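/- Let $(M^{2n},g,J)$ be a closed connected Kähler manifold of real dimension $2n\ge 4$, where $g$ is allowed to have arbitrary signature: $g$ is a pseudo-Riemannian metric and $J$ an almost complex structure with $g(J\cdot,J\cdot)=g$ and $\nabla J=0$, $\nabla$ being the Levi-Civita connection of $g$. Consider pairs $(a,\lambda)$ of a smooth symmetric hermitian $(0,2)$-tensor $a$ and a smooth one-form $\lambda$ that solve the $h$-projective equation $$a_{ij,k}=\lambda_i g_{jk}+\lambda_j g_{ik}-\bar\lambda_i J_{jk}-\bar\lambda_j J_{ik},\qquad \bar\lambda_i=J^{\alpha}{}_{i}\lambda_\alpha,\quad J_{jk}=g_{j\alpha}J^{\alpha}{}_{k},$$ and assume that the degree of mobility of $g$, i.e. the dimension of the vector space of these solutions, is at least $3$. A real number $B$ is a constant of the extended system if there are a solution $(a,\lambda)$ of the $h$-projective equation, with $a$ not a constant multiple of $g$, and a smooth function $\mu$ such that $$\lambda_{i,j}=\mu g_{ij}+Ba_{ij},\qquad \mu_{,i}=2B\lambda_i .$$ Suppose that this constant is zero, i.e. that $B=0$ is a constant of the extended system. Then $\lambda\equiv 0$ on $M$ for every solution $(a,\lambda)$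 of the $h$-projective equation. In particular, every metric $\bar g$ (of arbitrary signature) that is Kähler with respect to $J$ and $h$-projectively equivalent to $g$ is affinely equivalent to $g$, i.e. has the same Levi-Civita connection. Here $g$ and $\bar g$ are $h$-projectively equivalent if they have the same $h$-planar curves, the $h$-planar curves of $g$ being the smooth curves $\gamma$ with $\nabla_{\dot\gamma}\dot\gamma=\alpha\dot\gamma+\beta J\dot\gamma$ for some functions $\alpha(t),\beta(t)$. -/

import Mathlib

open scoped Manifold ContDiff

/-! Closed manifolds are modelled on a finite-dimensional real vector space `E` (no boundary).
Tensor fields are sections over the tangent spaces of `M`; smoothness and covariant derivatives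
are expressed through their components in the charts of the atlas. -/

namespace HProj

noncomputable section

section Local

/-! ### Levi-Civita calculus on a vector space: `G` is a field of bilinear forms on `E` -/

variable {E : Type*} [NormedAddCommGroup E] [NormedSpace ℝ E]

/-- The Christoffel symbols of the first kind:
`z ↦ (D_u G(v, z) + D_v G(u, z) - D_z G(u, v)) / 2` at the point `y`. -/
def christoffelLower (G : E → E →L[ℝ] E →L[ℝ] ℝ) (y u v : E) : E →L[ℝ] ℝ :=
  (2⁻¹ : ℝ) • (fderiv ℝ G y u v + fderiv ℝ G y v u - ((fderiv ℝ G y).flip u).flip v)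

/-- The Christoffel symbols (of the second kind) `Γ(u, v)` of `G` at `y`: the index is raised with
the inverse of `w ↦ G(w, ·)`. -/
def christoffel (G : E → E →L[ℝ] E →L[ℝ] ℝ) (y u v : E) : E :=
  (G y).inverse (christoffelLower G y u v)

/-- Covariant derivative of a one-form: `(∇_w L)(u)`. -/
def covDeriv01 (G : E → E →L[ℝ] E →L[ℝ] ℝ) (L : E → E →L[ℝ] ℝ) (y w u : E) : ℝ :=
  fderiv ℝ L y w u - L y (christoffel G y w u)

/-- Covariant derivative of a `(0,2)`-tensor: `(∇_w A)(u, v)`. -/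
def covDeriv02 (G A : E → E →L[ℝ] E →L[ℝ] ℝ) (y w u v : E) : ℝ :=
  fderiv ℝ A y w u v - A y (christoffel G y w u) v - A y u (christoffel G y w v)

/-- Covariant derivative of a field of endomorphisms: `(∇_w K)(u)`. -/
def covDeriv11 (G : E → E →L[ℝ] E →L[ℝ] ℝ) (K : E → E →L[ℝ] E) (y w u : E) : E :=
  fderiv ℝ K y w u + christoffel G y w (K y u) - K y (christoffel G y w u)

end Local

section Manifold

variable {E : Type*} [NormedAddCommGroup E] [NormedSpace ℝ E]
  {M : Type*} [TopologicalSpace M] [ChartedSpace E M]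

variable (E M) in
/-- One-forms on `M`. -/
abbrev Tensor01 := (x : M) → TangentSpace 𝓘(ℝ, E) x →L[ℝ] ℝ

variable (E M) in
/-- Fields of bilinear forms on `M`. -/
abbrev Tensor02 := (x : M) → TangentSpace 𝓘(ℝ, E) x →L[ℝ] TangentSpace 𝓘(ℝ, E) x →L[ℝ] ℝ

variable (E M) in
/-- Fields of endomorphisms of the tangent spaces of `M`. -/
abbrev Tensor11 := (x : M) → TangentSpace 𝓘(ℝ, E) x →L[ℝ] TangentSpace 𝓘(ℝ, E) x

/-! ### Components in a chart `φ`; they are only used at points `y ∈ φ.target` -/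

/-- The differential of the inverse of the chart `φ` at `y`. -/
def frame (φ : OpenPartialHomeomorph M E) (y : E) : E →L[ℝ] TangentSpace 𝓘(ℝ, E) (φ.symm y) :=
  mfderiv 𝓘(ℝ, E) 𝓘(ℝ, E) φ.symm y

/-- The differential of the chart `φ` at the point of `M` with coordinates `y`. -/
def coframe (φ : OpenPartialHomeomorph M E) (y : E) : TangentSpace 𝓘(ℝ, E) (φ.symm y) →L[ℝ] E :=
  mfderiv 𝓘(ℝ, E) 𝓘(ℝ, E) φ (φ.symm y)

/-- The components of a one-form: `u ↦ L(dφ⁻¹ u)`. -/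
def loc01 (φ : OpenPartialHomeomorph M E) (L : Tensor01 E M) (y : E) : E →L[ℝ] ℝ :=
  (L (φ.symm y)).comp (frame φ y)

/-- The components of a `(0,2)`-tensor: `(u, v) ↦ A(dφ⁻¹ u, dφ⁻¹ v)`. -/
def loc02 (φ : OpenPartialHomeomorph M E) (A : Tensor02 E M) (y : E) : E →L[ℝ] E →L[ℝ] ℝ :=
  ContinuousLinearMap.bilinearComp (E := E) (F := E) (A (φ.symm y)) (frame φ y) (frame φ y)

/-- The components of a field of endomorphisms: `u ↦ dφ (K (dφ⁻¹ u))`. -/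
def loc11 (φ : OpenPartialHomeomorph M E) (K : Tensor11 E M) (y : E) : E →L[ℝ] E :=
  (coframe φ y).comp ((K (φ.symm y)).comp (frame φ y))

/-- A smooth one-form. -/
def Smooth01 (L : Tensor01 E M) : Prop :=
  ∀ φ ∈ atlas E M, ContDiffOn ℝ ∞ (loc01 φ L) φ.target

/-- A smooth `(0,2)`-tensor field. -/
def Smooth02 (A : Tensor02 E M) : Prop :=
  ∀ φ ∈ atlas E M, ContDiffOn ℝ ∞ (loc02 φ A) φ.target

/-- A smooth `(1,1)`-tensor field. -/
def Smooth11 (K : Tensor11 E M) : Prop :=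
  ∀ φ ∈ atlas E M, ContDiffOn ℝ ∞ (loc11 φ K) φ.target

/-- `(g, J)` is a Kähler structure on `M`, where `g` may have arbitrary signature: `g` is a
pseudo-Riemannian metric and `J` is an almost complex structure that is orthogonal for `g` and
parallel for the Levi-Civita connection of `g` (hence is integrable). -/
structure IsKahler (g : Tensor02 E M) (J : Tensor11 E M) : Prop where
  smooth_metric : Smooth02 g
  symm : ∀ x u v, g x u v = g x v u
  nondegenerate : ∀ x u, (∀ v, g x u v = 0) → u = 0
  smooth_complex : Smooth11 J
  complex_sq : ∀ x u, J x (J x u) = -u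
  hermitian : ∀ x u v, g x (J x u) (J x v) = g x u v
  parallel : ∀ φ ∈ atlas E M, ∀ y ∈ φ.target, ∀ w u : E,
    covDeriv11 (loc02 φ g) (loc11 φ J) y w u = 0

/-- A smooth curve `γ`, defined on the open interval `I`, is `h`-planar for `(g, J)` if
`∇_γ' γ' = α γ' + β J γ'` for some functions `α`, `β` of the parameter. -/
def IsHPlanar (g : Tensor02 E M) (J : Tensor11 E M) (I : Set ℝ) (γ : ℝ → M) : Prop :=
  ContMDiffOn 𝓘(ℝ, ℝ) 𝓘(ℝ, E) ∞ γ I ∧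
    ∃ α β : ℝ → ℝ, ∀ φ ∈ atlas E M, ∀ t ∈ I, γ t ∈ φ.source →
      deriv (deriv fun s => φ (γ s)) t
          + christoffel (loc02 φ g) (φ (γ t))
              (deriv (fun s => φ (γ s)) t) (deriv (fun s => φ (γ s)) t)
        = α t • deriv (fun s => φ (γ s)) t
          + β t • loc11 φ J (φ (γ t)) (deriv (fun s => φ (γ s)) t)

/-- `g` and `gbar` have the same `h`-planar curves. -/
def HProjectivelyEquivalent (g gbar : Tensor02 E M) (J : Tensor11 E M) : Prop :=
  ∀ I : Set ℝ, IsOpen I → I.OrdConnected → ∀ γ : ℝ → M,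
    IsHPlanar g J I γ ↔ IsHPlanar gbar J I γ

/-- `g` and `gbar` have the same Levi-Civita connection. -/
def AffinelyEquivalent (g gbar : Tensor02 E M) : Prop :=
  ∀ φ ∈ atlas E M, ∀ y ∈ φ.target, ∀ u v : E,
    christoffel (loc02 φ g) y u v = christoffel (loc02 φ gbar) y u v

/-- The pair `(a, lam)` of smooth tensor fields, with `a` symmetric and hermitian, solves the
`h`-projective equation
`(∇_w a)(u, v) = λ(u) g(v, w) + λ(v) g(u, w) - λ(J u) g(v, J w) - λ(J v) g(u, J w)`. -/
structure IsHprSolution (g : Tensor02 E M) (J : Tensor11 E M) (a : Tensor02 E M)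
    (lam : Tensor01 E M) : Prop where
  smooth_tensor : Smooth02 a
  smooth_form : Smooth01 lam
  symm : ∀ x u v, a x u v = a x v u
  hermitian : ∀ x u v, a x (J x u) (J x v) = a x u v
  eqn : ∀ φ ∈ atlas E M, ∀ y ∈ φ.target, ∀ w u v : E,
    covDeriv02 (loc02 φ g) (loc02 φ a) y w u v
      = loc01 φ lam y u * loc02 φ g y v w + loc01 φ lam y v * loc02 φ g y u w
        - loc01 φ lam y (loc11 φ J y u) * loc02 φ g y v (loc11 φ J y w)
        - loc01 φ lam y (loc11 φ J y v) * loc02 φ g y u (loc11 φ J y w)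

/-- The triple `(a, lam, mu)` solves the extended system with the constant `B`: `(a, lam)` solves
the `h`-projective equation, `∇ lam = mu g + B a`, and `d mu = 2 B lam`. -/
structure IsExtendedSolution (g : Tensor02 E M) (J : Tensor11 E M) (B : ℝ) (a : Tensor02 E M)
    (lam : Tensor01 E M) (mu : M → ℝ) : Prop where
  hpr : IsHprSolution g J a lam
  smooth_function : ContMDiff 𝓘(ℝ, E) 𝓘(ℝ, ℝ) ∞ mu
  hessian : ∀ φ ∈ atlas E M, ∀ y ∈ φ.target, ∀ w u : E,
    covDeriv01 (loc02 φ g) (loc01 φ lam) y w u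
      = mu (φ.symm y) * loc02 φ g y u w + B * loc02 φ a y u w
  gradient : ∀ φ ∈ atlas E M, ∀ y ∈ φ.target, ∀ u : E,
    fderiv ℝ (fun z => mu (φ.symm z)) y u = 2 * B * loc01 φ lam y u

/-- `B` is a constant of the extended system of `(g, J)`: it is the constant of the extended system
that some solution `(a, lam)` of the `h`-projective equation, with `a` not a constant multiple of
`g`, satisfies together with some function `mu`. -/
def IsExtendedConstant (g : Tensor02 E M) (J : Tensor11 E M) (B : ℝ) : Prop :=
  ∃ (a : Tensor02 E M) (lam : Tensor01 E M) (mu : M → ℝ),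
    IsExtendedSolution g J B a lam mu ∧ ¬ ∃ c : ℝ, ∀ x, a x = c • g x

/-! ### The solution space is a vector space -/

theorem loc01_add (φ : OpenPartialHomeomorph M E) (L L' : Tensor01 E M) :
    loc01 φ (L + L') = loc01 φ L + loc01 φ L' := rfl

theorem loc02_add (φ : OpenPartialHomeomorph M E) (A A' : Tensor02 E M) :
    loc02 φ (A + A') = loc02 φ A + loc02 φ A' := rfl

theorem loc01_smul (φ : OpenPartialHomeomorph M E) (c : ℝ) (L : Tensor01 E M) :
    loc01 φ (c • L) = c • loc01 φ L := rfl

theorem loc02_smul (φ : OpenPartialHomeomorph M E) (c : ℝ) (A : Tensor02 E M) :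
    loc02 φ (c • A) = c • loc02 φ A := rfl

theorem Smooth02.differentiableAt {A : Tensor02 E M} (hA : Smooth02 A)
    {φ : OpenPartialHomeomorph M E} (hφ : φ ∈ atlas E M) {y : E} (hy : y ∈ φ.target) :
    DifferentiableAt ℝ (loc02 φ A) y :=
  ((hA φ hφ).contDiffAt (φ.open_target.mem_nhds hy)).differentiableAt (by simp)

theorem IsHprSolution.add {g : Tensor02 E M} {J : Tensor11 E M} {a a' : Tensor02 E M}
    {lam lam' : Tensor01 E M} (h : IsHprSolution g J a lam) (h' : IsHprSolution g J a' lam') :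
    IsHprSolution g J (a + a') (lam + lam') where
  smooth_tensor φ hφ := by
    rw [loc02_add]; exact (h.smooth_tensor φ hφ).add (h'.smooth_tensor φ hφ)
  smooth_form φ hφ := by
    rw [loc01_add]; exact (h.smooth_form φ hφ).add (h'.smooth_form φ hφ)
  symm x u v := congrArg₂ (· + ·) (h.symm x u v) (h'.symm x u v)
  hermitian x u v := congrArg₂ (· + ·) (h.hermitian x u v) (h'.hermitian x u v)
  eqn φ hφ y hy w u v := by
    have e := h.eqn φ hφ y hy w u v
    have e' := h'.eqn φ hφ y hy w u v
    have d : fderiv ℝ (loc02 φ (a + a')) y = fderiv ℝ (loc02 φ a) y + fderiv ℝ (loc02 φ a') y := by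
      have d0 := fderiv_add (𝕜 := ℝ) (E := E) (F := E →L[ℝ] E →L[ℝ] ℝ) (h.smooth_tensor.differentiableAt hφ hy)
        (h'.smooth_tensor.differentiableAt hφ hy)
      exact d0
    simp only [covDeriv02] at e e' ⊢
    rw [d, loc02_add, loc01_add]
    simp only [Pi.add_apply, add_apply]
    linear_combination e + e'

theorem IsHprSolution.smul {g : Tensor02 E M} {J : Tensor11 E M} {a : Tensor02 E M}
    {lam : Tensor01 E M} (c : ℝ) (h : IsHprSolution g J a lam) :
    IsHprSolution g J (c • a) (c • lam) where
  smooth_tensor φ hφ := by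
    rw [loc02_smul]; exact (h.smooth_tensor φ hφ).const_smul c
  smooth_form φ hφ := by
    rw [loc01_smul]; exact (h.smooth_form φ hφ).const_smul c
  symm x u v := congrArg (c * ·) (h.symm x u v)
  hermitian x u v := congrArg (c * ·) (h.hermitian x u v)
  eqn φ hφ y hy w u v := by
    have e := h.eqn φ hφ y hy w u v
    have d : fderiv ℝ (loc02 φ (c • a)) y = c • fderiv ℝ (loc02 φ a) y := by
      have d0 := fderiv_const_smul (𝕜 := ℝ) (E := E) (F := E →L[ℝ] E →L[ℝ] ℝ) (h.smooth_tensor.differentiableAt hφ hy) c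
      exact d0
    simp only [covDeriv02] at e ⊢
    rw [d, loc02_smul, loc01_smul]
    simp only [Pi.smul_apply, smul_apply, smul_eq_mul]
    linear_combination c * e

/-- The space of solutions `(a, lam)` of the `h`-projective equation. -/
def solutionSpace (g : Tensor02 E M) (J : Tensor11 E M) :
    Submodule ℝ (Tensor02 E M × Tensor01 E M) where
  carrier := {p | IsHprSolution g J p.1 p.2}
  add_mem' h h' := h.add h'
  zero_mem' := by
    have h0 : ∀ φ : OpenPartialHomeomorph M E, loc02 φ (0 : Tensor02 E M) = 0 := fun _ => rfl
    have h1 : ∀ φ : OpenPartialHomeomorph M E, loc01 φ (0 : Tensor01 E M) = 0 := fun _ => rfl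
    refine ⟨fun φ _ => ?_, fun φ _ => ?_, fun _ _ _ => rfl, fun _ _ _ => rfl,
      fun φ _ y _ w u v => ?_⟩
    · exact (h0 φ).symm ▸ contDiffOn_const
    · exact (h1 φ).symm ▸ contDiffOn_const
    · simp [covDeriv02, h0, h1]
  smul_mem' c _ h := h.smul c

/-- The degree of mobility: the dimension of the solution space of the `h`-projective equation. -/
def degreeOfMobility (g : Tensor02 E M) (J : Tensor11 E M) : Cardinal :=
  Module.rank ℝ (solutionSpace g J)

end Manifold

end

end HProj

set_option maxSynthPendingDepth 3
namespace HProj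

/-! ### Linear algebra of the integrability condition. -/

section LinearAlgebra

variable {E : Type*} [NormedAddCommGroup E] [NormedSpace ℝ E]

/-! The engine is one compactness argument, used twice (`IsKahler.form_eq_zero_of_hessian`): on a
closed manifold a solution `(a, λ)` with `∇λ = c g`, `c` constant, has `λ = 0`, whatever the
signature. Two functions have `λ` as their differential up to a factor: `d tr(g⁻¹a) = 4λ` and `d|λ|²
= 2cλ`. If `c = 0`, then `λ` is parallel and vanishes where `tr(g⁻¹a)` is maximal, hence everywhere.
If `c ≠ 0`, then `λ` vanishes where `|λ|²` is maximal and where it is minimal; both extreme values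
are therefore `0`, so `|λ|²` is constant and its differential `2cλ` is zero.

When `B = 0` the function `μ` of the distinguished solution `(a₀, λ₀, μ)` is constant, so the
argument gives `λ₀ = 0`: the tensor `a₀` is parallel, and being parallel and not a multiple of `g`
it is a multiple of `g` at no point.

Now let `(a, λ)` be any solution. A parallel `a₀` commutes with the curvature, and by pair symmetry
`R(a₀X, X) = 0` (`IsKahlerOn.curv_parallel_apply_self`). Inserting the pair `(a₀X, X)` into the
Ricci identity for `a` (`IsKahlerOn.integrability`) removes the curvature and leaves a purely
algebraic relation between `∇λ`, which is symmetric because `λ` is exact, and `a₀`. Its trace and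
its diagonal together say that the quadratic forms of the trace-free parts of `∇λ` and of `a₀` have
product zero, so one of them vanishes; it is not that of `a₀`, whence `∇λ = μ g` for a function `μ`
(`eq_smul_of_integrability`). The same pair in the Ricci identity for `λ` gives `dμ(a₀X) X = dμ(X)
a₀X`, which forces `dμ = 0` since `a₀` commutes with `J` (`IsKahlerOn.fderiv_hessian_factor`). So
`∇λ = c g` with `c` constant, and the compactness argument applies again: `λ = 0`.

For an `h`-projectively equivalent `ḡ` the difference of the two connections is `ψ(u)v + ψ(v)u -
ψ(Ju)Jv - ψ(Jv)Ju`, and taking traces identifies `ψ` with the differential of a multiple `f` of the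
logarithm of `|det(g⁻¹ḡ)|` (`IsKahler.christoffelDiff_eq`). Then `e^{2f} g ḡ⁻¹ g` solves the
`h`-projective equation with `λ = -e^{2f} df ∘ (ḡ⁻¹g)` (`IsKahler.isHprSolution_equivalent`). Since
`λ = 0` and `ḡ⁻¹g` is invertible, `df = 0` and the connections agree. -/

theorem symm_eq_zero_of_self {P : E →L[ℝ] E →L[ℝ] ℝ} (hP : ∀ u v, P u v = P v u)
    (h : ∀ u, P u u = 0) (u v : E) : P u v = 0 := by
  have h1 := h (u + v)
  have h2 := h u
  have h3 := h v
  have h4 := hP u v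
  simp only [map_add, add_apply] at h1
  linarith

/-- The product of two quadratic forms vanishes only if one of them does. -/
theorem symm_eq_zero_or_eq_zero {P Q : E →L[ℝ] E →L[ℝ] ℝ} (hP : ∀ u v, P u v = P v u)
    (hQ : ∀ u v, Q u v = Q v u) (h : ∀ u, P u u * Q u u = 0) :
    (∀ u v, P u v = 0) ∨ (∀ u v, Q u v = 0) := by
  by_contra hcon
  push Not at hcon
  obtain ⟨⟨u0, v0, h1⟩, ⟨u1, v1, h2⟩⟩ := hcon
  have hu : ∃ u, P u u ≠ 0 := by
    by_contra hc
    push Not at hc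
    exact h1 (symm_eq_zero_of_self hP hc _ _)
  have hv : ∃ u, Q u u ≠ 0 := by
    by_contra hc
    push Not at hc
    exact h2 (symm_eq_zero_of_self hQ hc _ _)
  obtain ⟨u, hu⟩ := hu
  obtain ⟨v, hv⟩ := hv
  have hQu : Q u u = 0 := (mul_eq_zero.1 (h u)).resolve_left hu
  have hPv : P v v = 0 := (mul_eq_zero.1 (h v)).resolve_right hv
  -- On the line `u + s v` the product is a polynomial in `s` without constant term, of degree at
  -- most three; the values at `1`, `-1`, `2` determine its coefficients.
  have key : ∀ s : ℝ, (P u u + 2 * s * P u v) * (2 * s * Q u v + s ^ 2 * Q v v) = 0 := by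
    intro s
    have := h (u + s • v)
    simp only [map_add, add_apply, map_smul, smul_apply, smul_eq_mul, hQu, hPv, hP v u, hQ v u]
      at this
    linear_combination this
  have k1 := key 1
  have k2 := key (-1)
  have k3 := key 2
  have m0 : P u u * Q u v = 0 := by linear_combination (1 / 2) * k1 - (1 / 6) * k2 - (1 / 12) * k3
  have m1 : Q u v = 0 := (mul_eq_zero.1 m0).resolve_left hu
  rw [m1] at k1 k2
  have : P u u * Q v v = 0 := by linear_combination (1 / 2) * k1 + (1 / 2) * k2
  exact (mul_ne_zero hu hv) this

variable [FiniteDimensional ℝ E]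

/-- A nondegenerate bilinear form as an isomorphism onto the dual space. -/
noncomputable def flatEquiv (G : E →L[ℝ] E →L[ℝ] ℝ) (hG : ∀ u, (∀ v, G u v = 0) → u = 0) :
    E ≃L[ℝ] (E →L[ℝ] ℝ) :=
  (LinearEquiv.ofInjectiveOfFinrankEq G.toLinearMap
    (by
      rw [← LinearMap.ker_eq_bot, LinearMap.ker_eq_bot']
      intro u hu
      exact hG u fun v => by
        have := DFunLike.congr_fun hu v
        simpa using this)
    (by
      rw [← (LinearMap.toContinuousLinearMap (𝕜 := ℝ) (E := E) (F' := ℝ)).finrank_eq]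
      exact (Subspace.dual_finrank_eq (K := ℝ) (V := E)).symm)).toContinuousLinearEquiv

theorem coe_flatEquiv (G : E →L[ℝ] E →L[ℝ] ℝ) (hG : ∀ u, (∀ v, G u v = 0) → u = 0) :
    (flatEquiv G hG : E →L[ℝ] E →L[ℝ] ℝ) = G := by
  ext u v
  rfl

/-- `ContinuousLinearMap.inverse` is zero on non-invertible maps; in finite dimension nondegeneracy
makes `G` invertible, so here it is the true inverse. -/
theorem apply_inverse {G : E →L[ℝ] E →L[ℝ] ℝ} (hG : ∀ u, (∀ v, G u v = 0) → u = 0)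
    (l : E →L[ℝ] ℝ) : G (G.inverse l) = l := by
  have h := coe_flatEquiv G hG
  conv_lhs => rw [← h, ContinuousLinearMap.inverse_equiv]
  simp

theorem inverse_apply {G : E →L[ℝ] E →L[ℝ] ℝ} (hG : ∀ u, (∀ v, G u v = 0) → u = 0)
    (u : E) : G.inverse (G u) = u := by
  have h := coe_flatEquiv G hG
  rw [← h, ContinuousLinearMap.inverse_equiv]
  simp

/-- The isomorphism `G` of `E` with its dual conjugates `S` to the transpose of `S'`. -/
theorem trace_eq_of_adjoint {G : E →L[ℝ] E →L[ℝ] ℝ} (hG : ∀ u, (∀ v, G u v = 0) → u = 0)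
    {S S' : E →ₗ[ℝ] E} (h : ∀ u v, G (S u) v = G u (S' v)) :
    LinearMap.trace ℝ E S = LinearMap.trace ℝ E S' := by
  let e : E ≃ₗ[ℝ] Module.Dual ℝ E :=
    (flatEquiv G hG).toLinearEquiv.trans (LinearMap.toContinuousLinearMap (𝕜 := ℝ)).symm
  rw [← LinearMap.trace_transpose' S', ← LinearMap.trace_conj' S e]
  congr 1
  ext l v
  obtain ⟨u, rfl⟩ := e.surjective l
  simp only [LinearEquiv.conj_apply_apply, LinearEquiv.symm_apply_apply]
  exact h u v

/-- The trace over the first and last arguments of the integrability condition `hI`. -/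
theorem trace_integrability {G T : E →L[ℝ] E →L[ℝ] ℝ} {J a t : E →ₗ[ℝ] E}
    (hG : ∀ u, (∀ v, G u v = 0) → u = 0) (hGs : ∀ u v, G u v = G v u)
    (hTs : ∀ u v, T u v = T v u) (hJ : ∀ u, J (J u) = -u) (hGJ : ∀ u v, G (J u) v = -G u (J v))
    (ha : ∀ u v, G (a u) v = G u (a v)) (haJ : ∀ u, a (J u) = J (a u))
    (ht : ∀ u v, G (t u) v = T u v)
    (hI : ∀ X Z W, T (a X) Z * G W X + T (a X) W * G Z X
      - T (a X) (J Z) * G W (J X) - T (a X) (J W) * G Z (J X)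
      = T X Z * G W (a X) + T X W * G Z (a X)
      - T X (J Z) * G W (J (a X)) - T X (J W) * G Z (J (a X))) (X Z : E) :
    Module.finrank ℝ E * T (a X) Z + LinearMap.trace ℝ E (t ∘ₗ a) * G X Z
      = LinearMap.trace ℝ E a * T X Z + LinearMap.trace ℝ E t * G (a X) Z := by
  -- `J` is skew for `G` while `t` and `a` are self-adjoint. Hence each of `J`, `Jt`, `Ja`, `Jta`
  -- has the opposite trace of itself, using cyclicity and, for the last one, `aJ = Ja`. No
  -- invariance of `T` under `J` is needed.
  have trJ : LinearMap.trace ℝ E J = 0 := by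
    have := trace_eq_of_adjoint hG (S := J) (S' := -J) (by simpa using hGJ)
    rw [map_neg] at this; linarith
  have htG : ∀ u v, G u (t v) = T u v := fun u v => by rw [hGs, ht, hTs]
  have htG' : ∀ u v, G (t u) v = G u (t v) := fun u v => by rw [ht, htG]
  have trJt : LinearMap.trace ℝ E (J ∘ₗ t) = 0 := by
    have := trace_eq_of_adjoint hG (S := J ∘ₗ t) (S' := -(t ∘ₗ J))
      (by intro u v; simp [hGJ, htG'])
    rw [map_neg, LinearMap.trace_comp_comm'] at this
    rw [LinearMap.trace_comp_comm']
    linarith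
  have trJa : LinearMap.trace ℝ E (J ∘ₗ a) = 0 := by
    have := trace_eq_of_adjoint hG (S := J ∘ₗ a) (S' := -(a ∘ₗ J))
      (by intro u v; simp [hGJ, ha])
    rw [map_neg, LinearMap.trace_comp_comm'] at this
    rw [LinearMap.trace_comp_comm']
    linarith
  have trJta : LinearMap.trace ℝ E (J ∘ₗ t ∘ₗ a) = 0 := by
    have h1 := trace_eq_of_adjoint hG (S := J ∘ₗ t ∘ₗ a) (S' := -((a ∘ₗ t) ∘ₗ J))
      (by intro u v; simp [hGJ, ha, htG'])
    have h2 : J ∘ₗ a ∘ₗ t = a ∘ₗ J ∘ₗ t := by ext u; simp [haJ]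
    have h3 : (J ∘ₗ t) ∘ₗ a = J ∘ₗ t ∘ₗ a := rfl
    have h4 : LinearMap.trace ℝ E ((a ∘ₗ t) ∘ₗ J) = LinearMap.trace ℝ E (J ∘ₗ t ∘ₗ a) := by
      rw [LinearMap.trace_comp_comm', h2, LinearMap.trace_comp_comm', h3]
    rw [map_neg, h4] at h1
    linarith
  -- Polarization of `hI` in `X`: a trace needs an argument that enters linearly.
  have hI2 : ∀ Y W, T (a X) Z * G W Y + T (a Y) Z * G W X + T (a X) W * G Z Y + T (a Y) W * G Z X
      - T (a X) (J Z) * G W (J Y) - T (a Y) (J Z) * G W (J X)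
      - T (a X) (J W) * G Z (J Y) - T (a Y) (J W) * G Z (J X)
      - (T X Z * G W (a Y) + T Y Z * G W (a X) + T X W * G Z (a Y) + T Y W * G Z (a X)
      - T X (J Z) * G W (J (a Y)) - T Y (J Z) * G W (J (a X))
      - T X (J W) * G Z (J (a Y)) - T Y (J W) * G Z (J (a X))) = 0 := by
    intro Y W
    have h1 := hI (X + Y) Z W
    have h2 := hI X Z W
    have h3 := hI Y Z W
    simp only [map_add, add_apply] at h1
    linear_combination h1 - h2 - h3
  let g : E → E →ₗ[ℝ] ℝ := fun u => (G u).toLinearMap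
  let T' : E → E →ₗ[ℝ] ℝ := fun u => (T u).toLinearMap
  -- `K` is the operator for which `hI2` reads `G(W, K Y) = 0`. In `tr K = 0` the terms containing a
  -- trace of `J`, `Jt`, `Ja` or `Jta` vanish and the rank-one terms of the two sides cancel.
  let K : E →ₗ[ℝ] E := T (a X) Z • LinearMap.id + (T' Z ∘ₗ a).smulRight X + (g Z).smulRight (t (a X))
    + G Z X • (t ∘ₗ a) - T (a X) (J Z) • J - (T' (J Z) ∘ₗ a).smulRight (J X)
    + (g Z ∘ₗ J).smulRight (J (t (a X))) + G Z (J X) • (J ∘ₗ t ∘ₗ a)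
    - (T X Z • a + (T' Z).smulRight (a X) + (g Z ∘ₗ a).smulRight (t X)
    + G Z (a X) • t - T X (J Z) • (J ∘ₗ a) - (T' (J Z)).smulRight (J (a X))
    + (g Z ∘ₗ J ∘ₗ a).smulRight (J (t X)) + G Z (J (a X)) • (J ∘ₗ t))
  have hK : K = 0 := by
    ext Y
    rw [LinearMap.zero_apply]
    refine hG _ fun W => ?_
    rw [hGs]
    have h := hI2 Y W
    have e : ∀ u, G W (J (t u)) = - T u (J W) := fun u => by
      rw [hGs, hGJ, ht]
    simp only [K, g, T', LinearMap.add_apply, LinearMap.sub_apply, LinearMap.smul_apply,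
      LinearMap.smulRight_apply, LinearMap.comp_apply, LinearMap.id_apply, map_add, map_sub,
      map_smul, smul_eq_mul, ContinuousLinearMap.coe_coe, e, htG]
    simp only [hTs Z, hTs (J Z), hTs W]
    linear_combination h
  have htr := congrArg (LinearMap.trace ℝ E) hK
  simp only [K, map_add, map_sub, map_smul, LinearMap.trace_smulRight, smul_eq_mul, map_zero,
    LinearMap.trace_id, trJ, trJt, trJa, trJta] at htr
  simp only [g, T', LinearMap.comp_apply, ContinuousLinearMap.coe_coe, htG, haJ, hJ, map_neg] at htr
  have e1 : G Z (t X) = T Z X := htG _ _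
  rw [hTs Z (a X), hTs (J Z) (J (a X)), hGs Z X, hGs Z (a X)] at htr
  linear_combination htr

/-- A symmetric form `T` that satisfies the integrability condition for an operator `a` which is
not a multiple of the identity is a multiple of `G`. -/
theorem eq_smul_of_integrability {G T : E →L[ℝ] E →L[ℝ] ℝ} {J a : E →L[ℝ] E}
    (hG : ∀ u, (∀ v, G u v = 0) → u = 0) (hGs : ∀ u v, G u v = G v u)
    (hTs : ∀ u v, T u v = T v u) (hJ : ∀ u, J (J u) = -u) (hGJ : ∀ u v, G (J u) v = -G u (J v))
    (ha : ∀ u v, G (a u) v = G u (a v)) (haJ : ∀ u, a (J u) = J (a u))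
    (hI : ∀ X Z W, T (a X) Z * G W X + T (a X) W * G Z X
      - T (a X) (J Z) * G W (J X) - T (a X) (J W) * G Z (J X)
      = T X Z * G W (a X) + T X W * G Z (a X)
      - T X (J Z) * G W (J (a X)) - T X (J W) * G Z (J (a X))) :
    (∃ c : ℝ, ∀ u, a u = c • u) ∨ ∃ μ : ℝ, ∀ u v, T u v = μ * G u v := by
  let t : E →L[ℝ] E := G.inverse ∘L T
  have ht : ∀ u v, G (t u) v = T u v := fun u v => by
    simp only [t, ContinuousLinearMap.comp_apply, apply_inverse hG]
  have key := trace_integrability (J := J.toLinearMap) (a := a.toLinearMap) (t := t.toLinearMap)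
    hG hGs hTs hJ hGJ ha haJ ht hI
  simp only [ContinuousLinearMap.coe_coe] at key
  set N : ℝ := ((Module.finrank ℝ E : ℕ) : ℝ) with hN
  set k : ℝ := LinearMap.trace ℝ E (t.toLinearMap ∘ₗ a.toLinearMap)
  set p : ℝ := LinearMap.trace ℝ E a.toLinearMap
  set q : ℝ := LinearMap.trace ℝ E t.toLinearMap
  rcases subsingleton_or_nontrivial E with hE | hE
  · left; exact ⟨0, fun u => Subsingleton.elim _ _⟩
  have hN0 : N ≠ 0 := by
    simp only [hN, ne_eq, Nat.cast_eq_zero]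
    exact (Module.finrank_pos (R := ℝ) (M := E)).ne'
  have hop : N • (t.toLinearMap ∘ₗ a.toLinearMap) + k • LinearMap.id
      = p • t.toLinearMap + q • a.toLinearMap := by
    ext u
    rw [← sub_eq_zero]
    refine hG _ fun v => ?_
    have := key u v
    simp only [LinearMap.add_apply, LinearMap.smul_apply, LinearMap.comp_apply, LinearMap.id_apply,
      ContinuousLinearMap.coe_coe, map_add, map_sub, map_smul, add_apply,
      sub_apply, smul_apply, smul_eq_mul, ht]
    linear_combination this
  have htr := congrArg (LinearMap.trace ℝ E) hop
  simp only [map_add, map_smul, LinearMap.trace_id, smul_eq_mul, ← hN] at htr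
  -- With this value of `k`, `hop` says that the trace-free parts satisfy `(t - q/N)(a - p/N) = 0`.
  have hk : N * k = p * q := by
    change N * k + k * N = p * q + q * p at htr
    linarith
  -- On the diagonal the `J`-terms of `hI` drop out, leaving `T(au,u) G(u,u) = T(u,u) G(au,u)`. By
  -- this the product equals `G(u,u) G((t - q/N)(a - p/N)u, u)`, which is zero.
  have h0 : ∀ u, (T - (q / N) • G) u u * ((G ∘L a) - (p / N) • G) u u = 0 := by
    intro u
    have h1 := hI u u u
    have h2 : G u (J u) = 0 := by have := hGJ u u; rw [hGs] at this; linarith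
    have h3 : G u (J (a u)) = 0 := by
      have e1 := hGJ u (a u)
      rw [← ha, haJ, hGs] at e1
      linarith
    rw [h2, h3] at h1
    have h4 := key u u
    have h5 := ha u u
    have h6 := hGs u (a u)
    simp only [sub_apply, smul_apply, smul_eq_mul, ContinuousLinearMap.comp_apply]
    have h7 : T (a u) u * G u u = T u u * G u (a u) := by linear_combination (1 / 2) * h1
    field_simp
    rw [h5] at h4 ⊢
    linear_combination N * G u u * h4 - N * N * h7 - G u u ^ 2 * hk
  rcases symm_eq_zero_or_eq_zero (P := T - (q / N) • G) (Q := (G ∘L a) - (p / N) • G)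
    (fun u v => by
      simp only [sub_apply, smul_apply, smul_eq_mul]; rw [hTs, hGs])
    (fun u v => by
      simp only [sub_apply, smul_apply, smul_eq_mul, ContinuousLinearMap.comp_apply]
      rw [ha, hGs u v, hGs u]) h0 with h | h
  · right
    refine ⟨q / N, fun u v => ?_⟩
    have := h u v
    simp only [sub_apply, smul_apply, smul_eq_mul] at this
    linarith
  · left
    refine ⟨p / N, fun u => ?_⟩
    rw [← sub_eq_zero]
    refine hG _ fun v => ?_
    have := h u v
    simp only [sub_apply, smul_apply, smul_eq_mul, ContinuousLinearMap.comp_apply] at this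
    simpa using this

omit [FiniteDimensional ℝ E] in
-- If `θ(x) = 1`, then `x` is an eigenvector of `a`, say with eigenvalue `k`, and polarization puts
-- the image of `a - k` inside `ℝx`. That image is `J`-invariant and `J` has no real eigenvector, so
-- `a = k`.
theorem eq_zero_of_apply_smul_eq {J a : E →L[ℝ] E} (hJ : ∀ u, J (J u) = -u)
    (haJ : ∀ u, a (J u) = J (a u)) {θ : E →L[ℝ] ℝ} (h : ∀ u, θ (a u) • u = θ u • a u)
    (ha : ¬ ∃ c : ℝ, ∀ u, a u = c • u) : θ = 0 := by
  by_contra hθ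
  obtain ⟨x0, hx0⟩ : ∃ x, θ x ≠ 0 := by
    by_contra hc
    push Not at hc
    exact hθ (by ext x; simpa using hc x)
  obtain ⟨x, hx⟩ : ∃ x, θ x = 1 := ⟨(θ x0)⁻¹ • x0, by simp [hx0]⟩
  have hax : a x = θ (a x) • x := by have := h x; rw [hx, one_smul] at this; exact this.symm
  refine ha ⟨θ (a x), fun v => ?_⟩
  set k := θ (a x)
  have hb : ∀ v, a v - k • v = θ (a v - k • v) • x := by
    intro v
    have h1 := h (x + v)
    have h2 := h x
    have h3 := h v
    simp only [map_add, smul_add, add_smul] at h1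
    have h4 : k • v + θ (a v) • x = a v + (θ v * k) • x := by
      have : θ (a x) • v + θ (a v) • x = θ x • a v + θ v • a x := by
        linear_combination (norm := module) h1 - h2 - h3
      rw [hx, one_smul, hax, smul_smul] at this
      simpa [hx] using this
    simp only [map_sub, map_smul, smul_eq_mul, sub_smul]
    have h5 : a v = k • v + θ (a v) • x - (θ v * k) • x := by rw [h4]; abel
    nth_rw 1 [h5]
    rw [mul_comm]; abel
  have hbJ : a (J v) - k • J v = J (a v - k • v) := by simp [haJ]
  have h1 := hb (J v)
  rw [hbJ, hb v, map_smul] at h1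
  set s := θ (a v - k • v)
  have hs : s = 0 := by
    by_contra hs
    set r := θ (a (J v) - k • J v)
    have h2 : J x = (s⁻¹ * θ (J (s • x))) • x := by
      rw [map_smul, mul_smul, ← h1, smul_smul, inv_mul_cancel₀ hs, one_smul]
    set m := s⁻¹ * θ (J (s • x))
    have h3 := hJ x
    rw [h2, map_smul, h2, smul_smul] at h3
    have h4 := congrArg θ h3
    simp only [map_smul, map_neg, hx, smul_eq_mul] at h4
    -- `Jx = m x` would give `m² = -1`.
    nlinarith [mul_self_nonneg m]
  have := hb v
  change a v - k • v = s • x at this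
  rwa [hs, zero_smul, sub_eq_zero] at this

end LinearAlgebra

/-! ### Bilinear maps that preserve every line, over a field and in complex form. -/

section Projective

/-- Write `P(u,u) = 2c(u)u`. For independent `u`, `v` the parallelogram law for `P` compares
coefficients and makes `c` additive; homogeneity settles dependent vectors, and `ψ = c` by
polarization. -/
theorem exists_linear_of_apply_self_mem_span {K V : Type*} [Field K] [CharZero K] [AddCommGroup V]
    [Module K V] (P : V →ₗ[K] V →ₗ[K] V) (hP : ∀ u v, P u v = P v u)
    (h : ∀ u, ∃ c : K, P u u = c • u) :
    ∃ ψ : V →ₗ[K] K, ∀ u v, P u v = ψ u • v + ψ v • u := by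
  -- At `u = 0` the factor is arbitrary; it is fixed to be `0` so that `c` can be homogeneous.
  have h' : ∀ u, ∃ c : K, P u u = (2 * c) • u ∧ (u = 0 → c = 0) := by
    intro u
    by_cases hu : u = 0
    · exact ⟨0, by simp [hu]⟩
    · obtain ⟨c, hc⟩ := h u
      exact ⟨c / 2, by rw [hc]; congr 1; ring, fun h => absurd h hu⟩
  choose c hc hc0 using h'
  have hsmul : ∀ (z : K) u, c (z • u) = z * c u := by
    intro z u
    by_cases hz : z = 0
    · simp [hz, hc0]
    by_cases hu : u = 0
    · simp [hu, hc0]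
    have h1 := hc (z • u)
    rw [map_smul, map_smul, LinearMap.smul_apply, hc u, smul_smul, smul_smul, smul_smul] at h1
    have h2 := smul_left_injective K hu h1
    have : z * (2 : K) ≠ 0 := mul_ne_zero hz two_ne_zero
    apply mul_left_cancel₀ this
    linear_combination -h2
  have hadd : ∀ u v, c (u + v) = c u + c v := by
    intro u v
    by_cases hd : ∃ z : K, v = z • u
    · obtain ⟨z, rfl⟩ := hd
      have : u + z • u = (1 + z) • u := by rw [add_smul, one_smul]
      rw [this, hsmul, hsmul]; ring
    by_cases hu : u = 0
    · simp [hu, hc0]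
    have h1 := hc (u + v)
    have h2 := hc (u - v)
    have h3 := hc u
    have h4 := hc v
    have h5 : P (u + v) (u + v) + P (u - v) (u - v) = (2 : K) • P u u + (2 : K) • P v v := by
      simp only [map_add, map_sub, LinearMap.add_apply, LinearMap.sub_apply, two_smul]; abel
    rw [h1, h2, h3, h4] at h5
    have h6 : (2 * (c (u + v) + c (u - v) - 2 * c u)) • u
        + (2 * (c (u + v) - c (u - v) - 2 * c v)) • v = 0 := by
      linear_combination (norm := module) h5
    have h7 : 2 * (c (u + v) - c (u - v) - 2 * c v) = 0 := by
      by_contra hne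
      refine hd ⟨-((2 * (c (u + v) - c (u - v) - 2 * c v))⁻¹
        * (2 * (c (u + v) + c (u - v) - 2 * c u))), ?_⟩
      rw [neg_smul, mul_smul, eq_neg_of_add_eq_zero_left h6, smul_neg, smul_smul,
        inv_mul_cancel₀ hne, one_smul, neg_neg]
    rw [h7, zero_smul, add_zero] at h6
    have h8 := (smul_eq_zero.1 h6).resolve_right hu
    have : (4 : K) * (c (u + v)) = 4 * (c u + c v) := by linear_combination h7 + h8
    exact mul_left_cancel₀ (by norm_num) this
  refine ⟨{ toFun := c, map_add' := hadd, map_smul' := hsmul }, fun u v => ?_⟩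
  have h1 := hc (u + v)
  rw [hadd] at h1
  simp only [map_add, LinearMap.add_apply, hc, hP v u] at h1
  have h2 : (2 : K) • P u v = (2 : K) • (c u • v + c v • u) := by
    linear_combination (norm := module) h1
  exact smul_right_injective V (two_ne_zero (α := K)) h2

/-- A symmetric complex bilinear map with `P u u ∈ ℂ u`, in real terms. -/
theorem exists_form_of_apply_self {E : Type*} [AddCommGroup E] [Module ℝ E]
    (P : E →ₗ[ℝ] E →ₗ[ℝ] E) (J : E →ₗ[ℝ] E) (hJ : ∀ u, J (J u) = -u) (hP : ∀ u v, P u v = P v u)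
    (hPJ : ∀ u v, P u (J v) = J (P u v)) (h : ∀ u, ∃ α β : ℝ, P u u = α • u + β • J u) :
    ∃ ψ : E →ₗ[ℝ] ℝ, ∀ u v,
      P u v = ψ u • v + ψ v • u - ψ (J u) • J v - ψ (J v) • J u := by
  have hJ2 : J * J = -1 := by ext u; exact hJ u
  -- `J` makes `E` a complex vector space over which `P` is bilinear. For the complex form `ψ` one
  -- has `Im ψ(u) = -Re ψ(Ju)`, so its real part carries all the information.
  let L : ℂ →ₐ[ℝ] Module.End ℝ E := Complex.liftAux J hJ2
  let _ : Module ℂ E := Module.compHom E L.toRingHom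
  have hs : ∀ (z : ℂ) (u : E), z • u = z.re • u + z.im • J u := by
    intro z u
    change L z u = _
    simp [L, Complex.liftAux_apply, Algebra.algebraMap_eq_smul_one]
  have hJP : ∀ u v, P (J u) v = J (P u v) := fun u v => by rw [hP, hPJ, hP]
  let PC : E →ₗ[ℂ] E →ₗ[ℂ] E :=
    { toFun := fun u =>
        { toFun := fun v => P u v
          map_add' := fun v w => map_add _ _ _
          map_smul' := fun z v => by simp [hs, hPJ] }
      map_add' := fun u v => by ext w; simp
      map_smul' := fun z v => by ext w; simp [hs, hJP] }
  obtain ⟨ψ, hψ⟩ := exists_linear_of_apply_self_mem_span PC hP (fun u => by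
    obtain ⟨α, β, e⟩ := h u
    exact ⟨⟨α, β⟩, by rw [hs]; exact e⟩)
  have hI : ∀ u, J u = Complex.I • u := fun u => by simp [hs]
  refine ⟨{ toFun := fun u => (ψ u).re
            map_add' := fun u v => by simp
            map_smul' := fun r u => by
              have : r • u = (r : ℂ) • u := by simp [hs]
              rw [this, map_smul]; simp }, fun u v => ?_⟩
  have := hψ u v
  change P u v = _ at this
  rw [this, hs, hs]
  simp only [LinearMap.coe_mk, AddHom.coe_mk, hI, map_smul, smul_eq_mul, Complex.mul_re,
    Complex.I_re, Complex.I_im]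
  simp only [zero_mul, one_mul, zero_sub, neg_smul]
  abel

end Projective
end HProj
namespace HProj

/-! ### Levi-Civita connection, Ricci identities and curvature symmetries in coordinates. -/

section LocalCalculus

open Filter Topology

variable {E : Type*} [NormedAddCommGroup E] [NormedSpace ℝ E]

/-- A smooth pseudo-Riemannian metric on an open subset of a vector space. -/
structure IsMetricOn (G : E → E →L[ℝ] E →L[ℝ] ℝ) (U : Set E) : Prop where
  isOpen : IsOpen U
  smooth : ContDiffOn ℝ ∞ G U
  symm : ∀ y ∈ U, ∀ u v, G y u v = G y v u
  nondegenerate : ∀ y ∈ U, ∀ u, (∀ v, G y u v = 0) → u = 0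

section
variable {F : Type*} [NormedAddCommGroup F] [NormedSpace ℝ F]

theorem differentiableAt_of_smoothOn {f : E → F} {U : Set E} (hf : ContDiffOn ℝ ∞ f U)
    (hU : IsOpen U) {y : E} (hy : y ∈ U) : DifferentiableAt ℝ f y :=
  ((hf.contDiffAt (hU.mem_nhds hy)).differentiableAt (by simp))

theorem fderiv_clm_apply_apply {A : E → E →L[ℝ] E →L[ℝ] F} {p q : E → E} {y : E}
    (hA : DifferentiableAt ℝ A y) (hp : DifferentiableAt ℝ p y) (hq : DifferentiableAt ℝ q y)
    (z : E) : fderiv ℝ (fun x => A x (p x) (q x)) y z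
      = fderiv ℝ A y z (p y) (q y) + A y (fderiv ℝ p y z) (q y) + A y (p y) (fderiv ℝ q y z) := by
  have h := ((hA.hasFDerivAt.clm_apply hp.hasFDerivAt).clm_apply hq.hasFDerivAt).fderiv
  rw [h]
  simp
  abel

theorem fderiv_clm_apply_one {A : E → E →L[ℝ] F} {p : E → E} {y : E}
    (hA : DifferentiableAt ℝ A y) (hp : DifferentiableAt ℝ p y)
    (z : E) : fderiv ℝ (fun x => A x (p x)) y z
      = fderiv ℝ A y z (p y) + A y (fderiv ℝ p y z) := by
  have h := (hA.hasFDerivAt.clm_apply hp.hasFDerivAt).fderiv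
  rw [h]
  simp
  abel

theorem fderiv_apply_const {A : E → E →L[ℝ] F} {y : E} (hA : DifferentiableAt ℝ A y) (u z : E) :
    fderiv ℝ (fun x => A x u) y z = fderiv ℝ A y z u := by
  rw [fderiv_clm_apply_one hA (differentiableAt_const u)]; simp

theorem fderiv_apply_const_const {A : E → E →L[ℝ] E →L[ℝ] F} {y : E}
    (hA : DifferentiableAt ℝ A y) (u v z : E) :
    fderiv ℝ (fun x => A x u v) y z = fderiv ℝ A y z u v := by
  rw [fderiv_clm_apply_apply hA (differentiableAt_const u) (differentiableAt_const v)]; simp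

end

theorem christoffel_add_left (G : E → E →L[ℝ] E →L[ℝ] ℝ) (y u u' v : E) :
    christoffel G y (u + u') v = christoffel G y u v + christoffel G y u' v := by
  simp only [christoffel, ← map_add]
  congr 1
  ext z
  simp [christoffelLower]
  ring

theorem christoffel_add_right (G : E → E →L[ℝ] E →L[ℝ] ℝ) (y u v v' : E) :
    christoffel G y u (v + v') = christoffel G y u v + christoffel G y u v' := by
  simp only [christoffel, ← map_add]
  congr 1
  ext z
  simp [christoffelLower]
  ring

theorem christoffel_smul_left (G : E → E →L[ℝ] E →L[ℝ] ℝ) (y : E) (c : ℝ) (u v : E) :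
    christoffel G y (c • u) v = c • christoffel G y u v := by
  simp only [christoffel, ← map_smul]
  congr 1
  ext z
  simp [christoffelLower]
  ring

theorem christoffel_smul_right (G : E → E →L[ℝ] E →L[ℝ] ℝ) (y : E) (c : ℝ) (u v : E) :
    christoffel G y u (c • v) = c • christoffel G y u v := by
  simp only [christoffel, ← map_smul]
  congr 1
  ext z
  simp [christoffelLower]
  ring

/-- The curvature `R(z, w) u`. -/
noncomputable def curv (G : E → E →L[ℝ] E →L[ℝ] ℝ) (y z w u : E) : E :=
  fderiv ℝ (fun x => christoffel G x w u) y z - fderiv ℝ (fun x => christoffel G x z u) y w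
    + christoffel G y z (christoffel G y w u) - christoffel G y w (christoffel G y z u)

namespace IsMetricOn

variable {G : E → E →L[ℝ] E →L[ℝ] ℝ} {U : Set E} {y : E}

theorem contDiffAt (h : IsMetricOn G U) (hy : y ∈ U) : ContDiffAt ℝ ∞ G y :=
  h.smooth.contDiffAt (h.isOpen.mem_nhds hy)

theorem differentiableAt (h : IsMetricOn G U) (hy : y ∈ U) : DifferentiableAt ℝ G y :=
  differentiableAt_of_smoothOn h.smooth h.isOpen hy

theorem fderiv_symm (h : IsMetricOn G U) (hy : y ∈ U) (w u v : E) :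
    fderiv ℝ G y w u v = fderiv ℝ G y w v u := by
  rw [← fderiv_apply_const_const (h.differentiableAt hy),
    ← fderiv_apply_const_const (h.differentiableAt hy)]
  congr 1
  apply Filter.EventuallyEq.fderiv_eq
  filter_upwards [h.isOpen.mem_nhds hy] with x hx using h.symm x hx u v

theorem christoffel_symm (h : IsMetricOn G U) (hy : y ∈ U) (u v : E) :
    christoffel G y u v = christoffel G y v u := by
  simp only [christoffel]
  congr 1
  ext z
  simp [christoffelLower, h.fderiv_symm hy z u v]
  ring

variable [FiniteDimensional ℝ E]

theorem apply_christoffel (h : IsMetricOn G U) (hy : y ∈ U) (u v z : E) :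
    G y (christoffel G y u v) z
      = 2⁻¹ * (fderiv ℝ G y u v z + fderiv ℝ G y v u z - fderiv ℝ G y z u v) := by
  rw [christoffel, apply_inverse (h.nondegenerate y hy)]
  simp [christoffelLower]

theorem fderiv_eq (h : IsMetricOn G U) (hy : y ∈ U) (w u v : E) :
    fderiv ℝ G y w u v = G y (christoffel G y w u) v + G y u (christoffel G y w v) := by
  rw [h.symm y hy u, h.apply_christoffel hy, h.apply_christoffel hy, h.fderiv_symm hy v w u,
    h.fderiv_symm hy u w v, h.fderiv_symm hy w u v]
  ring

/-- The Christoffel symbols are characterized by symmetry and metric compatibility. -/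
theorem christoffel_unique (h : IsMetricOn G U) (hy : y ∈ U) {C : E → E → E}
    (hs : ∀ u v, C u v = C v u)
    (hc : ∀ w u v, fderiv ℝ G y w u v = G y (C w u) v + G y u (C w v)) (u v : E) :
    christoffel G y u v = C u v := by
  rw [← sub_eq_zero]
  refine h.nondegenerate y hy _ fun z => ?_
  -- The Koszul computation: metric compatibility of `C` in three cyclic positions and the symmetry
  -- of `C`.
  rw [map_sub, sub_apply, h.apply_christoffel hy, hc, hc, hc, hs v u, hs z u, hs z v,
    h.symm y hy v (C u z)]
  ring

theorem contDiffOn_inverse (h : IsMetricOn G U) : ContDiffOn ℝ ∞ (fun y => (G y).inverse) U := by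
  intro y hy
  have : CompleteSpace E := FiniteDimensional.complete ℝ E
  have h1 := contDiffAt_map_inverse (n := ∞) (flatEquiv (G y) (h.nondegenerate y hy))
  rw [coe_flatEquiv] at h1
  exact h1.comp_contDiffWithinAt y (h.smooth y hy)

/-- Joint smoothness in the point and both vectors is what the geodesic equation, as an ODE on `U ×
E`, requires. -/
theorem contDiffOn_christoffel (h : IsMetricOn G U) :
    ContDiffOn ℝ ∞ (fun p : E × E × E => christoffel G p.1 p.2.1 p.2.2) (U ×ˢ Set.univ) := by
  have hf : ContDiffOn ℝ ∞ (fderiv ℝ G) U := h.smooth.fderiv_of_isOpen h.isOpen (by simp)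
  have hm : Set.MapsTo (Prod.fst : E × E × E → E) (U ×ˢ Set.univ) U := fun p hp => hp.1
  have h1 : ContDiffOn ℝ ∞ (fun p : E × E × E => p.2.1) (U ×ˢ Set.univ) :=
    (contDiff_fst.comp contDiff_snd).contDiffOn
  have h2 : ContDiffOn ℝ ∞ (fun p : E × E × E => p.2.2) (U ×ˢ Set.univ) :=
    (contDiff_snd.comp contDiff_snd).contDiffOn
  have hf' : ContDiffOn ℝ ∞ (fun p : E × E × E => fderiv ℝ G p.1) (U ×ˢ Set.univ) :=
    hf.comp contDiff_fst.contDiffOn hm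
  have hi : ContDiffOn ℝ ∞ (fun p : E × E × E => (G p.1).inverse) (U ×ˢ Set.univ) :=
    h.contDiffOn_inverse.comp contDiff_fst.contDiffOn hm
  have hflip : ContDiffOn ℝ ∞ (fun p : E × E × E =>
      (((fderiv ℝ G p.1).flip p.2.1).flip p.2.2)) (U ×ˢ Set.univ) := by
    have e1 : ContDiffOn ℝ ∞ (fun p : E × E × E => (fderiv ℝ G p.1).flip) (U ×ˢ Set.univ) :=
      (ContinuousLinearMap.flipₗᵢ ℝ E E (E →L[ℝ] ℝ)).contDiff.comp_contDiffOn hf'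
    have e2 := e1.clm_apply h1
    have e3 : ContDiffOn ℝ ∞ (fun p : E × E × E => ((fderiv ℝ G p.1).flip p.2.1).flip)
      (U ×ˢ Set.univ) :=
      (ContinuousLinearMap.flipₗᵢ ℝ E E ℝ).contDiff.comp_contDiffOn e2
    exact e3.clm_apply h2
  exact hi.clm_apply (((((hf'.clm_apply h1).clm_apply h2).add
    ((hf'.clm_apply h2).clm_apply h1)).sub hflip).const_smul _)

theorem contDiffOn_christoffel_const (h : IsMetricOn G U) (u v : E) :
    ContDiffOn ℝ ∞ (fun x => christoffel G x u v) U :=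
  h.contDiffOn_christoffel.comp
    ((contDiff_id.prodMk (contDiff_const (c := (u, v)))).contDiffOn) (fun _ hx => ⟨hx, trivial⟩)

theorem differentiableAt_christoffel (h : IsMetricOn G U) (hy : y ∈ U) (u v : E) :
    DifferentiableAt ℝ (fun x => christoffel G x u v) y :=
  differentiableAt_of_smoothOn (h.contDiffOn_christoffel_const u v) h.isOpen hy

omit [FiniteDimensional ℝ E] in
theorem snd_fderiv_symm {F : Type*} [NormedAddCommGroup F] [NormedSpace ℝ F] {A : E → F}
    (hA : ContDiffAt ℝ ∞ A y) (z w : E) :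
    fderiv ℝ (fderiv ℝ A) y z w = fderiv ℝ (fderiv ℝ A) y w z :=
  hA.isSymmSndFDerivAt (by
    rw [minSmoothness_of_isRCLikeNormedField]
    exact WithTop.coe_le_coe.2 (le_top (a := (2 : ℕ∞)))) z w

omit [FiniteDimensional ℝ E] in
theorem differentiableAt_fderiv {F : Type*} [NormedAddCommGroup F] [NormedSpace ℝ F] {A : E → F}
    (hA : ContDiffAt ℝ ∞ A y) : DifferentiableAt ℝ (fderiv ℝ A) y :=
  (hA.fderiv_right (m := 1) (by norm_cast)).differentiableAt (by simp)

/-- The Ricci identity for bilinear forms; `S` is the covariant derivative of `A`. -/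
theorem ricci_identity₂ (h : IsMetricOn G U) (hy : y ∈ U) {A : E → E →L[ℝ] E →L[ℝ] ℝ}
    (hA : ContDiffAt ℝ ∞ A y) {S : E → E → E → E → ℝ}
    (hS : ∀ w u v, DifferentiableAt ℝ (fun x => S x w u v) y)
    (hAS : ∀ x ∈ U, ∀ w u v, covDeriv02 G A x w u v = S x w u v) (z w u v : E) :
    A y (curv G y z w u) v + A y u (curv G y z w v)
      + (fderiv ℝ (fun x => S x w u v) y z - S y w (christoffel G y z u) v
          - S y w u (christoffel G y z v))
      - (fderiv ℝ (fun x => S x z u v) y w - S y z (christoffel G y w u) v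
          - S y z u (christoffel G y w v)) = 0 := by
  have hAd : DifferentiableAt ℝ A y := hA.differentiableAt (by simp)
  have e : ∀ x ∈ U, ∀ w u v, fderiv ℝ A x w u v
      = A x (christoffel G x w u) v + A x u (christoffel G x w v) + S x w u v := by
    intro x hx w u v
    rw [← hAS x hx w u v, covDeriv02]; ring
  -- The identity is the symmetry of the second derivative of `A`, with `dA` replaced by connection
  -- terms plus `S`. The terms `S(Γ(z,w), u, v)` are symmetric in `z`, `w` and are left out of the
  -- statement.
  have key : ∀ z w, fderiv ℝ (fderiv ℝ A) y z w u v
      = fderiv ℝ A y z (christoffel G y w u) v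
        + A y (fderiv ℝ (fun x => christoffel G x w u) y z) v
        + fderiv ℝ A y z u (christoffel G y w v)
        + A y u (fderiv ℝ (fun x => christoffel G x w v) y z)
        + fderiv ℝ (fun x => S x w u v) y z := by
    intro z w
    have d1 := differentiableAt_fderiv hA
    have d2 : DifferentiableAt ℝ (fun x => fderiv ℝ A x w) y :=
      d1.clm_apply (differentiableAt_const w)
    have h1 : fderiv ℝ (fderiv ℝ A) y z w u v = fderiv ℝ (fun x => fderiv ℝ A x w u v) y z := by
      rw [fderiv_apply_const_const (A := fun x => fderiv ℝ A x w) d2, fderiv_apply_const d1]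
    have h2 : (fun x => fderiv ℝ A x w u v) =ᶠ[𝓝 y] fun x =>
        A x (christoffel G x w u) v + A x u (christoffel G x w v) + S x w u v := by
      filter_upwards [h.isOpen.mem_nhds hy] with x hx using e x hx w u v
    have c1 := h.differentiableAt_christoffel hy w u
    have c2 := h.differentiableAt_christoffel hy w v
    have k1 : DifferentiableAt ℝ (fun x => A x (christoffel G x w u) v) y :=
      (hAd.clm_apply c1).clm_apply (differentiableAt_const v)
    have k2 : DifferentiableAt ℝ (fun x => A x u (christoffel G x w v)) y :=
      (hAd.clm_apply (differentiableAt_const u)).clm_apply c2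
    rw [h1, h2.fderiv_eq, fderiv_fun_add (k1.fun_add k2) (hS w u v), fderiv_fun_add k1 k2,
      add_apply, add_apply, fderiv_clm_apply_apply hAd c1 (differentiableAt_const v),
      fderiv_clm_apply_apply hAd (differentiableAt_const u) c2]
    simp
    ring
  have k1 := key z w
  have k2 := key w z
  rw [snd_fderiv_symm hA z w, k2] at k1
  rw [e y hy, e y hy, e y hy, e y hy] at k1
  simp only [curv, map_add, map_sub, add_apply, sub_apply]
  linear_combination -k1

/-- The Ricci identity for one-forms; `S` is the covariant derivative of `L`. -/
theorem ricci_identity₁ (h : IsMetricOn G U) (hy : y ∈ U) {L : E → E →L[ℝ] ℝ}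
    (hL : ContDiffAt ℝ ∞ L y) {S : E → E → E → ℝ}
    (hS : ∀ w u, DifferentiableAt ℝ (fun x => S x w u) y)
    (hLS : ∀ x ∈ U, ∀ w u, covDeriv01 G L x w u = S x w u) (z w u : E) :
    L y (curv G y z w u)
      + (fderiv ℝ (fun x => S x w u) y z - S y w (christoffel G y z u))
      - (fderiv ℝ (fun x => S x z u) y w - S y z (christoffel G y w u)) = 0 := by
  have hLd : DifferentiableAt ℝ L y := hL.differentiableAt (by simp)
  have e : ∀ x ∈ U, ∀ w u, fderiv ℝ L x w u
      = L x (christoffel G x w u) + S x w u := by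
    intro x hx w u
    rw [← hLS x hx w u, covDeriv01]; ring
  have key : ∀ z w, fderiv ℝ (fderiv ℝ L) y z w u
      = fderiv ℝ L y z (christoffel G y w u)
        + L y (fderiv ℝ (fun x => christoffel G x w u) y z)
        + fderiv ℝ (fun x => S x w u) y z := by
    intro z w
    have d1 := differentiableAt_fderiv hL
    have h1 : fderiv ℝ (fderiv ℝ L) y z w u = fderiv ℝ (fun x => fderiv ℝ L x w u) y z := by
      rw [fderiv_apply_const_const d1]
    have h2 : (fun x => fderiv ℝ L x w u) =ᶠ[𝓝 y] fun x =>
        L x (christoffel G x w u) + S x w u := by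
      filter_upwards [h.isOpen.mem_nhds hy] with x hx using e x hx w u
    have c1 := h.differentiableAt_christoffel hy w u
    rw [h1, h2.fderiv_eq, fderiv_fun_add (hLd.clm_apply c1) (hS w u), add_apply,
      fderiv_clm_apply_one hLd c1]
  have k1 := key z w
  have k2 := key w z
  rw [snd_fderiv_symm hL z w, k2] at k1
  rw [e y hy, e y hy] at k1
  simp only [curv, map_add, map_sub]
  linear_combination -k1

/-- The Ricci identity for the parallel form `G` itself. -/
theorem apply_curv_skew (h : IsMetricOn G U) (hy : y ∈ U) (z w u v : E) :
    G y (curv G y z w u) v = -G y u (curv G y z w v) := by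
  have := h.ricci_identity₂ hy (h.contDiffAt hy) (S := fun _ _ _ _ => 0)
    (fun _ _ _ => differentiableAt_const _)
    (fun x hx w u v => by rw [covDeriv02, h.fderiv_eq hx]; ring) z w u v
  simp at this
  linarith

omit [FiniteDimensional ℝ E] in
theorem curv_swap (z w u : E) : curv G y z w u = -curv G y w z u := by
  simp only [curv]; abel

omit [FiniteDimensional ℝ E] in
theorem bianchi (h : IsMetricOn G U) (hy : y ∈ U) (z w u : E) :
    curv G y z w u + curv G y w u z + curv G y u z w = 0 := by
  have e : ∀ u v, fderiv ℝ (fun x => christoffel G x u v) y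
      = fderiv ℝ (fun x => christoffel G x v u) y := by
    intro u v
    apply Filter.EventuallyEq.fderiv_eq
    filter_upwards [h.isOpen.mem_nhds hy] with x hx using h.christoffel_symm hx u v
  simp only [curv]
  rw [e w u, e z u, e z w, h.christoffel_symm hy w u, h.christoffel_symm hy z u,
    h.christoffel_symm hy z w]
  abel

theorem curv_pair_symm (h : IsMetricOn G U) (hy : y ∈ U) (x z u v : E) :
    G y (curv G y x z u) v = G y (curv G y u v x) z := by
  have B : ∀ a b c d, G y (curv G y a b c) d + G y (curv G y b c a) d + G y (curv G y c a b) d = 0 := by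
    intro a b c d
    have := congrArg (fun t => G y t d) (h.bianchi hy a b c)
    simpa using this
  have s1 : ∀ a b c d, G y (curv G y a b c) d = -G y (curv G y b a c) d := by
    intro a b c d
    rw [curv_swap, map_neg, neg_apply]
  have s2 : ∀ a b c d, G y (curv G y a b c) d = -G y (curv G y a b d) c := by
    intro a b c d
    rw [h.apply_curv_skew hy, h.symm y hy c]
  linarith [B x z u v, B z u v x, B u v x z, B v x z u, s1 x z u v, s2 x z u v, s1 u v x z,
    s2 u v x z, s1 z u x v, s2 z u x v, s1 u x z v, s2 u x z v, s1 z u v x, s2 z u v x,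
    s1 u v z x, s2 u v z x, s1 v z u x, s2 v z u x, s1 v x u z, s2 v x u z, s1 x u v z, s2 x u v z,
    s1 v x z u, s2 v x z u, s1 x z v u, s2 x z v u, s1 z v x u, s2 z v x u]

end IsMetricOn
end LocalCalculus
end HProj
namespace HProj

/-! ### Local consequences of the `h`-projective equation on a Kähler domain. -/

section LocalKahler

open Filter Topology

variable {E : Type*} [NormedAddCommGroup E] [NormedSpace ℝ E]

/-- A Kähler structure on an open subset of a vector space. -/
structure IsKahlerOn (G : E → E →L[ℝ] E →L[ℝ] ℝ) (J : E → E →L[ℝ] E) (U : Set E) : Prop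
    extends IsMetricOn G U where
  smooth_complex : ContDiffOn ℝ ∞ J U
  complex_sq : ∀ y ∈ U, ∀ u, J y (J y u) = -u
  hermitian : ∀ y ∈ U, ∀ u v, G y (J y u) (J y v) = G y u v
  parallel : ∀ y ∈ U, ∀ w u, covDeriv11 G J y w u = 0

/-- A solution of the `h`-projective equation on an open subset of a vector space. -/
structure IsSolutionOn (G : E → E →L[ℝ] E →L[ℝ] ℝ) (J : E → E →L[ℝ] E)
    (A : E → E →L[ℝ] E →L[ℝ] ℝ) (L : E → E →L[ℝ] ℝ) (U : Set E) : Prop where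
  smooth_tensor : ContDiffOn ℝ ∞ A U
  smooth_form : ContDiffOn ℝ ∞ L U
  symm : ∀ y ∈ U, ∀ u v, A y u v = A y v u
  hermitian : ∀ y ∈ U, ∀ u v, A y (J y u) (J y v) = A y u v
  eqn : ∀ y ∈ U, ∀ w u v, covDeriv02 G A y w u v
    = L y u * G y v w + L y v * G y u w - L y (J y u) * G y v (J y w)
      - L y (J y v) * G y u (J y w)

/-- The second covariant derivative of a solution with `∇L = T`. -/
noncomputable def hessTerm (G : E →L[ℝ] E →L[ℝ] ℝ) (J : E →L[ℝ] E) (T : E → E → ℝ) (z w u v : E) : ℝ :=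
  T z u * G v w + T z v * G u w - T z (J u) * G v (J w) - T z (J v) * G u (J w)

variable {G A : E → E →L[ℝ] E →L[ℝ] ℝ} {J : E → E →L[ℝ] E} {L : E → E →L[ℝ] ℝ} {U : Set E} {y : E}

namespace IsKahlerOn

theorem skew (h : IsKahlerOn G J U) (hy : y ∈ U) (u v : E) : G y (J y u) v = -G y u (J y v) := by
  rw [← h.hermitian y hy u, h.complex_sq y hy, ← neg_eq_iff_eq_neg, ← map_neg]

theorem differentiableAt_complex (h : IsKahlerOn G J U) (hy : y ∈ U) : DifferentiableAt ℝ J y :=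
  differentiableAt_of_smoothOn h.smooth_complex h.isOpen hy

theorem fderiv_complex (h : IsKahlerOn G J U) (hy : y ∈ U) (w u : E) :
    fderiv ℝ J y w u = J y (christoffel G y w u) - christoffel G y w (J y u) := by
  have := h.parallel y hy w u
  rw [covDeriv11, sub_eq_zero] at this
  rw [← this]; abel

theorem christoffel_add_complex (h : IsKahlerOn G J U) (hy : y ∈ U) (w u : E) :
    christoffel G y w (J y u) = J y (christoffel G y w u) - fderiv ℝ J y w u := by
  rw [h.fderiv_complex hy]; abel

variable [FiniteDimensional ℝ E]

/-- The Ricci identity for `A`. As `G` and `J` are parallel, differentiating the right-hand side of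
the `h`-projective equation only hits `L`, so the second covariant derivative of `A` is `hessTerm`
of `∇L`. -/
theorem integrability (h : IsKahlerOn G J U) (hs : IsSolutionOn G J A L U) (hy : y ∈ U)
    (z w u v : E) :
    A y (curv G y z w u) v + A y u (curv G y z w v)
      + hessTerm (G y) (J y) (covDeriv01 G L y) z w u v
      - hessTerm (G y) (J y) (covDeriv01 G L y) w z u v = 0 := by
  have dL : DifferentiableAt ℝ L y := differentiableAt_of_smoothOn hs.smooth_form h.isOpen hy
  have dG := h.differentiableAt hy
  have dJ := h.differentiableAt_complex hy
  have l : ∀ u, DifferentiableAt ℝ (fun x => L x u) y := fun u =>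
    dL.clm_apply (differentiableAt_const u)
  have j : ∀ u, DifferentiableAt ℝ (fun x => J x u) y := fun u =>
    dJ.clm_apply (differentiableAt_const u)
  have lj : ∀ u, DifferentiableAt ℝ (fun x => L x (J x u)) y := fun u => dL.clm_apply (j u)
  have g : ∀ u v, DifferentiableAt ℝ (fun x => G x u v) y := fun u v =>
    (dG.clm_apply (differentiableAt_const u)).clm_apply (differentiableAt_const v)
  have gj : ∀ u v, DifferentiableAt ℝ (fun x => G x u (J x v)) y := fun u v =>
    (dG.clm_apply (differentiableAt_const u)).clm_apply (j v)
  have hL : ∀ w u, fderiv ℝ L y w u = covDeriv01 G L y w u + L y (christoffel G y w u) := by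
    intro w u; rw [covDeriv01]; ring
  have fl : ∀ u w, fderiv ℝ (fun x => L x u) y w
      = covDeriv01 G L y w u + L y (christoffel G y w u) := by
    intro u w
    rw [fderiv_apply_const dL, hL]
  have fj : ∀ u w, fderiv ℝ (fun x => J x u) y w
      = J y (christoffel G y w u) - christoffel G y w (J y u) := by
    intro u w
    rw [fderiv_apply_const dJ, h.fderiv_complex hy]
  have flj : ∀ u w, fderiv ℝ (fun x => L x (J x u)) y w
      = covDeriv01 G L y w (J y u) + L y (J y (christoffel G y w u)) := by
    intro u w
    rw [fderiv_clm_apply_one dL (j u), fj, hL, map_sub]; ring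
  have fg : ∀ u v w, fderiv ℝ (fun x => G x u v) y w
      = G y (christoffel G y w u) v + G y u (christoffel G y w v) := by
    intro u v w
    rw [fderiv_apply_const_const dG, h.fderiv_eq hy]
  have fgj : ∀ u v w, fderiv ℝ (fun x => G x u (J x v)) y w
      = G y (christoffel G y w u) (J y v) + G y u (J y (christoffel G y w v)) := by
    intro u v w
    rw [fderiv_clm_apply_apply dG (differentiableAt_const u) (j v), fj, h.fderiv_eq hy]
    simp
  let S : E → E → E → E → ℝ := fun x w u v => L x u * G x v w + L x v * G x u w
    - L x (J x u) * G x v (J x w) - L x (J x v) * G x u (J x w)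
  have hS : ∀ w u v, DifferentiableAt ℝ (fun x => S x w u v) y := fun w u v =>
    ((((l u).fun_mul (g v w)).fun_add ((l v).fun_mul (g u w))).fun_sub
      ((lj u).fun_mul (gj v w))).fun_sub ((lj v).fun_mul (gj u w))
  have fS : ∀ w u v z, fderiv ℝ (fun x => S x w u v) y z
      = hessTerm (G y) (J y) (covDeriv01 G L y) z w u v + S y w (christoffel G y z u) v
        + S y w u (christoffel G y z v) + S y (christoffel G y z w) u v := by
    intro w u v z
    simp only [S]
    rw [fderiv_fun_sub ((((l u).fun_mul (g v w)).fun_add ((l v).fun_mul (g u w))).fun_sub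
      ((lj u).fun_mul (gj v w))) ((lj v).fun_mul (gj u w)),
      fderiv_fun_sub (((l u).fun_mul (g v w)).fun_add ((l v).fun_mul (g u w)))
      ((lj u).fun_mul (gj v w)), fderiv_fun_add ((l u).fun_mul (g v w)) ((l v).fun_mul (g u w)),
      fderiv_fun_mul (l u) (g v w), fderiv_fun_mul (l v) (g u w), fderiv_fun_mul (lj u) (gj v w),
      fderiv_fun_mul (lj v) (gj u w)]
    simp only [add_apply, sub_apply, smul_apply, smul_eq_mul, fl, flj, fg, fgj, hessTerm]
    ring
  have key := h.ricci_identity₂ hy (hs.smooth_tensor.contDiffAt (h.isOpen.mem_nhds hy)) hS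
    (fun x hx w u v => hs.eqn x hx w u v) z w u v
  rw [fS, fS, h.christoffel_symm hy w z] at key
  linear_combination key

/-- `R(aX, X) = 0` for the operator `a` of a parallel symmetric form. -/
theorem curv_parallel_apply_self (h : IsKahlerOn G J U) {A₀ : E → E →L[ℝ] E →L[ℝ] ℝ}
    (h₀ : IsSolutionOn G J A₀ (fun _ => 0) U) (hy : y ∈ U) {a : E →L[ℝ] E}
    (ha : ∀ u v, G y (a u) v = A₀ y u v) (x : E) : ∀ u, curv G y (a x) x u = 0 := by
  have hcomm : ∀ z w u v, A₀ y (curv G y z w u) v + A₀ y u (curv G y z w v) = 0 := by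
    intro z w u v
    have := h.integrability h₀ hy z w u v
    have e : covDeriv01 G (fun _ => (0 : E →L[ℝ] ℝ)) y = 0 := by
      ext w u; simp [covDeriv01]
    simpa [e, hessTerm] using this
  intro u
  refine h.nondegenerate y hy _ fun v => ?_
  -- By pair symmetry `G(R(ax,x)u, v) = G(R(u,v)ax, x) = -A₀(x, R(u,v)x)`, and twice this last value
  -- is zero by the commutation of `A₀` with the curvature.
  have := hcomm u v x x
  rw [h₀.symm y hy (curv G y u v x)] at this
  rw [h.curv_pair_symm hy (a x) x u v, h.apply_curv_skew hy, ha]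
  linarith

omit [FiniteDimensional ℝ E] in
theorem complex_comm (h : IsKahlerOn G J U) {B : E →L[ℝ] E →L[ℝ] ℝ} (hy : y ∈ U)
    (hB : ∀ u v, B (J y u) (J y v) = B u v) {a : E →L[ℝ] E}
    (ha : ∀ u v, G y (a u) v = B u v) (u : E) : a (J y u) = J y (a u) := by
  rw [← sub_eq_zero]
  refine h.nondegenerate y hy _ fun v => ?_
  rw [map_sub, sub_apply, ha, h.skew hy, ha, ← hB u, h.complex_sq y hy, map_neg]
  ring

theorem complex_comm_of_equiv (h : IsKahlerOn G J U) {Gb : E → E →L[ℝ] E →L[ℝ] ℝ}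
    (hb : IsKahlerOn Gb J U) (hy : y ∈ U) (u : E) :
    (Gb y).inverse (G y (J y u)) = J y ((Gb y).inverse (G y u)) :=
  hb.complex_comm (a := (Gb y).inverse ∘L G y) hy (h.hermitian y hy)
    (fun u v => by
      rw [ContinuousLinearMap.comp_apply, apply_inverse (hb.nondegenerate y hy)]) u

/-- The pair `(aX, X)` annihilates the curvature terms of `integrability`; what remains is the
hypothesis of `eq_smul_of_integrability` for `T = ∇L`. -/
theorem hessian_eq_smul (h : IsKahlerOn G J U) {A₀ : E → E →L[ℝ] E →L[ℝ] ℝ}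
    (h₀ : IsSolutionOn G J A₀ (fun _ => 0) U) (hne : ∀ y ∈ U, ¬ ∃ c : ℝ, A₀ y = c • G y)
    (hs : IsSolutionOn G J A L U)
    (hT : ∀ y ∈ U, ∀ w u, covDeriv01 G L y w u = covDeriv01 G L y u w) (hy : y ∈ U) :
    ∃ μ : ℝ, ∀ w u, covDeriv01 G L y w u = μ * G y w u := by
  let a : E →L[ℝ] E := (G y).inverse ∘L A₀ y
  have ha : ∀ u v, G y (a u) v = A₀ y u v := fun u v => by
    simp only [a, ContinuousLinearMap.comp_apply, apply_inverse (h.nondegenerate y hy)]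
  have ha' : ∀ u v, G y (a u) v = G y u (a v) := fun u v => by
    rw [ha, h.symm y hy, ha, h₀.symm y hy]
  let T : E →L[ℝ] E →L[ℝ] ℝ := LinearMap.toContinuousLinearMap
    { toFun := fun w => LinearMap.toContinuousLinearMap
        { toFun := fun u => covDeriv01 G L y w u
          map_add' := fun u v => by simp [covDeriv01, christoffel_add_right]; ring
          map_smul' := fun c u => by simp [covDeriv01, christoffel_smul_right]; ring }
      map_add' := fun u v => by
        ext w; simp [covDeriv01, christoffel_add_left]; ring
      map_smul' := fun c u => by
        ext w; simp [covDeriv01, christoffel_smul_left]; ring }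
  have hTe : ∀ u v, T u v = covDeriv01 G L y u v := fun _ _ => rfl
  have key := eq_smul_of_integrability (G := G y) (T := T) (J := J y) (a := a)
    (h.nondegenerate y hy) (h.symm y hy) (fun u v => hT y hy u v) (h.complex_sq y hy)
    (fun u v => h.skew hy u v) ha' (h.complex_comm hy (h₀.hermitian y hy) ha)
    (fun X Z W => by
      have := h.integrability hs hy (a X) X Z W
      rw [h.curv_parallel_apply_self h₀ hy ha X, h.curv_parallel_apply_self h₀ hy ha X] at this
      simp only [hessTerm, map_zero, zero_apply] at this
      simp only [hTe]
      linear_combination this)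
  rcases key with ⟨c, hc⟩ | ⟨μ, hμ⟩
  · refine absurd ⟨c, ?_⟩ (hne y hy)
    ext u v
    rw [← ha, hc]; simp
  · exact ⟨μ, fun w u => hμ w u⟩

/-- The Ricci identity for `L` reads `L(R(z,w)u) = dμ(w) G(z,u) - dμ(z) G(w,u)`. With `(z, w) = (ax,
x)` the left side vanishes, and `dμ(ax) x = dμ(x) ax` remains. -/
theorem fderiv_hessian_factor (h : IsKahlerOn G J U) {A₀ : E → E →L[ℝ] E →L[ℝ] ℝ}
    (h₀ : IsSolutionOn G J A₀ (fun _ => 0) U) (hne : ∀ y ∈ U, ¬ ∃ c : ℝ, A₀ y = c • G y)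
    (hL : ContDiffOn ℝ ∞ L U) {μ : E → ℝ}
    (hμ : ∀ y ∈ U, ∀ w u, covDeriv01 G L y w u = μ y * G y w u) (hy : y ∈ U) :
    DifferentiableAt ℝ μ y ∧ fderiv ℝ μ y = 0 := by
  rcases subsingleton_or_nontrivial E with hE | hE
  · refine ⟨(hasFDerivAt_of_subsingleton μ y).differentiableAt, ?_⟩
    ext u; rw [Subsingleton.elim u 0]; simp
  have hLy : ContDiffAt ℝ ∞ L y := hL.contDiffAt (h.isOpen.mem_nhds hy)
  have dG := h.differentiableAt hy
  have g : ∀ u v, DifferentiableAt ℝ (fun x => G x u v) y := fun u v =>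
    (dG.clm_apply (differentiableAt_const u)).clm_apply (differentiableAt_const v)
  -- `μ` is only given pointwise; near `y` it is the quotient of `∇L(u,v)` by a nonzero `G(u,v)`.
  have dμ : DifferentiableAt ℝ μ y := by
    obtain ⟨u, hu⟩ := exists_ne (0 : E)
    obtain ⟨v, hv⟩ : ∃ v, G y u v ≠ 0 := by
      by_contra hc
      push Not at hc
      exact hu (h.nondegenerate y hy u hc)
    have hc : DifferentiableAt ℝ (fun x => covDeriv01 G L x u v) y := by
      have d1 : DifferentiableAt ℝ (fun x => fderiv ℝ L x u v) y :=
        ((IsMetricOn.differentiableAt_fderiv hLy).clm_apply (differentiableAt_const u)).clm_apply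
          (differentiableAt_const v)
      exact d1.fun_sub ((hLy.differentiableAt (by simp)).clm_apply
        (h.differentiableAt_christoffel hy u v))
    refine (hc.fun_mul ((g u v).inv hv)).congr_of_eventuallyEq ?_
    have hev : ∀ᶠ x in 𝓝 y, G x u v ≠ 0 := (g u v).continuousAt.eventually_ne hv
    filter_upwards [h.isOpen.mem_nhds hy, hev] with x hx hx'
    rw [hμ x hx, Pi.inv_apply, mul_inv_cancel_right₀ hx']
  refine ⟨dμ, ?_⟩
  let a : E →L[ℝ] E := (G y).inverse ∘L A₀ y
  have ha : ∀ u v, G y (a u) v = A₀ y u v := fun u v => by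
    simp only [a, ContinuousLinearMap.comp_apply, apply_inverse (h.nondegenerate y hy)]
  refine eq_zero_of_apply_smul_eq (h.complex_sq y hy) (h.complex_comm hy (h₀.hermitian y hy) ha)
    (fun x => ?_) (fun ⟨c, hc⟩ => hne y hy ⟨c, ?_⟩)
  · rw [← sub_eq_zero]
    refine h.nondegenerate y hy _ fun u => ?_
    have key := h.ricci_identity₁ hy hLy (S := fun x w u => μ x * G x w u)
      (fun w u => dμ.fun_mul (g w u)) hμ (a x) x u
    simp only [fderiv_fun_mul dμ (g _ _), h.curv_parallel_apply_self h₀ hy ha x, map_zero,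
      add_apply, smul_apply, smul_eq_mul, fderiv_apply_const_const dG, h.fderiv_eq hy] at key
    rw [h.christoffel_symm hy x (a x)] at key
    simp only [map_sub, map_smul, sub_apply, smul_apply, smul_eq_mul]
    linear_combination key
  · ext u v
    rw [← ha, hc]; simp

end IsKahlerOn

/-- Grönwall's inequality along the segments that issue from `y`. This is the local uniqueness of
parallel sections. -/
theorem eventually_eq_zero_of_fderiv_le {V : Type*} [NormedAddCommGroup V] [NormedSpace ℝ V]
    {f : E → V} {C : ℝ}
    (h : ∀ᶠ x in 𝓝 y, DifferentiableAt ℝ f x ∧ ‖fderiv ℝ f x‖ ≤ C * ‖f x‖) (h0 : f y = 0) :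
    ∀ᶠ x in 𝓝 y, f x = 0 := by
  obtain ⟨ε, hε, hb⟩ := Metric.eventually_nhds_iff_ball.1 h
  filter_upwards [Metric.ball_mem_nhds y hε] with x hx
  have hmem : ∀ t ∈ Set.Icc (0 : ℝ) 1, y + t • (x - y) ∈ Metric.ball y ε := fun t ht =>
    (convex_ball y ε).add_smul_sub_mem (Metric.mem_ball_self hε) hx ht
  have hder : ∀ t ∈ Set.Icc (0 : ℝ) 1, HasDerivAt (fun s : ℝ => f (y + s • (x - y)))
      (fderiv ℝ f (y + t • (x - y)) (x - y)) t := by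
    intro t ht
    have h1 : HasDerivAt (fun s : ℝ => y + s • (x - y)) (x - y) t := by
      simpa using ((hasDerivAt_id t).smul_const (x - y)).const_add y
    exact (hb _ (hmem t ht)).1.hasFDerivAt.comp_hasDerivAt t h1
  have := eq_zero_of_abs_deriv_le_mul_abs_self_of_eq_zero_right (a := 0) (b := 1)
    (K := C * ‖x - y‖) (f := fun s : ℝ => f (y + s • (x - y)))
    (f' := fun t => fderiv ℝ f (y + t • (x - y)) (x - y))
    (fun t ht => (hder t ht).continuousAt.continuousWithinAt)
    (fun t ht => (hder t ⟨ht.1, ht.2.le⟩).hasDerivWithinAt) (by simpa using h0)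
    (fun t ht => by
      refine (ContinuousLinearMap.le_opNorm _ _).trans ?_
      have := (hb _ (hmem t ⟨ht.1, ht.2.le⟩)).2
      calc _ ≤ (C * ‖f (y + t • (x - y))‖) * ‖x - y‖ := by gcongr
        _ = _ := by ring) 1 (by simp)
  simpa using this

namespace IsMetricOn

variable [FiniteDimensional ℝ E]

theorem eventually_norm_christoffel_le (h : IsMetricOn G U) (hy : y ∈ U) :
    ∃ C : ℝ, 0 ≤ C ∧ ∀ᶠ x in 𝓝 y, ∀ u v, ‖christoffel G x u v‖ ≤ C * ‖u‖ * ‖v‖ := by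
  have c1 : ContinuousAt (fun x => ‖(G x).inverse‖) y :=
    ((h.contDiffOn_inverse.contDiffAt (h.isOpen.mem_nhds hy)).continuousAt).norm
  have c2 : ContinuousAt (fun x => ‖fderiv ℝ G x‖) y :=
    (differentiableAt_fderiv (h.contDiffAt hy)).continuousAt.norm
  have e1 := c1.eventually_lt_const (lt_add_one _)
  have e2 := c2.eventually_lt_const (lt_add_one _)
  set K1 := ‖(G y).inverse‖ + 1
  set K2 := ‖fderiv ℝ G y‖ + 1
  have hK1 : 0 ≤ K1 := by positivity
  have hK2 : 0 ≤ K2 := by positivity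
  refine ⟨K1 * (2 * K2), by positivity, ?_⟩
  filter_upwards [e1, e2] with x h1 h2 u v
  have b : ∀ a b c, ‖fderiv ℝ G x a b c‖ ≤ K2 * ‖a‖ * ‖b‖ * ‖c‖ := fun a b c => by
    refine (ContinuousLinearMap.le_opNorm _ _).trans ?_
    gcongr
    refine (ContinuousLinearMap.le_opNorm _ _).trans ?_
    gcongr
    exact (ContinuousLinearMap.le_opNorm _ _).trans (by gcongr)
  have hl : ‖christoffelLower G x u v‖ ≤ 2 * K2 * ‖u‖ * ‖v‖ := by
    refine ContinuousLinearMap.opNorm_le_bound _ (by positivity) fun z => ?_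
    simp only [christoffelLower, smul_apply, add_apply, sub_apply, ContinuousLinearMap.flip_apply]
    have b1 := b u v z
    have b2 := b v u z
    have b3 := b z u v
    rw [Real.norm_eq_abs] at b1 b2 b3
    have p : 0 ≤ K2 * ‖u‖ * ‖v‖ * ‖z‖ := by positivity
    rw [smul_eq_mul, Real.norm_eq_abs, abs_le]
    rw [abs_le] at b1 b2 b3
    constructor <;> nlinarith
  calc ‖christoffel G x u v‖ ≤ ‖(G x).inverse‖ * ‖christoffelLower G x u v‖ :=
        ContinuousLinearMap.le_opNorm _ _
    _ ≤ K1 * (2 * K2 * ‖u‖ * ‖v‖) := by gcongr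
    _ = _ := by ring

/-- For a parallel form `dL(w)(u) = L(Γ(w,u))`, so `‖dL‖ ≤ C‖L‖` near `y`. -/
theorem parallel_form_eventually_eq_zero (h : IsMetricOn G U) (hy : y ∈ U)
    (hL : ContDiffOn ℝ ∞ L U) (hp : ∀ x ∈ U, ∀ w u, covDeriv01 G L x w u = 0) (h0 : L y = 0) :
    ∀ᶠ x in 𝓝 y, L x = 0 := by
  obtain ⟨C, hC, hb⟩ := h.eventually_norm_christoffel_le hy
  refine eventually_eq_zero_of_fderiv_le (C := C) ?_ h0
  filter_upwards [h.isOpen.mem_nhds hy, hb] with x hx hbx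
  refine ⟨differentiableAt_of_smoothOn hL h.isOpen hx, ?_⟩
  refine ContinuousLinearMap.opNorm_le_bound _ (by positivity) fun w => ?_
  refine ContinuousLinearMap.opNorm_le_bound _ (by positivity) fun u => ?_
  have := hp x hx w u
  rw [covDeriv01, sub_eq_zero] at this
  rw [this]
  calc _ ≤ ‖L x‖ * (C * ‖w‖ * ‖u‖) :=
        (ContinuousLinearMap.le_opNorm _ _).trans (by gcongr; exact hbx w u)
    _ = _ := by ring

theorem parallel_bilin_eventually_eq_zero (h : IsMetricOn G U) (hy : y ∈ U)
    (hA : ContDiffOn ℝ ∞ A U) (hp : ∀ x ∈ U, ∀ w u v, covDeriv02 G A x w u v = 0)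
    (h0 : A y = 0) : ∀ᶠ x in 𝓝 y, A x = 0 := by
  obtain ⟨C, hC, hb⟩ := h.eventually_norm_christoffel_le hy
  refine eventually_eq_zero_of_fderiv_le (C := 2 * C) ?_ h0
  filter_upwards [h.isOpen.mem_nhds hy, hb] with x hx hbx
  refine ⟨differentiableAt_of_smoothOn hA h.isOpen hx, ?_⟩
  refine ContinuousLinearMap.opNorm_le_bound _ (by positivity) fun w => ?_
  refine ContinuousLinearMap.opNorm_le_bound _ (by positivity) fun u => ?_
  refine ContinuousLinearMap.opNorm_le_bound _ (by positivity) fun v => ?_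
  have := hp x hx w u v
  have e : fderiv ℝ A x w u v = A x (christoffel G x w u) v + A x u (christoffel G x w v) := by
    rw [covDeriv02] at this; linarith
  rw [e]
  calc _ ≤ ‖A x (christoffel G x w u) v‖ + ‖A x u (christoffel G x w v)‖ := norm_add_le _ _
    _ ≤ ‖A x‖ * (C * ‖w‖ * ‖u‖) * ‖v‖ + ‖A x‖ * ‖u‖ * (C * ‖w‖ * ‖v‖) := by
        gcongr
        · exact (ContinuousLinearMap.le_opNorm₂ _ _ _).trans (by gcongr; exact hbx w u)
        · exact (ContinuousLinearMap.le_opNorm₂ _ _ _).trans (by gcongr; exact hbx w v)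
    _ = _ := by ring

/-- The function `|L|²` of a one-form with `∇L = c G`. -/
theorem fderiv_norm_sq (h : IsMetricOn G U) (hy : y ∈ U) (hL : ContDiffOn ℝ ∞ L U) {c : ℝ}
    (hp : ∀ w u, covDeriv01 G L y w u = c * G y w u) :
    DifferentiableAt ℝ (fun x => L x ((G x).inverse (L x))) y ∧
      fderiv ℝ (fun x => L x ((G x).inverse (L x))) y = (2 * c) • L y := by
  have dL : DifferentiableAt ℝ L y := differentiableAt_of_smoothOn hL h.isOpen hy
  have dG := h.differentiableAt hy
  have dI : DifferentiableAt ℝ (fun x => (G x).inverse) y :=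
    differentiableAt_of_smoothOn h.contDiffOn_inverse h.isOpen hy
  have dl : DifferentiableAt ℝ (fun x => (G x).inverse (L x)) y := dI.clm_apply dL
  have hL' : ∀ w u, fderiv ℝ L y w u = c * G y w u + L y (christoffel G y w u) := by
    intro w u; rw [← hp, covDeriv01]; ring
  have hl : ∀ x ∈ U, G x ((G x).inverse (L x)) = L x := fun x hx =>
    apply_inverse (h.nondegenerate x hx) _
  refine ⟨dL.clm_apply dl, ?_⟩
  ext w
  rw [fderiv_clm_apply_one dL dl]
  set l := (G y).inverse (L y) with hldef
  have key : fderiv ℝ (fun x => (G x).inverse (L x)) y w = c • w - christoffel G y w l := by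
    rw [← sub_eq_zero]
    refine h.nondegenerate y hy _ fun v => ?_
    have e : (fun x => G x ((G x).inverse (L x)) v) =ᶠ[𝓝 y] fun x => L x v := by
      filter_upwards [h.isOpen.mem_nhds hy] with x hx using by rw [hl x hx]
    have e2 := congrArg (fun f => f w) (e.fderiv_eq (𝕜 := ℝ))
    rw [fderiv_clm_apply_apply dG dl (differentiableAt_const v), fderiv_apply_const dL,
      h.fderiv_eq hy, hL', ← hldef] at e2
    simp only [fderiv_fun_const, Pi.zero_apply, zero_apply, map_zero, add_zero] at e2
    have e3 : G y l (christoffel G y w v) = L y (christoffel G y w v) := by rw [hl y hy]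
    simp only [map_sub, map_smul, sub_apply, smul_apply, smul_eq_mul]
    linear_combination e2 - e3
  rw [key, hL', h.symm y hy w, hl y hy]
  simp only [map_sub, map_smul, smul_apply, smul_eq_mul]
  ring

/-- The Christoffel symbols `Γ(w, ·)` as an operator. -/
noncomputable def _root_.HProj.christoffelMap (G : E → E →L[ℝ] E →L[ℝ] ℝ) (y w : E) : E →ₗ[ℝ] E where
  toFun := christoffel G y w
  map_add' u v := christoffel_add_right G y w u v
  map_smul' c u := christoffel_smul_right G y c w u

theorem _root_.HProj.hasFDerivAt_trace {B : E → E →L[ℝ] E} (hB : DifferentiableAt ℝ B y) :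
    DifferentiableAt ℝ (fun x => LinearMap.trace ℝ E (B x).toLinearMap) y ∧ ∀ w,
      fderiv ℝ (fun x => LinearMap.trace ℝ E (B x).toLinearMap) y w
        = LinearMap.trace ℝ E (fderiv ℝ B y w).toLinearMap := by
  let tr : (E →L[ℝ] E) →L[ℝ] ℝ := LinearMap.toContinuousLinearMap
    (LinearMap.trace ℝ E ∘ₗ ContinuousLinearMap.coeLM ℝ)
  have h := tr.hasFDerivAt.comp y hB.hasFDerivAt
  exact ⟨h.differentiableAt, fun w => congrArg (fun f => f w) h.fderiv⟩

/-- The derivative of `tr(G⁻¹ A)` is `tr(G⁻¹ ∇A)`. -/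
theorem fderiv_metric_trace (h : IsMetricOn G U) (hy : y ∈ U) (hA : ContDiffOn ℝ ∞ A U) {w : E}
    {Q : E →ₗ[ℝ] E} (hQ : ∀ u v, G y (Q u) v = covDeriv02 G A y w u v) :
    DifferentiableAt ℝ (fun x => LinearMap.trace ℝ E ((G x).inverse ∘L A x).toLinearMap) y ∧
    fderiv ℝ (fun x => LinearMap.trace ℝ E ((G x).inverse ∘L A x).toLinearMap) y w
      = LinearMap.trace ℝ E Q := by
  have dA : DifferentiableAt ℝ A y := differentiableAt_of_smoothOn hA h.isOpen hy
  have dG := h.differentiableAt hy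
  have dI : DifferentiableAt ℝ (fun x => (G x).inverse) y :=
    differentiableAt_of_smoothOn h.contDiffOn_inverse h.isOpen hy
  have dB : DifferentiableAt ℝ (fun x => (G x).inverse ∘L A x) y := dI.clm_comp dA
  set B : E → E →L[ℝ] E := fun x => (G x).inverse ∘L A x with hBdef
  refine ⟨(hasFDerivAt_trace dB).1, ?_⟩
  rw [(hasFDerivAt_trace dB).2]
  have hB : ∀ x ∈ U, ∀ u, G x (B x u) = A x u := fun x hx u => by
    simp only [hBdef, ContinuousLinearMap.comp_apply, apply_inverse (h.nondegenerate x hx)]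
  -- The derivative of `G⁻¹A` is a commutator with `Γ(w, ·)` plus `Q`, and commutators have trace
  -- zero.
  have key : (fderiv ℝ B y w).toLinearMap = (B y).toLinearMap ∘ₗ christoffelMap G y w
      - christoffelMap G y w ∘ₗ (B y).toLinearMap + Q := by
    ext u
    rw [← sub_eq_zero]
    refine h.nondegenerate y hy _ fun v => ?_
    have e : (fun x => G x (B x u) v) =ᶠ[𝓝 y] fun x => A x u v := by
      filter_upwards [h.isOpen.mem_nhds hy] with x hx using by rw [hB x hx]
    have e2 := congrArg (fun f => f w) (e.fderiv_eq (𝕜 := ℝ))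
    rw [fderiv_clm_apply_apply dG (dB.clm_apply (differentiableAt_const u))
      (differentiableAt_const v), fderiv_apply_const dB, fderiv_apply_const_const dA,
      h.fderiv_eq hy, hB y hy] at e2
    simp only [fderiv_fun_const, Pi.zero_apply, zero_apply, map_zero, add_zero] at e2
    have e3 := hQ u v
    rw [covDeriv02] at e3
    simp only [LinearMap.add_apply, LinearMap.sub_apply, LinearMap.comp_apply, christoffelMap,
      ContinuousLinearMap.coe_coe, LinearMap.coe_mk, AddHom.coe_mk, map_sub, map_add, sub_apply,
      add_apply, hB y hy]
    linear_combination e2 - e3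
  rw [key, map_add, map_sub, LinearMap.trace_comp_comm', sub_self, zero_add]

end IsMetricOn

/-- Each of the four terms of the `h`-projective equation contributes one `L(w)` to the trace, the
last two through `J² = -1`. -/
theorem IsKahlerOn.fderiv_trace_solution [FiniteDimensional ℝ E] (h : IsKahlerOn G J U)
    (hs : IsSolutionOn G J A L U) (hy : y ∈ U) :
    DifferentiableAt ℝ (fun x => LinearMap.trace ℝ E ((G x).inverse ∘L A x).toLinearMap) y ∧
    fderiv ℝ (fun x => LinearMap.trace ℝ E ((G x).inverse ∘L A x).toLinearMap) y
      = (4 : ℝ) • L y := by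
  let Q : E → E →ₗ[ℝ] E := fun w => (L y).toLinearMap.smulRight w
    + (G y w).toLinearMap.smulRight ((G y).inverse (L y))
    - ((L y).toLinearMap ∘ₗ (J y).toLinearMap).smulRight (J y w)
    - (G y (J y w)).toLinearMap.smulRight ((G y).inverse (L y ∘L J y))
  have hQ : ∀ w u v, G y (Q w u) v = covDeriv02 G A y w u v := by
    intro w u v
    have n := h.nondegenerate y hy
    rw [hs.eqn y hy]
    simp only [Q, LinearMap.add_apply, LinearMap.sub_apply, LinearMap.smulRight_apply,
      LinearMap.comp_apply, ContinuousLinearMap.coe_coe, map_sub, map_add, map_smul, sub_apply,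
      add_apply, smul_apply, smul_eq_mul, apply_inverse n, ContinuousLinearMap.comp_apply]
    rw [h.symm y hy w v, h.symm y hy w u, h.symm y hy (J y w) v, h.symm y hy (J y w) u]
    ring
  refine ⟨(h.fderiv_metric_trace hy hs.smooth_tensor (hQ 0)).1, ?_⟩
  ext w
  rw [(h.fderiv_metric_trace hy hs.smooth_tensor (hQ w)).2]
  have n := h.nondegenerate y hy
  simp only [Q, map_add, map_sub, LinearMap.trace_smulRight, LinearMap.comp_apply,
    ContinuousLinearMap.coe_coe]
  rw [h.symm y hy w, h.symm y hy (J y w), apply_inverse n, apply_inverse n,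
    ContinuousLinearMap.comp_apply, h.complex_sq y hy]
  simp only [map_neg, smul_apply, smul_eq_mul]
  ring

/-- `4L` is the differential of the trace of `G⁻¹A`, so `∇L` is a Hessian up to a factor. -/
theorem IsKahlerOn.covDeriv_symm [FiniteDimensional ℝ E] (h : IsKahlerOn G J U)
    (hs : IsSolutionOn G J A L U) (hy : y ∈ U) (w u : E) :
    covDeriv01 G L y w u = covDeriv01 G L y u w := by
  set f : E → ℝ := fun x => LinearMap.trace ℝ E ((G x).inverse ∘L A x).toLinearMap with hf
  have hL : ContDiffAt ℝ ∞ L y := hs.smooth_form.contDiffAt (h.isOpen.mem_nhds hy)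
  have dL : DifferentiableAt ℝ L y := hL.differentiableAt (by simp)
  have e : fderiv ℝ f =ᶠ[𝓝 y] fun x => (4 : ℝ) • L x := by
    filter_upwards [h.isOpen.mem_nhds hy] with x hx using (h.fderiv_trace_solution hs hx).2
  have hf' : ∀ᶠ x in 𝓝 y, HasFDerivAt f (fderiv ℝ f x) x := by
    filter_upwards [h.isOpen.mem_nhds hy] with x hx using
      (h.fderiv_trace_solution hs hx).1.hasFDerivAt
  have d2 : HasFDerivAt (fderiv ℝ f) ((4 : ℝ) • fderiv ℝ L y) y :=
    (dL.hasFDerivAt.const_smul (4 : ℝ)).congr_of_eventuallyEq e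
  have := second_derivative_symmetric_of_eventually hf' d2 w u
  simp only [smul_apply, smul_eq_mul] at this
  rw [covDeriv01, covDeriv01, h.christoffel_symm hy w u]
  linarith

end LocalKahler
end HProj
namespace HProj

/-! ### Behaviour under changes of frame and of coordinates. -/

section Transformation

open Filter Topology

variable {E : Type*} [NormedAddCommGroup E] [NormedSpace ℝ E]

section Linear

variable [FiniteDimensional ℝ E] {B A : E →L[ℝ] E →L[ℝ] ℝ} (hB : ∀ u, (∀ v, B u v = 0) → u = 0)
  (F : E ≃L[ℝ] E)

include hB

theorem inverse_bilinearComp (l : E →L[ℝ] ℝ) :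
    (B.bilinearComp (F : E →L[ℝ] E) (F : E →L[ℝ] E)).inverse (l ∘L (F : E →L[ℝ] E))
      = F.symm (B.inverse l) := by
  have hn : ∀ u, (∀ v, B.bilinearComp (F : E →L[ℝ] E) (F : E →L[ℝ] E) u v = 0) → u = 0 := by
    intro u hu
    have : F u = 0 := hB _ fun v => by
      have := hu (F.symm v)
      simpa [ContinuousLinearMap.bilinearComp_apply] using this
    simpa using this
  rw [← inverse_apply hn (F.symm (B.inverse l))]
  congr 1
  ext v
  simp [ContinuousLinearMap.bilinearComp_apply, apply_inverse hB]

theorem inverse_comp_bilinearComp :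
    (B.bilinearComp (F : E →L[ℝ] E) (F : E →L[ℝ] E)).inverse
        ∘L (A.bilinearComp (F : E →L[ℝ] E) (F : E →L[ℝ] E))
      = (F.symm : E →L[ℝ] E) ∘L (B.inverse ∘L A) ∘L (F : E →L[ℝ] E) := by
  ext u
  have : A.bilinearComp (F : E →L[ℝ] E) (F : E →L[ℝ] E) u = A (F u) ∘L (F : E →L[ℝ] E) := by
    ext v; rfl
  simp only [ContinuousLinearMap.comp_apply, this, inverse_bilinearComp hB F]
  rfl

theorem trace_bilinearComp :
    LinearMap.trace ℝ E ((B.bilinearComp (F : E →L[ℝ] E) (F : E →L[ℝ] E)).inverse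
        ∘L (A.bilinearComp (F : E →L[ℝ] E) (F : E →L[ℝ] E))).toLinearMap
      = LinearMap.trace ℝ E (B.inverse ∘L A).toLinearMap := by
  rw [inverse_comp_bilinearComp hB, ← LinearMap.trace_conj' (B.inverse ∘L A).toLinearMap
    F.symm.toLinearEquiv]
  rfl

theorem det_bilinearComp :
    LinearMap.det ((B.bilinearComp (F : E →L[ℝ] E) (F : E →L[ℝ] E)).inverse
        ∘L (A.bilinearComp (F : E →L[ℝ] E) (F : E →L[ℝ] E))).toLinearMap
      = LinearMap.det (B.inverse ∘L A).toLinearMap := by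
  rw [inverse_comp_bilinearComp hB, ← LinearMap.det_conj (B.inverse ∘L A).toLinearMap
    F.symm.toLinearEquiv]
  rfl

end Linear

variable [FiniteDimensional ℝ E]
  {G G' : E → E →L[ℝ] E →L[ℝ] ℝ} {U U' : Set E} {y : E} {τ : E → E}

/-- The transformation law of the Christoffel symbols under a change of coordinates `τ`. -/
theorem christoffel_transform (h : IsMetricOn G U) (h' : IsMetricOn G' U') (hy : y ∈ U)
    (hy' : τ y ∈ U') (hτ : ContDiffAt ℝ ∞ τ y) (hbij : Function.Bijective (fderiv ℝ τ y))
    (hG : ∀ᶠ x in 𝓝 y, ∀ u v, G x u v = G' (τ x) (fderiv ℝ τ x u) (fderiv ℝ τ x v)) (u v : E) :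
    fderiv ℝ τ y (christoffel G y u v) = fderiv ℝ (fderiv ℝ τ) y u v
      + christoffel G' (τ y) (fderiv ℝ τ y u) (fderiv ℝ τ y v) := by
  let e : E ≃ₗ[ℝ] E := LinearEquiv.ofBijective (fderiv ℝ τ y).toLinearMap hbij
  have he : ∀ x, fderiv ℝ τ y (e.symm x) = x := fun x => e.apply_symm_apply x
  have d1 : DifferentiableAt ℝ τ y := hτ.differentiableAt (by simp)
  have d2 : DifferentiableAt ℝ (fderiv ℝ τ) y := IsMetricOn.differentiableAt_fderiv hτ
  have dG' := h'.differentiableAt hy'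
  -- The transformed symbols are symmetric and compatible with `G`, the pull-back of `G'`;
  -- uniqueness of the Levi-Civita connection does the rest.
  have key := h.christoffel_unique hy (C := fun u v => e.symm (fderiv ℝ (fderiv ℝ τ) y u v
      + christoffel G' (τ y) (fderiv ℝ τ y u) (fderiv ℝ τ y v)))
    (fun u v => by rw [IsMetricOn.snd_fderiv_symm hτ, h'.christoffel_symm hy'])
    (fun w u v => by
      have hGy := hG.self_of_nhds
      rw [hGy, hGy, he, he, ← fderiv_apply_const_const (h.differentiableAt hy)]
      have e1 : (fun x => G x u v) =ᶠ[𝓝 y]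
          fun x => G' (τ x) (fderiv ℝ τ x u) (fderiv ℝ τ x v) := by
        filter_upwards [hG] with x hx using hx u v
      rw [e1.fderiv_eq, fderiv_clm_apply_apply (A := fun x => G' (τ x))
        (dG'.comp y d1) (d2.clm_apply (differentiableAt_const u))
        (d2.clm_apply (differentiableAt_const v)), fderiv_apply_const d2, fderiv_apply_const d2]
      have e2 : fderiv ℝ (fun x => G' (τ x)) y = fderiv ℝ G' (τ y) ∘L fderiv ℝ τ y :=
        fderiv_comp y dG' d1
      rw [e2, ContinuousLinearMap.comp_apply, h'.fderiv_eq hy']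
      simp only [map_add, add_apply]
      ring) u v
  rw [key, he]

theorem covDeriv01_transform (h : IsMetricOn G U) (h' : IsMetricOn G' U') (hy : y ∈ U)
    (hy' : τ y ∈ U') (hτ : ContDiffAt ℝ ∞ τ y) (hbij : Function.Bijective (fderiv ℝ τ y))
    (hG : ∀ᶠ x in 𝓝 y, ∀ u v, G x u v = G' (τ x) (fderiv ℝ τ x u) (fderiv ℝ τ x v))
    {L L' : E → E →L[ℝ] ℝ} (dL : DifferentiableAt ℝ L y) (dL' : DifferentiableAt ℝ L' (τ y))
    (hL : ∀ᶠ x in 𝓝 y, ∀ u, L x u = L' (τ x) (fderiv ℝ τ x u)) (w u : E) :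
    covDeriv01 G L y w u = covDeriv01 G' L' (τ y) (fderiv ℝ τ y w) (fderiv ℝ τ y u) := by
  have d1 : DifferentiableAt ℝ τ y := hτ.differentiableAt (by simp)
  have d2 : DifferentiableAt ℝ (fderiv ℝ τ) y := IsMetricOn.differentiableAt_fderiv hτ
  rw [covDeriv01, covDeriv01, hL.self_of_nhds, christoffel_transform h h' hy hy' hτ hbij hG,
    ← fderiv_apply_const dL]
  have e1 : (fun x => L x u) =ᶠ[𝓝 y] fun x => L' (τ x) (fderiv ℝ τ x u) := by
    filter_upwards [hL] with x hx using hx u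
  have e2 : fderiv ℝ (fun x => L' (τ x)) y = fderiv ℝ L' (τ y) ∘L fderiv ℝ τ y :=
    fderiv_comp y dL' d1
  rw [e1.fderiv_eq, fderiv_clm_apply_one (A := fun x => L' (τ x))
    (dL'.comp y d1) (d2.clm_apply (differentiableAt_const u)), e2, fderiv_apply_const d2]
  simp only [map_add, ContinuousLinearMap.comp_apply]
  ring

end Transformation

/-! ### Passage between tensors on `M` and their components in charts. -/

section Charts

open Filter Topology

variable {E : Type*} [NormedAddCommGroup E] [NormedSpace ℝ E]
  {M : Type*} [TopologicalSpace M] [ChartedSpace E M]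

/-- Tangent spaces at propositionally equal points are different types. Viewing a tensor as a
function into a fixed space over `E` makes the change of base point an ordinary rewrite. -/
theorem congr_section {X F : Type*} (s : X → F) {x x' : X} (h : x' = x) : s x' = s x := by rw [h]

section Topological

omit [NormedSpace ℝ E] in
/-- A property that is open and closed in every chart holds everywhere if it holds somewhere. -/
theorem forall_of_eventually_chart [PreconnectedSpace M] {p : M → Prop}
    (h1 : ∀ φ ∈ atlas E M, ∀ y ∈ φ.target, p (φ.symm y) → ∀ᶠ z in 𝓝 y, p (φ.symm z))
    (h2 : ∀ φ ∈ atlas E M, ∀ y ∈ φ.target, ¬ p (φ.symm y) → ∀ᶠ z in 𝓝 y, ¬ p (φ.symm z))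
    {x₀ : M} (h0 : p x₀) (x : M) : p x := by
  have aux : ∀ q : M → Prop,
      (∀ φ ∈ atlas E M, ∀ y ∈ φ.target, q (φ.symm y) → ∀ᶠ z in 𝓝 y, q (φ.symm z)) →
      IsOpen {x | q x} := by
    intro q hq
    rw [isOpen_iff_mem_nhds]
    intro x hx
    let φ := chartAt E x
    have hxs : x ∈ φ.source := mem_chart_source E x
    have hxx : φ.symm (φ x) = x := φ.left_inv hxs
    have h := hq φ (chart_mem_atlas E x) (φ x) (φ.map_source hxs) (by rw [hxx]; exact hx)
    have h' := (φ.continuousAt hxs).eventually h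
    filter_upwards [h', φ.open_source.mem_nhds hxs] with z hz hzs
    rwa [φ.left_inv hzs] at hz
  have hcl : IsClopen {x | p x} :=
    ⟨⟨aux (fun x => ¬ p x) h2⟩, aux p h1⟩
  have := hcl.eq_univ ⟨x₀, h0⟩
  exact (Set.ext_iff.1 this x).2 trivial

/-- `f` is constant on the image of a small ball in each chart, so its level sets are open and
closed. -/
theorem const_of_fderiv_chart_eq_zero [PreconnectedSpace M] {f : M → ℝ}
    (h : ∀ φ ∈ atlas E M, ∀ y ∈ φ.target, DifferentiableAt ℝ (fun z => f (φ.symm z)) y ∧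
      fderiv ℝ (fun z => f (φ.symm z)) y = 0) (x x' : M) : f x' = f x := by
  have aux : ∀ φ ∈ atlas E M, ∀ y ∈ φ.target, ∀ᶠ z in 𝓝 y, f (φ.symm z) = f (φ.symm y) := by
    intro φ hφ y hy
    obtain ⟨ε, hε, hb⟩ := Metric.isOpen_iff.1 φ.open_target y hy
    filter_upwards [Metric.ball_mem_nhds y hε] with z hz
    exact (Metric.isOpen_ball.is_const_of_fderiv_eq_zero (convex_ball y ε).isPreconnected
      (fun w hw => (h φ hφ w (hb hw)).1.differentiableWithinAt)
      (fun w hw => (h φ hφ w (hb hw)).2) (Metric.mem_ball_self hε) hz).symm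
  refine forall_of_eventually_chart (E := E) (p := fun x' => f x' = f x) ?_ ?_ rfl x'
  · intro φ hφ y hy hp
    filter_upwards [aux φ hφ y hy] with z hz
    rw [hz, hp]
  · intro φ hφ y hy hp
    filter_upwards [aux φ hφ y hy] with z hz
    rwa [hz]

omit [NormedSpace ℝ E] in
theorem continuous_of_chart {f : M → ℝ}
    (h : ∀ φ ∈ atlas E M, ∀ y ∈ φ.target, ContinuousAt (fun z => f (φ.symm z)) y) :
    Continuous f := by
  rw [continuous_iff_continuousAt]
  intro x
  let φ := chartAt E x
  have hxs : x ∈ φ.source := mem_chart_source E x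
  have h1 := (h φ (chart_mem_atlas E x) (φ x) (φ.map_source hxs)).comp (φ.continuousAt hxs)
  refine h1.congr ?_
  filter_upwards [φ.open_source.mem_nhds hxs] with z hz
  simp [φ.left_inv hz]

end Topological

variable [IsManifold 𝓘(ℝ, E) ∞ M] {φ ψ : OpenPartialHomeomorph M E} {y : E}

theorem mdifferentiable_chart (hφ : φ ∈ atlas E M) : φ.MDifferentiable 𝓘(ℝ, E) 𝓘(ℝ, E) :=
  have : IsManifold 𝓘(ℝ, E) 1 M := IsManifold.of_le (n := ∞) (by exact_mod_cast le_top)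
  mdifferentiable_of_mem_atlas hφ

theorem coframe_frame (hφ : φ ∈ atlas E M) (hy : y ∈ φ.target) (u : E) :
    coframe φ y (frame φ y u) = u :=
  congrArg (fun f : E →L[ℝ] E => f u) ((mdifferentiable_chart hφ).comp_symm_deriv hy)

theorem frame_bijective (hφ : φ ∈ atlas E M) (hy : y ∈ φ.target) :
    Function.Bijective (frame φ y) :=
  (mdifferentiable_chart hφ).symm.mfderiv_bijective hy

theorem frame_coframe (hφ : φ ∈ atlas E M) (hy : y ∈ φ.target)
    (u : TangentSpace 𝓘(ℝ, E) (φ.symm y)) : frame φ y (coframe φ y u) = u := by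
  obtain ⟨v, rfl⟩ := (frame_bijective hφ hy).2 u
  rw [coframe_frame hφ hy]

/-- The frame of a chart as an automorphism of the model space. -/
noncomputable def frameEquiv [FiniteDimensional ℝ E] (hφ : φ ∈ atlas E M) (hy : y ∈ φ.target) :
    E ≃L[ℝ] E :=
  ContinuousLinearEquiv.equivOfInverse (frame φ y : E →L[ℝ] E) (coframe φ y : E →L[ℝ] E)
    (coframe_frame hφ hy) (frame_coframe hφ hy)

theorem loc11_frame (hφ : φ ∈ atlas E M) (hy : y ∈ φ.target) (K : Tensor11 E M) (u : E) :
    frame φ y (loc11 φ K y u) = K (φ.symm y) (frame φ y u) :=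
  frame_coframe hφ hy _

omit [IsManifold 𝓘(ℝ, E) ∞ M] in
theorem loc02_apply (A : Tensor02 E M) (u v : E) :
    loc02 φ A y u v = A (φ.symm y) (frame φ y u) (frame φ y v) := rfl

omit [IsManifold 𝓘(ℝ, E) ∞ M] in
theorem loc01_apply (L : Tensor01 E M) (u : E) :
    loc01 φ L y u = L (φ.symm y) (frame φ y u) := rfl

theorem loc01_eq_zero_iff (hφ : φ ∈ atlas E M) (hy : y ∈ φ.target) (L : Tensor01 E M) :
    loc01 φ L y = 0 ↔ L (φ.symm y) = 0 := by
  constructor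
  · intro h
    ext u
    obtain ⟨v, rfl⟩ := (frame_bijective hφ hy).2 u
    exact congrArg (fun f : E →L[ℝ] ℝ => f v) h
  · intro h
    ext u
    rw [loc01_apply, h]; rfl

theorem loc02_eq_zero_iff (hφ : φ ∈ atlas E M) (hy : y ∈ φ.target) (A : Tensor02 E M) :
    loc02 φ A y = 0 ↔ A (φ.symm y) = 0 := by
  constructor
  · intro h
    ext u u'
    obtain ⟨v, rfl⟩ := (frame_bijective hφ hy).2 u
    obtain ⟨v', rfl⟩ := (frame_bijective hφ hy).2 u'
    exact congrArg (fun f : E →L[ℝ] E →L[ℝ] ℝ => f v v') h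
  · intro h
    ext u v
    rw [loc02_apply, h]; rfl

omit [IsManifold 𝓘(ℝ, E) ∞ M] in
theorem symm_loc {A : Tensor02 E M} (h : ∀ x u v, A x u v = A x v u)
    (φ : OpenPartialHomeomorph M E) (y u v : E) : loc02 φ A y u v = loc02 φ A y v u :=
  h (φ.symm y) (frame φ y u) (frame φ y v)

theorem complex_sq_loc {J : Tensor11 E M} (h : ∀ x u, J x (J x u) = -u) (hφ : φ ∈ atlas E M)
    (hy : y ∈ φ.target) (u : E) : loc11 φ J y (loc11 φ J y u) = -u := by
  apply (frame_bijective hφ hy).1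
  have h1 := loc11_frame hφ hy J (loc11 φ J y u)
  have h2 := loc11_frame hφ hy J u
  have h3 := h (φ.symm y) (frame φ y u)
  have h4 := map_neg (frame φ y) u
  rw [← h2] at h3
  exact (h1.trans h3).trans h4.symm

theorem hermitian_loc {J : Tensor11 E M} {A : Tensor02 E M}
    (h : ∀ x u v, A x (J x u) (J x v) = A x u v) (hφ : φ ∈ atlas E M)
    (hy : y ∈ φ.target) (u v : E) :
    loc02 φ A y (loc11 φ J y u) (loc11 φ J y v) = loc02 φ A y u v := by
  have h1 := loc11_frame hφ hy J u
  have h2 := loc11_frame hφ hy J v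
  have h3 := h (φ.symm y) (frame φ y u) (frame φ y v)
  rw [← h1, ← h2] at h3
  exact h3

theorem nondegenerate_loc {A : Tensor02 E M}
    (h : ∀ x u, (∀ v, A x u v = 0) → u = 0) (hφ : φ ∈ atlas E M)
    (hy : y ∈ φ.target) (u : E) (hu : ∀ v, loc02 φ A y u v = 0) : u = 0 := by
  have : frame φ y u = 0 := h _ _ fun v => by
    obtain ⟨v, rfl⟩ := (frame_bijective hφ hy).2 v
    exact hu v
  exact (frame_bijective hφ hy).1 (this.trans (map_zero _).symm)

theorem IsKahler.isKahlerOn {g : Tensor02 E M} {J : Tensor11 E M} (h : IsKahler g J)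
    (hφ : φ ∈ atlas E M) : IsKahlerOn (loc02 φ g) (loc11 φ J) φ.target where
  isOpen := φ.open_target
  smooth := h.smooth_metric φ hφ
  symm y _ u v := symm_loc h.symm φ y u v
  nondegenerate _ hy u hu := nondegenerate_loc h.nondegenerate hφ hy u hu
  smooth_complex := h.smooth_complex φ hφ
  complex_sq _ hy u := complex_sq_loc h.complex_sq hφ hy u
  hermitian _ hy u v := hermitian_loc h.hermitian hφ hy u v
  parallel y hy w u := h.parallel φ hφ y hy w u

theorem IsHprSolution.isSolutionOn {g : Tensor02 E M} {J : Tensor11 E M} {a : Tensor02 E M}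
    {lam : Tensor01 E M} (h : IsHprSolution g J a lam) (hφ : φ ∈ atlas E M) :
    IsSolutionOn (loc02 φ g) (loc11 φ J) (loc02 φ a) (loc01 φ lam) φ.target where
  smooth_tensor := h.smooth_tensor φ hφ
  smooth_form := h.smooth_form φ hφ
  symm y _ u v := symm_loc h.symm φ y u v
  hermitian _ hy u v := hermitian_loc h.hermitian hφ hy u v
  eqn y hy w u v := h.eqn φ hφ y hy w u v

/-! ### Change of charts -/

/-- The points of the first chart that also belong to the second one. -/
def overlap (φ ψ : OpenPartialHomeomorph M E) : Set E := (φ.symm.trans ψ).source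

omit [NormedSpace ℝ E] [ChartedSpace E M] [IsManifold 𝓘(ℝ, E) ∞ M] in
theorem mem_overlap : y ∈ overlap φ ψ ↔ y ∈ φ.target ∧ φ.symm y ∈ ψ.source := by
  simp [overlap]

omit [NormedSpace ℝ E] [ChartedSpace E M] [IsManifold 𝓘(ℝ, E) ∞ M] in
theorem isOpen_overlap : IsOpen (overlap φ ψ) := (φ.symm.trans ψ).open_source

/-- The change of coordinates. -/
def transition (φ ψ : OpenPartialHomeomorph M E) (y : E) : E := ψ (φ.symm y)

theorem contDiffOn_transition (hφ : φ ∈ atlas E M) (hψ : ψ ∈ atlas E M) :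
    ContDiffOn ℝ ∞ (transition φ ψ) (overlap φ ψ) := by
  have := HasGroupoid.compatible (G := contDiffGroupoid ∞ 𝓘(ℝ, E)) hφ hψ
  have h := (mem_groupoid_of_pregroupoid.1 this).1
  simp only [contDiffPregroupoid, modelWithCornersSelf_coe, modelWithCornersSelf_coe_symm,
    Function.comp_id, Function.id_comp, Set.range_id, Set.inter_univ, Set.preimage_id] at h
  exact h

omit [NormedSpace ℝ E] [ChartedSpace E M] [IsManifold 𝓘(ℝ, E) ∞ M] in
theorem transition_mem (hy : y ∈ overlap φ ψ) : transition φ ψ y ∈ ψ.target :=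
  ψ.map_source (mem_overlap.1 hy).2

theorem fderiv_transition (hφ : φ ∈ atlas E M) (hψ : ψ ∈ atlas E M) (hy : y ∈ overlap φ ψ)
    (u : E) : fderiv ℝ (transition φ ψ) y u
      = mfderiv 𝓘(ℝ, E) 𝓘(ℝ, E) ψ (φ.symm y) (frame φ y u) := by
  obtain ⟨h1, h2⟩ := mem_overlap.1 hy
  have := mfderiv_comp y ((mdifferentiable_chart hψ).mdifferentiableAt h2)
    ((mdifferentiable_chart hφ).mdifferentiableAt_symm h1)
  rw [← mfderiv_eq_fderiv]
  exact congrArg (fun f : E →L[ℝ] E => f u) this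

theorem frame_mfderiv (hψ : ψ ∈ atlas E M) {x : M} (hx : x ∈ ψ.source) (v : E) :
    (frame ψ (ψ x) : E →L[ℝ] E) ((mfderiv 𝓘(ℝ, E) 𝓘(ℝ, E) ψ x : E →L[ℝ] E) v) = v :=
  congrArg (fun f : E →L[ℝ] E => f v) ((mdifferentiable_chart hψ).symm_comp_deriv hx)

theorem fderiv_transition_bijective (hφ : φ ∈ atlas E M) (hψ : ψ ∈ atlas E M)
    (hy : y ∈ overlap φ ψ) : Function.Bijective (fderiv ℝ (transition φ ψ) y) := by
  obtain ⟨h1, h2⟩ := mem_overlap.1 hy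
  have e : ⇑(fderiv ℝ (transition φ ψ) y)
      = mfderiv 𝓘(ℝ, E) 𝓘(ℝ, E) ψ (φ.symm y) ∘ frame φ y :=
    funext fun u => fderiv_transition hφ hψ hy u
  rw [e]
  exact ((mdifferentiable_chart hψ).mfderiv_bijective h2).comp (frame_bijective hφ h1)

theorem loc01_transition (hφ : φ ∈ atlas E M) (hψ : ψ ∈ atlas E M) (hy : y ∈ overlap φ ψ)
    (L : Tensor01 E M) (u : E) :
    loc01 φ L y u = loc01 ψ L (transition φ ψ y) (fderiv ℝ (transition φ ψ) y u) := by
  obtain ⟨h1, h2⟩ := mem_overlap.1 hy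
  rw [fderiv_transition hφ hψ hy u]
  have e1 := frame_mfderiv hψ h2 (frame φ y u)
  have e2 := congr_section (F := E →L[ℝ] ℝ) L (ψ.left_inv h2)
  change (L (φ.symm y) : E →L[ℝ] ℝ) (frame φ y u)
    = (L (ψ.symm (ψ (φ.symm y))) : E →L[ℝ] ℝ) ((frame ψ (ψ (φ.symm y)) : E →L[ℝ] E)
      ((mfderiv 𝓘(ℝ, E) 𝓘(ℝ, E) ψ (φ.symm y) : E →L[ℝ] E) (frame φ y u)))
  rw [e1, e2]
  rfl

theorem loc02_transition (hφ : φ ∈ atlas E M) (hψ : ψ ∈ atlas E M) (hy : y ∈ overlap φ ψ)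
    (A : Tensor02 E M) (u v : E) :
    loc02 φ A y u v = loc02 ψ A (transition φ ψ y) (fderiv ℝ (transition φ ψ) y u)
      (fderiv ℝ (transition φ ψ) y v) := by
  obtain ⟨h1, h2⟩ := mem_overlap.1 hy
  rw [fderiv_transition hφ hψ hy u, fderiv_transition hφ hψ hy v]
  have e1 := frame_mfderiv hψ h2 (frame φ y u)
  have e1' := frame_mfderiv hψ h2 (frame φ y v)
  have e2 := congr_section (F := E →L[ℝ] E →L[ℝ] ℝ) A (ψ.left_inv h2)
  change (A (φ.symm y) : E →L[ℝ] E →L[ℝ] ℝ) (frame φ y u) (frame φ y v)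
    = (A (ψ.symm (ψ (φ.symm y))) : E →L[ℝ] E →L[ℝ] ℝ) ((frame ψ (ψ (φ.symm y)) : E →L[ℝ] E)
      ((mfderiv 𝓘(ℝ, E) 𝓘(ℝ, E) ψ (φ.symm y) : E →L[ℝ] E) (frame φ y u)))
      ((frame ψ (ψ (φ.symm y)) : E →L[ℝ] E)
      ((mfderiv 𝓘(ℝ, E) 𝓘(ℝ, E) ψ (φ.symm y) : E →L[ℝ] E) (frame φ y v)))
  rw [e1, e1', e2]
  rfl

theorem loc02_transition_eventually (hφ : φ ∈ atlas E M) (hψ : ψ ∈ atlas E M)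
    (hy : y ∈ overlap φ ψ) (A : Tensor02 E M) : ∀ᶠ x in 𝓝 y, ∀ u v,
      loc02 φ A x u v = loc02 ψ A (transition φ ψ x) (fderiv ℝ (transition φ ψ) x u)
        (fderiv ℝ (transition φ ψ) x v) := by
  filter_upwards [isOpen_overlap.mem_nhds hy] with x hx using loc02_transition hφ hψ hx A

theorem contDiffAt_transition (hφ : φ ∈ atlas E M) (hψ : ψ ∈ atlas E M) (hy : y ∈ overlap φ ψ) :
    ContDiffAt ℝ ∞ (transition φ ψ) y :=
  (contDiffOn_transition hφ hψ).contDiffAt (isOpen_overlap.mem_nhds hy)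

variable [FiniteDimensional ℝ E]

theorem IsKahler.christoffel_transition {g : Tensor02 E M} {J : Tensor11 E M} (h : IsKahler g J)
    (hφ : φ ∈ atlas E M) (hψ : ψ ∈ atlas E M) (hy : y ∈ overlap φ ψ) (u v : E) :
    fderiv ℝ (transition φ ψ) y (christoffel (loc02 φ g) y u v)
      = fderiv ℝ (fderiv ℝ (transition φ ψ)) y u v
      + christoffel (loc02 ψ g) (transition φ ψ y) (fderiv ℝ (transition φ ψ) y u)
        (fderiv ℝ (transition φ ψ) y v) :=
  christoffel_transform (h.isKahlerOn hφ).toIsMetricOn (h.isKahlerOn hψ).toIsMetricOn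
    (mem_overlap.1 hy).1 (transition_mem hy) (contDiffAt_transition hφ hψ hy)
    (fderiv_transition_bijective hφ hψ hy) (loc02_transition_eventually hφ hψ hy g) u v

theorem IsKahler.covDeriv01_transition {g : Tensor02 E M} {J : Tensor11 E M} (h : IsKahler g J)
    (hφ : φ ∈ atlas E M) (hψ : ψ ∈ atlas E M) (hy : y ∈ overlap φ ψ) {L : Tensor01 E M}
    (hL : Smooth01 L) (w u : E) :
    covDeriv01 (loc02 φ g) (loc01 φ L) y w u
      = covDeriv01 (loc02 ψ g) (loc01 ψ L) (transition φ ψ y) (fderiv ℝ (transition φ ψ) y w)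
        (fderiv ℝ (transition φ ψ) y u) :=
  covDeriv01_transform (h.isKahlerOn hφ).toIsMetricOn (h.isKahlerOn hψ).toIsMetricOn
    (mem_overlap.1 hy).1 (transition_mem hy) (contDiffAt_transition hφ hψ hy)
    (fderiv_transition_bijective hφ hψ hy) (loc02_transition_eventually hφ hψ hy g)
    (differentiableAt_of_smoothOn (hL φ hφ) φ.open_target (mem_overlap.1 hy).1)
    (differentiableAt_of_smoothOn (hL ψ hψ) ψ.open_target (transition_mem hy))
    (by filter_upwards [isOpen_overlap.mem_nhds hy] with x hx using
      loc01_transition hφ hψ hx L) w u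

end Charts
end HProj
namespace HProj

/-! ### The compactness argument and the vanishing of `λ`. -/

section Global

open Filter Topology

variable {E : Type*} [NormedAddCommGroup E] [NormedSpace ℝ E]
  {M : Type*} [TopologicalSpace M] [ChartedSpace E M]

/-- The value of a `(0,2)`-tensor at a point, on the model space. -/
def modelForm (A : Tensor02 E M) (x : M) : E →L[ℝ] E →L[ℝ] ℝ := A x

/-- The value of a one-form at a point, on the model space. -/
def modelCovector (L : Tensor01 E M) (x : M) : E →L[ℝ] ℝ := L x

/-- The operator `g⁻¹ A`, on the model space. -/
noncomputable def raise (g A : Tensor02 E M) (x : M) : E →L[ℝ] E :=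
  (modelForm g x).inverse ∘L modelForm A x

/-- The metric trace of a `(0,2)`-tensor. -/
noncomputable def metricTrace (g A : Tensor02 E M) (x : M) : ℝ :=
  LinearMap.trace ℝ E (raise g A x).toLinearMap

/-- The square of a one-form with respect to the inverse metric. -/
noncomputable def normSq (g : Tensor02 E M) (L : Tensor01 E M) (x : M) : ℝ :=
  modelCovector L x ((modelForm g x).inverse (modelCovector L x))

theorem fderiv_chart_eq_zero_of_le {f : M → ℝ} {x : M} (h : ∀ x', f x' ≤ f x) :
    fderiv ℝ (fun z => f ((chartAt E x).symm z)) (chartAt E x x) = 0 := by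
  apply IsLocalMax.fderiv_eq_zero
  -- The bound holds even for `z` outside the target of the chart, since the inverse chart always
  -- takes values in `M`.
  refine Eventually.of_forall fun z => ?_
  simp only [(chartAt E x).left_inv (mem_chart_source E x)]
  exact h _

theorem fderiv_chart_eq_zero_of_ge {f : M → ℝ} {x : M} (h : ∀ x', f x ≤ f x') :
    fderiv ℝ (fun z => f ((chartAt E x).symm z)) (chartAt E x x) = 0 := by
  apply IsLocalMin.fderiv_eq_zero
  refine Eventually.of_forall fun z => ?_
  simp only [(chartAt E x).left_inv (mem_chart_source E x)]
  exact h _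

variable [FiniteDimensional ℝ E] [IsManifold 𝓘(ℝ, E) ∞ M] {φ ψ : OpenPartialHomeomorph M E} {y : E}

theorem loc02_eq_bilinearComp (hφ : φ ∈ atlas E M) (hy : y ∈ φ.target) (A : Tensor02 E M) :
    loc02 φ A y = (modelForm A (φ.symm y)).bilinearComp
      (frameEquiv hφ hy : E →L[ℝ] E) (frameEquiv hφ hy : E →L[ℝ] E) := rfl

theorem loc01_eq_comp (hφ : φ ∈ atlas E M) (hy : y ∈ φ.target) (L : Tensor01 E M) :
    loc01 φ L y = (modelCovector L (φ.symm y)) ∘L (frameEquiv hφ hy : E →L[ℝ] E) := rfl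

theorem metricTrace_symm {g : Tensor02 E M} (hg : ∀ x u, (∀ v, g x u v = 0) → u = 0)
    (hφ : φ ∈ atlas E M) (hy : y ∈ φ.target) (A : Tensor02 E M) :
    metricTrace g A (φ.symm y)
      = LinearMap.trace ℝ E ((loc02 φ g y).inverse ∘L loc02 φ A y).toLinearMap := by
  rw [loc02_eq_bilinearComp hφ hy, loc02_eq_bilinearComp hφ hy, trace_bilinearComp]
  · rfl
  · exact hg (φ.symm y)

theorem normSq_symm {g : Tensor02 E M} (hg : ∀ x u, (∀ v, g x u v = 0) → u = 0)
    (hφ : φ ∈ atlas E M) (hy : y ∈ φ.target) (L : Tensor01 E M) :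
    normSq g L (φ.symm y) = loc01 φ L y ((loc02 φ g y).inverse (loc01 φ L y)) := by
  rw [loc02_eq_bilinearComp hφ hy, loc01_eq_comp hφ hy, inverse_bilinearComp]
  · simp [normSq]
  · exact hg (φ.symm y)

theorem IsKahler.fderiv_metricTrace {g : Tensor02 E M} {J : Tensor11 E M} (h : IsKahler g J)
    {a : Tensor02 E M} {lam : Tensor01 E M} (hs : IsHprSolution g J a lam)
    (hφ : φ ∈ atlas E M) (hy : y ∈ φ.target) :
    DifferentiableAt ℝ (fun z => metricTrace g a (φ.symm z)) y ∧
      fderiv ℝ (fun z => metricTrace g a (φ.symm z)) y = (4 : ℝ) • loc01 φ lam y := by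
  have key := (h.isKahlerOn hφ).fderiv_trace_solution (hs.isSolutionOn hφ) hy
  have e : (fun z => metricTrace g a (φ.symm z)) =ᶠ[𝓝 y]
      fun z => LinearMap.trace ℝ E ((loc02 φ g z).inverse ∘L loc02 φ a z).toLinearMap := by
    filter_upwards [φ.open_target.mem_nhds hy] with z hz using
      metricTrace_symm h.nondegenerate hφ hz a
  exact ⟨e.differentiableAt_iff.2 key.1, e.fderiv_eq.trans key.2⟩

theorem IsKahler.fderiv_normSq {g : Tensor02 E M} {J : Tensor11 E M} (h : IsKahler g J)
    {lam : Tensor01 E M} (hs : Smooth01 lam) {c : ℝ}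
    (hφ : φ ∈ atlas E M) (hy : y ∈ φ.target)
    (hc : ∀ w u, covDeriv01 (loc02 φ g) (loc01 φ lam) y w u = c * loc02 φ g y w u) :
    DifferentiableAt ℝ (fun z => normSq g lam (φ.symm z)) y ∧
      fderiv ℝ (fun z => normSq g lam (φ.symm z)) y = (2 * c) • loc01 φ lam y := by
  have key := (h.isKahlerOn hφ).fderiv_norm_sq hy (hs φ hφ) hc
  have e : (fun z => normSq g lam (φ.symm z)) =ᶠ[𝓝 y]
      fun z => loc01 φ lam z ((loc02 φ g z).inverse (loc01 φ lam z)) := by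
    filter_upwards [φ.open_target.mem_nhds hy] with z hz using
      normSq_symm h.nondegenerate hφ hz lam
  exact ⟨e.differentiableAt_iff.2 key.1, e.fderiv_eq.trans key.2⟩

variable [ConnectedSpace M] [CompactSpace M]

omit [ConnectedSpace M] [CompactSpace M] [FiniteDimensional ℝ E] in
theorem eq_zero_of_loc01_chartAt {lam : Tensor01 E M} {x : M}
    (h : loc01 (chartAt E x) lam (chartAt E x x) = 0) : lam x = 0 := by
  have h1 := (loc01_eq_zero_iff (chart_mem_atlas E x) (mem_chart_target E x) lam).1 h
  rwa [(chartAt E x).left_inv (mem_chart_source E x)] at h1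

omit [CompactSpace M] in
theorem IsKahler.parallel_form_eq_zero {g : Tensor02 E M} {J : Tensor11 E M} (h : IsKahler g J)
    {lam : Tensor01 E M} (hs : Smooth01 lam)
    (hp : ∀ φ ∈ atlas E M, ∀ y ∈ φ.target, ∀ w u,
      covDeriv01 (loc02 φ g) (loc01 φ lam) y w u = 0) {x₀ : M} (h0 : lam x₀ = 0) (x : M) :
    lam x = 0 := by
  refine forall_of_eventually_chart (E := E) (p := fun x => lam x = 0) ?_ ?_ h0 x
  · intro φ hφ y hy hx
    have := (h.isKahlerOn hφ).parallel_form_eventually_eq_zero hy (hs φ hφ) (hp φ hφ)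
      ((loc01_eq_zero_iff hφ hy lam).2 hx)
    filter_upwards [this, φ.open_target.mem_nhds hy] with z hz hzt using
      (loc01_eq_zero_iff hφ hzt lam).1 hz
  · intro φ hφ y hy hx
    have hne : loc01 φ lam y ≠ 0 := fun e => hx ((loc01_eq_zero_iff hφ hy lam).1 e)
    have hc : ContinuousAt (loc01 φ lam) y :=
      (differentiableAt_of_smoothOn (hs φ hφ) φ.open_target hy).continuousAt
    filter_upwards [hc.eventually_ne hne, φ.open_target.mem_nhds hy] with z hz hzt hcon using
      hz ((loc01_eq_zero_iff hφ hzt lam).2 hcon)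

/-- On a closed manifold a solution with `∇ lam = c g`, `c` constant, has `lam = 0`. -/
theorem IsKahler.form_eq_zero_of_hessian {g : Tensor02 E M} {J : Tensor11 E M} (h : IsKahler g J)
    {a : Tensor02 E M} {lam : Tensor01 E M} (hs : IsHprSolution g J a lam) (c : ℝ)
    (hc : ∀ φ ∈ atlas E M, ∀ y ∈ φ.target, ∀ w u,
      covDeriv01 (loc02 φ g) (loc01 φ lam) y w u = c * loc02 φ g y w u) (x : M) : lam x = 0 := by
  have hne : (Set.univ : Set M).Nonempty := Set.univ_nonempty
  -- For `c = 0` the form is parallel, and it vanishes at a maximum of the metric trace of `a`,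
  -- whose differential is `4 lam`.
  by_cases hc0 : c = 0
  · have hcont : Continuous (metricTrace g a) := continuous_of_chart (E := E) fun φ hφ y hy =>
      (h.fderiv_metricTrace hs hφ hy).1.continuousAt
    obtain ⟨x₀, -, hx₀⟩ := isCompact_univ.exists_isMaxOn hne hcont.continuousOn
    refine h.parallel_form_eq_zero hs.smooth_form (fun φ hφ y hy w u => ?_) (x₀ := x₀) ?_ x
    · rw [hc φ hφ y hy, hc0, zero_mul]
    · have h1 := fderiv_chart_eq_zero_of_le (E := E) (f := metricTrace g a) (x := x₀) (fun x' => hx₀ (Set.mem_univ x'))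
      rw [(h.fderiv_metricTrace hs (chart_mem_atlas E x₀) (mem_chart_target E x₀)).2] at h1
      exact eq_zero_of_loc01_chartAt ((smul_eq_zero.1 h1).resolve_left (by norm_num))
  -- For `c ≠ 0` critical points of `|lam|²` are zeros of `lam`, so its maximum and minimum are both
  -- `0`. It is then constant and every point is critical.
  · have hd : ∀ φ ∈ atlas E M, ∀ y ∈ φ.target, _ := fun φ hφ y hy =>
      h.fderiv_normSq hs.smooth_form hφ hy (hc φ hφ y hy)
    have hcont : Continuous (normSq g lam) := continuous_of_chart (E := E) fun φ hφ y hy =>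
      (hd φ hφ y hy).1.continuousAt
    have hcrit : ∀ x, fderiv ℝ (fun z => normSq g lam ((chartAt E x).symm z)) (chartAt E x x) = 0 →
        lam x = 0 := by
      intro x hx
      rw [(hd _ (chart_mem_atlas E x) _ (mem_chart_target E x)).2] at hx
      exact eq_zero_of_loc01_chartAt ((smul_eq_zero.1 hx).resolve_left
        (mul_ne_zero two_ne_zero hc0))
    have hz : ∀ x, lam x = 0 → normSq g lam x = 0 := by
      intro x hx
      have : modelCovector lam x = 0 := hx
      rw [normSq, this]; rfl
    obtain ⟨x₁, -, hx₁⟩ := isCompact_univ.exists_isMaxOn hne hcont.continuousOn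
    obtain ⟨x₂, -, hx₂⟩ := isCompact_univ.exists_isMinOn hne hcont.continuousOn
    have k1 := hz x₁ (hcrit x₁ (fderiv_chart_eq_zero_of_le fun x' => hx₁ (Set.mem_univ x')))
    have k2 := hz x₂ (hcrit x₂ (fderiv_chart_eq_zero_of_ge fun x' => hx₂ (Set.mem_univ x')))
    refine hcrit x (fderiv_chart_eq_zero_of_le fun x' => ?_)
    have l1 : normSq g lam x' ≤ normSq g lam x₁ := hx₁ (Set.mem_univ x')
    have l2 : normSq g lam x₂ ≤ normSq g lam x := hx₂ (Set.mem_univ x)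
    linarith

omit [ConnectedSpace M] [CompactSpace M] [FiniteDimensional ℝ E] [IsManifold 𝓘(ℝ, E) ∞ M] in
theorem loc02_sub_smul (φ : OpenPartialHomeomorph M E) (a g : Tensor02 E M) (c : ℝ) :
    loc02 φ (fun x => a x - c • g x) = fun y => loc02 φ a y - c • loc02 φ g y := rfl

omit [CompactSpace M] in
/-- A parallel tensor that is proportional to the metric at one point is so everywhere, with the
same factor. -/
theorem IsKahler.eq_smul_of_parallel {g : Tensor02 E M} {J : Tensor11 E M} (h : IsKahler g J)
    {a : Tensor02 E M} (hs : Smooth02 a)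
    (hp : ∀ φ ∈ atlas E M, ∀ y ∈ φ.target, ∀ w u v,
      covDeriv02 (loc02 φ g) (loc02 φ a) y w u v = 0) {c : ℝ} {x₀ : M} (h0 : a x₀ = c • g x₀)
    (x : M) : a x = c • g x := by
  let b : Tensor02 E M := fun x => a x - c • g x
  have hb : ∀ φ : OpenPartialHomeomorph M E, loc02 φ b = fun y => loc02 φ a y - c • loc02 φ g y :=
    fun φ => loc02_sub_smul φ a g c
  have hbs : Smooth02 b := fun φ hφ => by
    rw [hb]; exact (hs φ hφ).sub ((h.smooth_metric φ hφ).const_smul c)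
  have hbp : ∀ φ ∈ atlas E M, ∀ y ∈ φ.target, ∀ w u v,
      covDeriv02 (loc02 φ g) (loc02 φ b) y w u v = 0 := by
    intro φ hφ y hy w u v
    have dg := (h.isKahlerOn hφ).differentiableAt hy
    have e : fderiv ℝ (loc02 φ b) y = fderiv ℝ (loc02 φ a) y - c • fderiv ℝ (loc02 φ g) y := by
      have := fderiv_fun_sub (hs.differentiableAt hφ hy) (dg.const_smul c)
      rw [hb]
      refine this.trans ?_
      congr 1
      exact fderiv_const_smul (𝕜 := ℝ) dg c
    have h1 := hp φ hφ y hy w u v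
    have h2 := (h.isKahlerOn hφ).fderiv_eq hy w u v
    rw [covDeriv02] at h1 ⊢
    rw [e, hb]
    simp only [sub_apply, smul_apply, smul_eq_mul]
    linear_combination h1 - c * h2
  suffices b x = 0 from sub_eq_zero.1 this
  refine forall_of_eventually_chart (E := E) (p := fun x => b x = 0) ?_ ?_
    (x₀ := x₀) (sub_eq_zero.2 h0) x
  · intro φ hφ y hy hx
    have := (h.isKahlerOn hφ).parallel_bilin_eventually_eq_zero hy (hbs φ hφ) (hbp φ hφ)
      ((loc02_eq_zero_iff hφ hy b).2 hx)
    filter_upwards [this, φ.open_target.mem_nhds hy] with z hz hzt using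
      (loc02_eq_zero_iff hφ hzt b).1 hz
  · intro φ hφ y hy hx
    have hne : loc02 φ b y ≠ 0 := fun e => hx ((loc02_eq_zero_iff hφ hy b).1 e)
    have hc : ContinuousAt (loc02 φ b) y := (hbs.differentiableAt hφ hy).continuousAt
    filter_upwards [hc.eventually_ne hne, φ.open_target.mem_nhds hy] with z hz hzt hcon using
      hz ((loc02_eq_zero_iff hφ hzt b).2 hcon)

/-- If some solution with `∇ lam = mu g`, `mu` constant, is not proportional to `g`, then every
solution is parallel. -/
theorem IsKahler.form_eq_zero_of_extendedConstant {g : Tensor02 E M} {J : Tensor11 E M}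
    (h : IsKahler g J) (hB : IsExtendedConstant g J 0) {a : Tensor02 E M} {lam : Tensor01 E M}
    (hs : IsHprSolution g J a lam) (x : M) : lam x = 0 := by
  obtain ⟨a₀, lam₀, mu₀, h₀, hne⟩ := hB
  -- This is where `B = 0` enters: `dμ₀ = 2B λ₀ = 0`.
  have hmu : ∀ x x', mu₀ x' = mu₀ x := by
    refine const_of_fderiv_chart_eq_zero (E := E) fun φ hφ y hy => ⟨?_, ?_⟩
    · have h1 := (h₀.smooth_function.mdifferentiable (by simp) (φ.symm y)).comp y
        ((mdifferentiable_chart hφ).mdifferentiableAt_symm hy)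
      exact h1.differentiableAt
    · ext u
      rw [h₀.gradient φ hφ y hy]; simp
  have hlam₀ : ∀ x, lam₀ x = 0 := by
    refine h.form_eq_zero_of_hessian h₀.hpr (mu₀ x) fun φ hφ y hy w u => ?_
    rw [h₀.hessian φ hφ y hy, hmu x, zero_mul, add_zero, (h.isKahlerOn hφ).symm y hy]
  obtain rfl : lam₀ = fun _ => 0 := funext hlam₀
  have hpar : ∀ φ ∈ atlas E M, IsSolutionOn (loc02 φ g) (loc11 φ J) (loc02 φ a₀) (fun _ => 0)
      φ.target := fun φ hφ => h₀.hpr.isSolutionOn hφ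
  -- `a₀` is now parallel, so proportionality to `g` at one point would spread over `M` with the
  -- same factor.
  have hnot : ∀ φ ∈ atlas E M, ∀ y ∈ φ.target,
      ¬ ∃ c : ℝ, loc02 φ a₀ y = c • loc02 φ g y := by
    rintro φ hφ y hy ⟨c, hcy⟩
    refine hne ⟨c, h.eq_smul_of_parallel h₀.hpr.smooth_tensor (fun φ hφ y hy w u v => ?_)
      (x₀ := φ.symm y) ?_⟩
    · have := (hpar φ hφ).eqn y hy w u v
      simpa using this
    · have h1 : loc02 φ (fun x => a₀ x - c • g x) y = 0 := by
        rw [loc02_sub_smul]; exact sub_eq_zero.2 hcy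
      exact sub_eq_zero.1 ((loc02_eq_zero_iff hφ hy (fun x => a₀ x - c • g x)).1 h1)
  have hex : ∀ φ ∈ atlas E M, ∀ y ∈ φ.target, ∃ μ : ℝ, ∀ w u,
      covDeriv01 (loc02 φ g) (loc01 φ lam) y w u = μ * loc02 φ g y w u := fun φ hφ y hy =>
    (h.isKahlerOn hφ).hessian_eq_smul (hpar φ hφ) (hnot φ hφ) (hs.isSolutionOn hφ)
      (fun y hy w u => (h.isKahlerOn hφ).covDeriv_symm (hs.isSolutionOn hφ) hy w u) hy
  -- The factor is chosen at each point in the preferred chart there; tensoriality of `∇ lam` makes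
  -- it valid in every other chart.
  choose mu hmu' using fun x : M => hex _ (chart_mem_atlas E x) _ (mem_chart_target E x)
  have hall : ∀ φ ∈ atlas E M, ∀ y ∈ φ.target, ∀ w u,
      covDeriv01 (loc02 φ g) (loc01 φ lam) y w u = mu (φ.symm y) * loc02 φ g y w u := by
    intro φ hφ y hy w u
    have hψ := chart_mem_atlas E (φ.symm y)
    have hyo : y ∈ overlap φ (chartAt E (φ.symm y)) :=
      mem_overlap.2 ⟨hy, mem_chart_source E _⟩
    rw [h.covDeriv01_transition hφ hψ hyo hs.smooth_form, loc02_transition hφ hψ hyo]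
    exact hmu' (φ.symm y) _ _
  have hconst : ∀ x x', mu x' = mu x :=
    const_of_fderiv_chart_eq_zero (E := E) fun φ hφ y hy =>
      (h.isKahlerOn hφ).fderiv_hessian_factor (hpar φ hφ) (hnot φ hφ) (hs.smooth_form φ hφ)
        (hall φ hφ) hy
  exact h.form_eq_zero_of_hessian hs (mu x) (fun φ hφ y hy w u => by
    rw [hall φ hφ y hy, hconst x]) x

end Global
end HProj
namespace HProj

/-! ### The differential of the determinant. -/

section Determinant

open Filter Topology

variable {E : Type*} [NormedAddCommGroup E] [NormedSpace ℝ E] [FiniteDimensional ℝ E]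

theorem contDiff_det : ContDiff ℝ ∞ fun A : E →L[ℝ] E => LinearMap.det A.toLinearMap := by
  let b := Module.finBasis ℝ E
  have h : (fun A : E →L[ℝ] E => LinearMap.det A.toLinearMap)
      = fun A => ∑ σ : Equiv.Perm (Fin (Module.finrank ℝ E)), ((Equiv.Perm.sign σ : ℤ) : ℝ) *
        ∏ i, b.repr (A (b i)) (σ i) := by
    funext A
    rw [← LinearMap.det_toMatrix b, Matrix.det_apply']
    simp [LinearMap.toMatrix_apply]
  rw [h]
  refine ContDiff.sum fun σ _ => contDiff_const.mul (contDiff_prod fun i _ => ?_)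
  let l : (E →L[ℝ] E) →ₗ[ℝ] ℝ := b.coord (σ i) ∘ₗ
    (ContinuousLinearMap.apply ℝ E (b i)).toLinearMap
  exact (LinearMap.toContinuousLinearMap l).contDiff

theorem fderiv_det_one (X : E →L[ℝ] E) :
    fderiv ℝ (fun A : E →L[ℝ] E => LinearMap.det A.toLinearMap) (ContinuousLinearMap.id ℝ E) X
      = LinearMap.trace ℝ E X.toLinearMap := by
  let b := Module.finBasis ℝ E
  have h1 : HasDerivAt (fun t : ℝ => ContinuousLinearMap.id ℝ E + t • X) X 0 := by
    simpa using ((hasDerivAt_id (0 : ℝ)).smul_const X).const_add (ContinuousLinearMap.id ℝ E)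
  have hd : HasFDerivAt (fun A : E →L[ℝ] E => LinearMap.det A.toLinearMap)
      (fderiv ℝ (fun A : E →L[ℝ] E => LinearMap.det A.toLinearMap) (ContinuousLinearMap.id ℝ E))
      (ContinuousLinearMap.id ℝ E + (0 : ℝ) • X) := by
    rw [zero_smul, add_zero]
    exact ((contDiff_det (E := E)).differentiable (by simp) _).hasFDerivAt
  have h2 := hd.comp_hasDerivAt (0 : ℝ) h1
  set m := LinearMap.toMatrix b b X.toLinearMap
  -- `det(1 + tX) = 1 + t tr X + t² p(t)` with a polynomial `p`; the derivative at `0` can be read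
  -- off.
  have h3 : ((fun A : E →L[ℝ] E => LinearMap.det A.toLinearMap) ∘
      fun t : ℝ => ContinuousLinearMap.id ℝ E + t • X) = fun t : ℝ => 1 + m.trace * t
        + Polynomial.eval t
          (1 + (Polynomial.X : Polynomial ℝ) • m.map ⇑Polynomial.C).det.divX.divX * t ^ 2 := by
    funext t
    rw [← Matrix.det_one_add_smul]
    simp only [Function.comp_apply]
    rw [← LinearMap.det_toMatrix b]
    congr 1
    simp [m]
  rw [h3] at h2
  set p := (1 + (Polynomial.X : Polynomial ℝ) • m.map ⇑Polynomial.C).det.divX.divX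
  have h4 : HasDerivAt (fun t : ℝ => 1 + m.trace * t + Polynomial.eval t p * t ^ 2)
      m.trace 0 := by
    have := (((hasDerivAt_id' (0 : ℝ)).const_mul m.trace).const_add 1).fun_add
      ((p.hasDerivAt 0).fun_mul (hasDerivAt_pow 2 (0 : ℝ)))
    exact this.congr_deriv (by simp)
  rw [LinearMap.trace_eq_matrix_trace ℝ b]
  exact h2.unique h4

/-- Jacobi's formula: if `B' = B ∘ Q` then the logarithmic derivative of `det B` is `tr Q`. -/
theorem fderiv_log_det {B : E → E →L[ℝ] E} {y : E} (hB : DifferentiableAt ℝ B y)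
    (hdet : LinearMap.det (B y).toLinearMap ≠ 0) {w : E} {Q : E →L[ℝ] E}
    (hQ : fderiv ℝ B y w = B y ∘L Q) :
    fderiv ℝ (fun x => Real.log (LinearMap.det (B x).toLinearMap)) y w
      = LinearMap.trace ℝ E Q.toLinearMap := by
  have hunit : IsUnit (LinearMap.det (B y).toLinearMap) := isUnit_iff_ne_zero.2 hdet
  let e : E ≃ₗ[ℝ] E := LinearEquiv.ofIsUnitDet (v := Module.finBasis ℝ E)
    (v' := Module.finBasis ℝ E) (f := (B y).toLinearMap) (by rwa [LinearMap.det_toMatrix])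
  -- Multiplying by `C = B(y)⁻¹` moves the base point to the identity, where the differential of
  -- `det` is the trace.
  let C : E →L[ℝ] E := LinearMap.toContinuousLinearMap e.symm.toLinearMap
  have hC : C ∘L B y = ContinuousLinearMap.id ℝ E := by
    ext u; exact e.symm_apply_apply u
  have hC' : B y ∘L C = ContinuousLinearMap.id ℝ E := by
    ext u; exact e.apply_symm_apply u
  have hfac : (fun x => LinearMap.det (B x).toLinearMap)
      = fun x => LinearMap.det (B y).toLinearMap * LinearMap.det (C ∘L B x).toLinearMap := by
    funext x
    rw [← LinearMap.det_comp]
    congr 1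
    change (B x).toLinearMap = ((B y ∘L C) ∘L B x).toLinearMap
    rw [hC']; rfl
  have hCB : HasFDerivAt (fun x => C ∘L B x)
      ((ContinuousLinearMap.compL ℝ E E E C) ∘L fderiv ℝ B y) y :=
    (ContinuousLinearMap.compL ℝ E E E C).hasFDerivAt.comp y hB.hasFDerivAt
  have hd : HasFDerivAt (fun A : E →L[ℝ] E => LinearMap.det A.toLinearMap)
      (fderiv ℝ (fun A : E →L[ℝ] E => LinearMap.det A.toLinearMap) (ContinuousLinearMap.id ℝ E))
      (C ∘L B y) := by
    rw [hC]
    exact ((contDiff_det (E := E)).differentiable (by simp) _).hasFDerivAt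
  have h2 : HasFDerivAt (fun x => LinearMap.det (B x).toLinearMap)
      (LinearMap.det (B y).toLinearMap • (fderiv ℝ (fun A : E →L[ℝ] E =>
        LinearMap.det A.toLinearMap) (ContinuousLinearMap.id ℝ E) ∘L
        ((ContinuousLinearMap.compL ℝ E E E C) ∘L fderiv ℝ B y))) y := by
    rw [hfac]
    exact (hd.comp y hCB).const_mul (LinearMap.det (B y).toLinearMap)
  rw [(h2.log hdet).fderiv]
  simp only [smul_apply, ContinuousLinearMap.comp_apply, smul_eq_mul]
  rw [inv_mul_cancel_left₀ hdet, ContinuousLinearMap.compL_apply, hQ,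
    ← ContinuousLinearMap.comp_assoc, hC, ContinuousLinearMap.id_comp, fderiv_det_one]

end Determinant

/-! ### From a second metric to a solution of the `h`-projective equation. -/

section Equivalence

open Filter Topology

variable {E : Type*} [NormedAddCommGroup E] [NormedSpace ℝ E] [FiniteDimensional ℝ E]
  {G Gb : E → E →L[ℝ] E →L[ℝ] ℝ} {J : E → E →L[ℝ] E} {U : Set E} {y : E}

theorem det_inverse_comp_ne_zero {G Gb : E →L[ℝ] E →L[ℝ] ℝ}
    (hG : ∀ u, (∀ v, G u v = 0) → u = 0) (hGb : ∀ u, (∀ v, Gb u v = 0) → u = 0) :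
    LinearMap.det (G.inverse ∘L Gb).toLinearMap ≠ 0 := by
  have : (G.inverse ∘L Gb).toLinearMap ∘ₗ (Gb.inverse ∘L G).toLinearMap = LinearMap.id := by
    ext u
    simp [apply_inverse hGb, inverse_apply hG]
  intro h0
  have h1 := congrArg LinearMap.det this
  rw [LinearMap.det_comp, h0, zero_mul, LinearMap.det_id] at h1
  exact zero_ne_one h1

/-- The difference of two Levi-Civita connections. -/
noncomputable def christoffelDiff (G Gb : E → E →L[ℝ] E →L[ℝ] ℝ) (y w : E) : E →ₗ[ℝ] E :=
  christoffelMap Gb y w - christoffelMap G y w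

omit [FiniteDimensional ℝ E] in
theorem christoffelDiff_apply (w u : E) :
    christoffelDiff G Gb y w u = christoffel Gb y w u - christoffel G y w u := rfl

/-- The logarithmic derivative of the ratio of the volume forms of two metrics. -/
theorem fderiv_log_det_ratio (h : IsMetricOn G U) (hb : IsMetricOn Gb U) (hy : y ∈ U) (w : E) :
    fderiv ℝ (fun x => Real.log (LinearMap.det ((G x).inverse ∘L Gb x).toLinearMap)) y w
      = 2 * LinearMap.trace ℝ E (christoffelDiff G Gb y w) := by
  have n := h.nondegenerate y hy
  have nb := hb.nondegenerate y hy
  have dG := h.differentiableAt hy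
  have dGb := hb.differentiableAt hy
  have dI : DifferentiableAt ℝ (fun x => (G x).inverse) y :=
    differentiableAt_of_smoothOn h.contDiffOn_inverse h.isOpen hy
  have dB : DifferentiableAt ℝ (fun x => (G x).inverse ∘L Gb x) y := dI.clm_comp dGb
  let D := LinearMap.toContinuousLinearMap (christoffelDiff G Gb y w)
  let Γ := LinearMap.toContinuousLinearMap (christoffelMap G y w)
  let Γb := LinearMap.toContinuousLinearMap (christoffelMap Gb y w)
  -- `Da` is the `Gb`-adjoint of the connection difference `D`. In `hQ`, `B⁻¹B'` is `Γb - B⁻¹ΓB +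
  -- Da`, whose trace is `tr D + tr Da = 2 tr D`.
  let Da : E →L[ℝ] E := (Gb y).inverse ∘L ((Gb y).flip ∘L D).flip
  have hDa : ∀ u v, Gb y (Da u) v = Gb y u (D v) := fun u v => by
    simp only [Da, ContinuousLinearMap.comp_apply, apply_inverse nb,
      ContinuousLinearMap.flip_apply]
  set B : E → E →L[ℝ] E := fun x => (G x).inverse ∘L Gb x with hBdef
  let C : E →L[ℝ] E := (Gb y).inverse ∘L G y
  have hB : ∀ x ∈ U, ∀ u, G x (B x u) = Gb x u := fun x hx u => by
    simp only [hBdef, ContinuousLinearMap.comp_apply, apply_inverse (h.nondegenerate x hx)]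
  have hBC : ∀ u, B y (C u) = u := fun u => by
    simp [hBdef, C, apply_inverse nb, inverse_apply n]
  have hCB : ∀ u, C (B y u) = u := fun u => by
    simp [hBdef, C, apply_inverse n, inverse_apply nb]
  have hQ : fderiv ℝ B y w = B y ∘L (Γb - C ∘L Γ ∘L B y + Da) := by
    ext u
    rw [← sub_eq_zero]
    refine n _ fun v => ?_
    have e : (fun x => G x (B x u) v) =ᶠ[𝓝 y] fun x => Gb x u v := by
      filter_upwards [h.isOpen.mem_nhds hy] with x hx using by rw [hB x hx]
    have e2 := congrArg (fun f => f w) (e.fderiv_eq (𝕜 := ℝ))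
    rw [fderiv_clm_apply_apply dG (dB.clm_apply (differentiableAt_const u))
      (differentiableAt_const v), fderiv_apply_const dB, fderiv_apply_const_const dGb,
      h.fderiv_eq hy, hb.fderiv_eq hy, hB y hy] at e2
    simp only [fderiv_fun_const, Pi.zero_apply, zero_apply, map_zero, add_zero] at e2
    have e3 := hDa u v
    have e4 : D v = christoffel Gb y w v - christoffel G y w v := rfl
    rw [e4, map_sub] at e3
    simp only [ContinuousLinearMap.comp_apply, sub_apply, add_apply, map_sub, map_add, hBC,
      hB y hy, e3]
    change _ - (Gb y (christoffel Gb y w u) v - G y (christoffel G y w (B y u)) v + _) = 0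
    linear_combination e2
  rw [fderiv_log_det dB (det_inverse_comp_ne_zero n nb) hQ]
  have t1 : LinearMap.trace ℝ E (C ∘L Γ ∘L B y).toLinearMap
      = LinearMap.trace ℝ E (christoffelMap G y w) := by
    have : (C ∘L Γ ∘L B y).toLinearMap
      = C.toLinearMap ∘ₗ (christoffelMap G y w ∘ₗ (B y).toLinearMap) := rfl
    rw [this, LinearMap.trace_comp_comm', LinearMap.comp_assoc]
    congr 1
    ext u
    simp [hBC]
  have t2 : LinearMap.trace ℝ E Da.toLinearMap
      = LinearMap.trace ℝ E (christoffelDiff G Gb y w) :=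
    trace_eq_of_adjoint nb hDa
  have t3 : (Γb - C ∘L Γ ∘L B y + Da).toLinearMap
      = christoffelMap Gb y w - (C ∘L Γ ∘L B y).toLinearMap + Da.toLinearMap := rfl
  rw [t3, map_add, map_sub, t1, t2, ← map_sub]
  change LinearMap.trace ℝ E (christoffelDiff G Gb y w) + _ = _
  ring

/-- The tensor `e^{2f} g gbar⁻¹ g` solves the `h`-projective equation, where `df = Ψ`. -/
theorem covDeriv02_equivalent (h : IsKahlerOn G J U) (hb : IsKahlerOn Gb J U) (hy : y ∈ U)
    {f : E → ℝ} (df : DifferentiableAt ℝ f y)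
    (hΨ : ∀ u v, christoffelDiff G Gb y u v = fderiv ℝ f y u • v + fderiv ℝ f y v • u
      - fderiv ℝ f y (J y u) • J y v - fderiv ℝ f y (J y v) • J y u) (w u v : E) :
    covDeriv02 G (fun x => Real.exp (2 * f x) • (G x ∘L ((Gb x).inverse ∘L G x))) y w u v
      = -Real.exp (2 * f y) * (fderiv ℝ f y ((Gb y).inverse (G y u)) * G y v w
        + fderiv ℝ f y ((Gb y).inverse (G y v)) * G y u w
        - fderiv ℝ f y ((Gb y).inverse (G y (J y u))) * G y v (J y w)
        - fderiv ℝ f y ((Gb y).inverse (G y (J y v))) * G y u (J y w)) := by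
  have n := h.nondegenerate y hy
  have nb := hb.nondegenerate y hy
  have dG := h.differentiableAt hy
  have dGb := hb.differentiableAt hy
  have dI : DifferentiableAt ℝ (fun x => (Gb x).inverse) y :=
    differentiableAt_of_smoothOn hb.contDiffOn_inverse h.isOpen hy
  have dK : DifferentiableAt ℝ (fun x => (Gb x).inverse ∘L G x) y := dI.clm_comp dG
  set K : E → E →L[ℝ] E := fun x => (Gb x).inverse ∘L G x with hKdef
  have hK : ∀ x ∈ U, ∀ u, Gb x (K x u) = G x u := fun x hx u => by
    simp only [hKdef, ContinuousLinearMap.comp_apply, apply_inverse (hb.nondegenerate x hx)]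
  have hKe : ∀ u, (Gb y).inverse (G y u) = K y u := fun u => rfl
  simp only [hKe]
  have hKs : ∀ u v, G y (K y u) v = G y u (K y v) := fun u v => by
    rw [h.symm y hy, ← hK y hy, ← hK y hy u, hb.symm y hy]
  have hKJ : ∀ u, K y (J y u) = J y (K y u) := h.complex_comm_of_equiv hb hy
  have dexp : HasFDerivAt (fun x => Real.exp (2 * f x))
      (Real.exp (2 * f y) • (2 : ℝ) • fderiv ℝ f y) y := (df.hasFDerivAt.const_mul 2).exp
  have dGK : DifferentiableAt ℝ (fun x => G x ∘L K x) y := dG.clm_comp dK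
  have dA : DifferentiableAt ℝ (fun x => Real.exp (2 * f x) • (G x ∘L K x)) y :=
    dexp.differentiableAt.fun_smul dGK
  have dGKu : ∀ u v, DifferentiableAt ℝ (fun x => G x (K x u) v) y := fun u v =>
    (dG.clm_apply (dK.clm_apply (differentiableAt_const u))).clm_apply (differentiableAt_const v)
  have hdA : fderiv ℝ (fun x => Real.exp (2 * f x) • (G x ∘L K x)) y w u v
      = Real.exp (2 * f y) * (2 * fderiv ℝ f y w * G y (K y u) v
        + G y (christoffel G y w (K y u)) v + G y (K y u) (christoffel G y w v)
        + G y (fderiv ℝ K y w u) v) := by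
    rw [← fderiv_apply_const_const dA]
    have e : (fun x => (Real.exp (2 * f x) • (G x ∘L K x)) u v)
        = fun x => Real.exp (2 * f x) * G x (K x u) v := rfl
    rw [e, fderiv_fun_mul dexp.differentiableAt (dGKu u v), dexp.fderiv]
    simp only [add_apply, smul_apply, smul_eq_mul]
    rw [fderiv_clm_apply_apply dG (dK.clm_apply (differentiableAt_const u))
      (differentiableAt_const v), fderiv_apply_const dK, h.fderiv_eq hy]
    simp
    ring
  -- Obtained by differentiating `Gb(Ku, ·) = G(u, ·)` and testing on `Kv`.
  have hdK : G y (fderiv ℝ K y w u) v = G y (christoffel G y w u) (K y v)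
      + G y u (christoffel G y w (K y v)) - Gb y (christoffel Gb y w (K y u)) (K y v)
      - Gb y (K y u) (christoffel Gb y w (K y v)) := by
    have e : ∀ v, (fun x => Gb x (K x u) v) =ᶠ[𝓝 y] fun x => G x u v := fun v => by
      filter_upwards [h.isOpen.mem_nhds hy] with x hx using by rw [hK x hx]
    have e2 := congrArg (fun f => f w) ((e (K y v)).fderiv_eq (𝕜 := ℝ))
    rw [fderiv_clm_apply_apply dGb (dK.clm_apply (differentiableAt_const u))
      (differentiableAt_const _), fderiv_apply_const dK, fderiv_apply_const_const dG,
      h.fderiv_eq hy, hb.fderiv_eq hy] at e2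
    simp only [fderiv_fun_const, Pi.zero_apply, zero_apply, map_zero, add_zero] at e2
    rw [h.symm y hy, ← hK y hy v, hb.symm y hy]
    linear_combination e2
  have p1 : christoffel Gb y w (K y u) = christoffel G y w (K y u)
      + christoffelDiff G Gb y w (K y u) := by rw [christoffelDiff_apply]; abel
  have p2 : christoffel Gb y w (K y v) = christoffel G y w (K y v)
      + christoffelDiff G Gb y w (K y v) := by rw [christoffelDiff_apply]; abel
  -- The connection difference contributes `-2 df(w) G(Ku, v)`, which the derivative of `e^{2f}`
  -- cancels; this fixes the exponent. The terms with `df(Jw)` cancel because `J` is skew for `Gb`.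
  rw [covDeriv02, hdA, hdK, p1, p2, hΨ, hΨ]
  simp only [smul_apply, ContinuousLinearMap.comp_apply, smul_eq_mul, map_add, map_sub, map_smul,
    add_apply, sub_apply, hKe]
  have c1 : G y (christoffel G y w (K y u)) v = Gb y (christoffel G y w (K y u)) (K y v) := by
    rw [h.symm y hy, ← hK y hy v, hb.symm y hy]
  have c2 : G y u (christoffel G y w (K y v)) = Gb y (K y u) (christoffel G y w (K y v)) := by
    rw [← hK y hy u]
  have c3 : G y (K y (christoffel G y w u)) v = G y (christoffel G y w u) (K y v) := hKs _ _
  have c4 : Gb y (K y u) (K y v) = G y (K y u) v := by rw [hK y hy, hKs]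
  have c5 : Gb y w (K y v) = G y v w := by rw [hb.symm y hy, hK y hy]
  have c6 : Gb y (K y u) w = G y u w := by rw [hK y hy]
  have c7 : Gb y (J y w) (K y v) = G y v (J y w) := by rw [hb.symm y hy, hK y hy]
  have c8 : Gb y (K y u) (J y w) = G y u (J y w) := by rw [hK y hy]
  have c9 : Gb y (J y (K y u)) (K y v) = -Gb y (K y u) (J y (K y v)) := hb.skew hy _ _
  rw [c1, c2, c3, c4, c5, c6, c7, c8, c9, hKJ, hKJ]
  ring

end Equivalence
end HProj
namespace HProj

/-! ### Existence of smooth geodesics in a chart. -/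

section Geodesic

open Filter Topology

variable {E : Type*} [NormedAddCommGroup E] [NormedSpace ℝ E] [FiniteDimensional ℝ E]

/-- Bootstrapping: if `α` is `C^k`, then so is its derivative `v ∘ α`, hence `α` is `C^{k+1}`. -/
theorem contDiffOn_of_autonomous_ode {F : Type*} [NormedAddCommGroup F] [NormedSpace ℝ F]
    {v : F → F} {V : Set F} (hv : ContDiffOn ℝ ∞ v V) {α : ℝ → F} {I : Set ℝ} (hI : IsOpen I)
    (hα : ∀ t ∈ I, HasDerivAt α (v (α t)) t) (hmem : Set.MapsTo α I V) :
    ContDiffOn ℝ ∞ α I := by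
  have hd : DifferentiableOn ℝ α I := fun t ht =>
    (hα t ht).differentiableAt.differentiableWithinAt
  rw [contDiffOn_infty]
  intro n
  induction n with
  | zero => exact contDiffOn_zero.2 hd.continuousOn
  | succ k ih =>
    have : ((k + 1 : ℕ) : ℕ∞ω) = (k : ℕ∞ω) + 1 := by norm_cast
    rw [this, contDiffOn_succ_iff_deriv_of_isOpen hI]
    refine ⟨hd, fun h => absurd h (by norm_cast), ?_⟩
    have h1 : ContDiffOn ℝ k (fun t => v (α t)) I :=
      (hv.of_le (by exact_mod_cast le_top)).comp ih hmem
    exact h1.congr fun t ht => (hα t ht).deriv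

theorem IsMetricOn.exists_geodesic {G : E → E →L[ℝ] E →L[ℝ] ℝ} {U : Set E} (h : IsMetricOn G U)
    {y : E} (hy : y ∈ U) (u : E) : ∃ (c : ℝ → E) (ε : ℝ), 0 < ε ∧
      ContDiffOn ℝ ∞ c (Set.Ioo (-ε) ε) ∧ c 0 = y ∧ deriv c 0 = u ∧
      ∀ t ∈ Set.Ioo (-ε) ε, c t ∈ U ∧
        deriv (deriv c) t = -christoffel G (c t) (deriv c t) (deriv c t) := by
  have : CompleteSpace E := FiniteDimensional.complete ℝ E
  -- The geodesic equation as a first-order system for position and velocity, solved by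
  -- Picard–Lindelöf.
  let v : E × E → E × E := fun p => (p.2, -christoffel G p.1 p.2 p.2)
  have hopen : IsOpen (U ×ˢ (Set.univ : Set E)) := h.isOpen.prod isOpen_univ
  have hv : ContDiffOn ℝ ∞ v (U ×ˢ Set.univ) := by
    have h1 : ContDiffOn ℝ ∞ (fun p : E × E => christoffel G p.1 p.2 p.2) (U ×ˢ Set.univ) :=
      h.contDiffOn_christoffel.comp (g := fun p : E × E × E => christoffel G p.1 p.2.1 p.2.2)
        (f := fun p : E × E => (p.1, p.2, p.2))
        ((contDiff_fst.prodMk (contDiff_snd.prodMk contDiff_snd)).contDiffOn)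
        (fun p hp => ⟨hp.1, trivial⟩)
    exact contDiff_snd.contDiffOn.prodMk h1.neg
  have hv1 : ContDiffAt ℝ 1 v (y, u) :=
    (hv.contDiffAt (hopen.mem_nhds ⟨hy, trivial⟩)).of_le (by exact_mod_cast le_top)
  obtain ⟨r, hr, ε, hε, hα⟩ :=
    hv1.exists_forall_mem_closedBall_exists_eq_forall_mem_Ioo_hasDerivAt 0
  obtain ⟨α, hα0, hα⟩ := hα (y, u) (Metric.mem_closedBall_self hr.le)
  rw [zero_sub, zero_add] at hα
  have hcont : ContinuousAt α 0 := (hα 0 ⟨by linarith, hε⟩).continuousAt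
  have hev : ∀ᶠ t in 𝓝 (0 : ℝ), α t ∈ U ×ˢ (Set.univ : Set E) :=
    hcont.eventually (hopen.mem_nhds (by rw [hα0]; exact ⟨hy, trivial⟩))
  obtain ⟨δ, hδ, hb⟩ := Metric.eventually_nhds_iff_ball.1 hev
  have hI : ∀ t ∈ Set.Ioo (-(min ε δ)) (min ε δ), t ∈ Set.Ioo (-ε) ε ∧ t ∈ Metric.ball (0 : ℝ) δ := by
    intro t ht
    have h1 := min_le_left ε δ
    have h2 := min_le_right ε δ
    refine ⟨⟨by linarith [ht.1], by linarith [ht.2]⟩, ?_⟩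
    rw [Metric.mem_ball, Real.dist_eq, sub_zero, abs_lt]
    exact ⟨by linarith [ht.1], by linarith [ht.2]⟩
  have hpos : 0 < min ε δ := lt_min hε hδ
  have hd1 : ∀ t ∈ Set.Ioo (-(min ε δ)) (min ε δ), HasDerivAt (fun s => (α s).1) (α t).2 t :=
    fun t ht => (hα t (hI t ht).1).fst
  have hd2 : ∀ t ∈ Set.Ioo (-(min ε δ)) (min ε δ), HasDerivAt (fun s => (α s).2)
      (-christoffel G (α t).1 (α t).2 (α t).2) t := fun t ht => (hα t (hI t ht).1).snd
  have hsm := contDiffOn_of_autonomous_ode hv (I := Set.Ioo (-(min ε δ)) (min ε δ)) isOpen_Ioo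
    (fun t ht => hα t (hI t ht).1) (fun t ht => hb t (hI t ht).2)
  have h0 : (0 : ℝ) ∈ Set.Ioo (-(min ε δ)) (min ε δ) := ⟨by linarith, hpos⟩
  refine ⟨fun s => (α s).1, min ε δ, hpos, contDiff_fst.comp_contDiffOn hsm, by simp [hα0], ?_,
    fun t ht => ⟨(hb t (hI t ht).2).1, ?_⟩⟩
  · rw [(hd1 0 h0).deriv, hα0]
  · have e : deriv (fun s => (α s).1) =ᶠ[𝓝 t] fun s => (α s).2 := by
      filter_upwards [isOpen_Ioo.mem_nhds ht] with s hs using (hd1 s hs).deriv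
    rw [e.deriv_eq, (hd2 t ht).deriv, (hd1 t ht).deriv]

end Geodesic

/-! ### `h`-planar curves, equivalent metrics and their connections. -/

section Planar

open Filter Topology

variable {E : Type*} [NormedAddCommGroup E] [NormedSpace ℝ E] [FiniteDimensional ℝ E]
  {M : Type*} [TopologicalSpace M] [ChartedSpace E M] [IsManifold 𝓘(ℝ, E) ∞ M]
  {φ : OpenPartialHomeomorph M E} {y : E}

/-- A geodesic of a chart is `h`-planar. -/
theorem IsKahler.isHPlanar_geodesic {g : Tensor02 E M} {J : Tensor11 E M} (h : IsKahler g J)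
    (hφ : φ ∈ atlas E M) {c : ℝ → E} {I : Set ℝ} (hI : IsOpen I) (hc : ContDiffOn ℝ ∞ c I)
    (hgeo : ∀ t ∈ I, c t ∈ φ.target ∧
      deriv (deriv c) t = -christoffel (loc02 φ g) (c t) (deriv c t) (deriv c t)) :
    IsHPlanar g J I (fun t => φ.symm (c t)) := by
  -- A geodesic is `h`-planar with `α = β = 0`. The equation is required in every chart `ψ`, so the
  -- transformation law of the Christoffel symbols must absorb the second derivative of the
  -- transition map.
  refine ⟨?_, 0, 0, fun ψ hψ t ht hts => ?_⟩
  · exact (contMDiffOn_symm_of_mem_maximalAtlas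
      (IsManifold.subset_maximalAtlas hφ)).comp hc.contMDiffOn (fun t ht => (hgeo t ht).1)
  have hmem : ∀ s ∈ I, φ.symm (c s) ∈ ψ.source → c s ∈ overlap φ ψ := fun s hs hs' =>
    mem_overlap.2 ⟨(hgeo s hs).1, hs'⟩
  have hct : c t ∈ overlap φ ψ := hmem t ht hts
  have hcI : ContDiffAt ℝ ∞ c t := hc.contDiffAt (hI.mem_nhds ht)
  have dc : ∀ s ∈ I, DifferentiableAt ℝ c s := fun s hs =>
    (hc.contDiffAt (hI.mem_nhds hs)).differentiableAt (by simp)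
  have ddc : DifferentiableAt ℝ (deriv c) t := by
    have h1 : ContDiffOn ℝ ∞ (deriv c) I := ((contDiffOn_infty_iff_deriv_of_isOpen hI).1 hc).2
    exact (h1.contDiffAt (hI.mem_nhds ht)).differentiableAt (by simp)
  have hder : ∀ s ∈ I, c s ∈ overlap φ ψ →
      HasDerivAt (fun s => ψ (φ.symm (c s))) (fderiv ℝ (transition φ ψ) (c s) (deriv c s)) s :=
    fun s hs hs' => (((contDiffAt_transition hφ hψ hs').differentiableAt
      (by simp)).hasFDerivAt).comp_hasDerivAt s (dc s hs).hasDerivAt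
  have e : deriv (fun s => ψ (φ.symm (c s))) =ᶠ[𝓝 t]
      fun s => fderiv ℝ (transition φ ψ) (c s) (deriv c s) := by
    filter_upwards [hI.mem_nhds ht,
      hcI.continuousAt.eventually (isOpen_overlap.mem_nhds hct)] with s hs hs'
    exact (hder s hs hs').deriv
  have d2 : HasDerivAt (fun s => fderiv ℝ (transition φ ψ) (c s) (deriv c s))
      (fderiv ℝ (fderiv ℝ (transition φ ψ)) (c t) (deriv c t) (deriv c t)
        + fderiv ℝ (transition φ ψ) (c t) (deriv (deriv c) t)) t := by
    have h1 : HasDerivAt (fun s => fderiv ℝ (transition φ ψ) (c s))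
        (fderiv ℝ (fderiv ℝ (transition φ ψ)) (c t) (deriv c t)) t :=
      ((IsMetricOn.differentiableAt_fderiv
        (contDiffAt_transition hφ hψ hct)).hasFDerivAt).comp_hasDerivAt t (dc t ht).hasDerivAt
    exact h1.clm_apply ddc.hasDerivAt
  rw [e.deriv_eq, d2.deriv, (hder t ht hct).deriv]
  have key := h.christoffel_transition hφ hψ hct (deriv c t) (deriv c t)
  have e2 : transition φ ψ (c t) = ψ (φ.symm (c t)) := rfl
  rw [e2] at key
  rw [(hgeo t ht).2, map_neg, key]
  simp

/-- `h`-projectively equivalent metrics: the difference of the connections on the diagonal. -/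
theorem IsKahler.exists_christoffel_sub {g gbar : Tensor02 E M} {J : Tensor11 E M}
    (h : IsKahler g J) (he : HProjectivelyEquivalent g gbar J) (hφ : φ ∈ atlas E M)
    (hy : y ∈ φ.target) (u : E) : ∃ α β : ℝ,
      christoffelDiff (loc02 φ g) (loc02 φ gbar) y u u = α • u + β • loc11 φ J y u := by
  obtain ⟨c, ε, hε, hc, hc0, hc1, hgeo⟩ := (h.isKahlerOn hφ).exists_geodesic hy u
  have hI : IsOpen (Set.Ioo (-ε) ε) := isOpen_Ioo
  have h0 : (0 : ℝ) ∈ Set.Ioo (-ε) ε := ⟨by linarith, hε⟩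
  -- The `g`-geodesic with velocity `u` at `y` is `h`-planar for `gbar`; at time `0` its
  -- acceleration is `-Γ(u,u)`, so the `gbar`-equation exhibits the difference of the connections.
  have hpl := (he _ hI Set.ordConnected_Ioo _).1 (h.isHPlanar_geodesic hφ hI hc hgeo)
  obtain ⟨-, α, β, hαβ⟩ := hpl
  have key := hαβ φ hφ 0 h0 (φ.map_target (hgeo 0 h0).1)
  have e : (fun s => φ (φ.symm (c s))) =ᶠ[𝓝 0] c := by
    filter_upwards [hI.mem_nhds h0] with s hs using φ.right_inv (hgeo s hs).1
  rw [e.deriv.deriv_eq, e.deriv_eq, φ.right_inv (hgeo 0 h0).1, (hgeo 0 h0).2, hc0, hc1] at key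
  exact ⟨α 0, β 0, by rw [christoffelDiff_apply, ← key]; abel⟩

/-- Both connections are torsion-free and make `J` parallel, so their difference is symmetric and
complex bilinear; on the diagonal it stays in the complex line of `u`. -/
theorem IsKahler.exists_form_of_equivalent {g gbar : Tensor02 E M} {J : Tensor11 E M}
    (h : IsKahler g J) (hb : IsKahler gbar J) (he : HProjectivelyEquivalent g gbar J)
    (hφ : φ ∈ atlas E M) (hy : y ∈ φ.target) : ∃ ψ : E →ₗ[ℝ] ℝ, ∀ u v,
      christoffelDiff (loc02 φ g) (loc02 φ gbar) y u v = ψ u • v + ψ v • u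
        - ψ (loc11 φ J y u) • loc11 φ J y v - ψ (loc11 φ J y v) • loc11 φ J y u := by
  have k := h.isKahlerOn hφ
  have kb := hb.isKahlerOn hφ
  let P : E →ₗ[ℝ] E →ₗ[ℝ] E :=
    { toFun := fun w => christoffelDiff (loc02 φ g) (loc02 φ gbar) y w
      map_add' := fun w w' => by
        ext u
        simp only [LinearMap.add_apply, christoffelDiff_apply, christoffel_add_left]
        abel
      map_smul' := fun r w => by
        ext u
        simp only [LinearMap.smul_apply, christoffelDiff_apply, christoffel_smul_left,
          RingHom.id_apply, smul_sub] }
  exact exists_form_of_apply_self P (loc11 φ J y).toLinearMap (k.complex_sq y hy)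
    (fun u v => by
      change christoffelDiff _ _ y u v = christoffelDiff _ _ y v u
      rw [christoffelDiff_apply, christoffelDiff_apply, k.christoffel_symm hy,
        kb.christoffel_symm hy])
    (fun u v => by
      change christoffelDiff _ _ y u (loc11 φ J y v) = loc11 φ J y (christoffelDiff _ _ y u v)
      rw [christoffelDiff_apply, christoffelDiff_apply, k.christoffel_add_complex hy,
        kb.christoffel_add_complex hy, map_sub]
      abel)
    (fun u => h.exists_christoffel_sub he hφ hy u)

/-- The logarithm of the ratio of the volume forms, normalized. -/
noncomputable def volumePotential (g gbar : Tensor02 E M) (x : M) : ℝ :=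
  (2 * (Module.finrank ℝ E + 2 : ℝ))⁻¹ * Real.log (LinearMap.det (raise g gbar x).toLinearMap)

theorem volumePotential_symm {g : Tensor02 E M} (hg : ∀ x u, (∀ v, g x u v = 0) → u = 0)
    (hφ : φ ∈ atlas E M) (hy : y ∈ φ.target) (gbar : Tensor02 E M) :
    volumePotential g gbar (φ.symm y) = (2 * (Module.finrank ℝ E + 2 : ℝ))⁻¹ *
      Real.log (LinearMap.det ((loc02 φ g y).inverse ∘L loc02 φ gbar y).toLinearMap) := by
  rw [loc02_eq_bilinearComp hφ hy, loc02_eq_bilinearComp hφ hy, det_bilinearComp]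
  · rfl
  · exact hg (φ.symm y)

theorem contDiffOn_volumePotential {g gbar : Tensor02 E M} {J : Tensor11 E M}
    (h : IsKahler g J) (hb : IsKahler gbar J) (hφ : φ ∈ atlas E M) :
    ContDiffOn ℝ ∞ (fun z => volumePotential g gbar (φ.symm z)) φ.target := by
  have k := h.isKahlerOn hφ
  have kb := hb.isKahlerOn hφ
  have h1 : ContDiffOn ℝ ∞ (fun z => (2 * (Module.finrank ℝ E + 2 : ℝ))⁻¹ *
      Real.log (LinearMap.det ((loc02 φ g z).inverse ∘L loc02 φ gbar z).toLinearMap))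
      φ.target := by
    refine contDiffOn_const.mul (ContDiffOn.log ?_ fun z hz => det_inverse_comp_ne_zero
      (k.nondegenerate z hz) (kb.nondegenerate z hz))
    exact contDiff_det.comp_contDiffOn (k.contDiffOn_inverse.clm_comp kb.smooth)
  exact h1.congr fun z hz => volumePotential_symm h.nondegenerate hφ hz gbar

/-- Explains the normalization of `volumePotential`: the logarithmic derivative of the determinant
is twice this trace, that is `2(N + 2)ψ`. `Real.log` is the logarithm of the absolute value, so the
sign of the determinant plays no role. -/
theorem trace_christoffelDiff {P J : E →ₗ[ℝ] E} {ψ : E →ₗ[ℝ] ℝ} {w : E}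
    (hJ : ∀ u, J (J u) = -u) (hJt : LinearMap.trace ℝ E J = 0)
    (hP : ∀ v, P v = ψ w • v + ψ v • w - ψ (J w) • J v - ψ (J v) • J w) :
    LinearMap.trace ℝ E P = (Module.finrank ℝ E + 2) * ψ w := by
  have : P = ψ w • LinearMap.id + ψ.smulRight w - ψ (J w) • J - (ψ ∘ₗ J).smulRight (J w) := by
    ext v; simp [hP]
  rw [this]
  simp only [map_add, map_sub, map_smul, LinearMap.trace_id, LinearMap.trace_smulRight, hJt,
    LinearMap.comp_apply, hJ, map_neg, smul_eq_mul]
  ring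

theorem IsKahlerOn.trace_complex {G : E → E →L[ℝ] E →L[ℝ] ℝ} {J : E → E →L[ℝ] E} {U : Set E}
    (h : IsKahlerOn G J U) (hy : y ∈ U) : LinearMap.trace ℝ E (J y).toLinearMap = 0 := by
  have := trace_eq_of_adjoint (h.nondegenerate y hy) (S := (J y).toLinearMap)
    (S' := -(J y).toLinearMap) (by intro u v; simp [h.skew hy])
  rw [map_neg] at this; linarith

/-- The difference of the connections of `h`-projectively equivalent metrics is determined by the
differential of the volume potential. -/
theorem IsKahler.christoffelDiff_eq {g gbar : Tensor02 E M} {J : Tensor11 E M}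
    (h : IsKahler g J) (hb : IsKahler gbar J) (he : HProjectivelyEquivalent g gbar J)
    (hφ : φ ∈ atlas E M) (hy : y ∈ φ.target) {Ψ : E →L[ℝ] ℝ}
    (hΨ : Ψ = fderiv ℝ (fun z => volumePotential g gbar (φ.symm z)) y) (u v : E) :
    christoffelDiff (loc02 φ g) (loc02 φ gbar) y u v = Ψ u • v + Ψ v • u
        - Ψ (loc11 φ J y u) • loc11 φ J y v - Ψ (loc11 φ J y v) • loc11 φ J y u := by
  have k := h.isKahlerOn hφ
  have kb := hb.isKahlerOn hφ
  obtain ⟨ψ, hψ⟩ := h.exists_form_of_equivalent hb he hφ hy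
  have hψΨ : ∀ w, ψ w = Ψ w := by
    intro w
    have e : (fun z => volumePotential g gbar (φ.symm z)) =ᶠ[𝓝 y] fun z =>
        (2 * (Module.finrank ℝ E + 2 : ℝ))⁻¹ * Real.log
          (LinearMap.det ((loc02 φ g z).inverse ∘L loc02 φ gbar z).toLinearMap) := by
      filter_upwards [φ.open_target.mem_nhds hy] with z hz using
        volumePotential_symm h.nondegenerate hφ hz gbar
    have d : DifferentiableAt ℝ (fun z => Real.log
          (LinearMap.det ((loc02 φ g z).inverse ∘L loc02 φ gbar z).toLinearMap)) y := by
      refine DifferentiableAt.log ?_ (det_inverse_comp_ne_zero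
        (k.nondegenerate y hy) (kb.nondegenerate y hy))
      exact differentiableAt_of_smoothOn
        (contDiff_det.comp_contDiffOn (k.contDiffOn_inverse.clm_comp kb.smooth)) k.isOpen hy
    rw [hΨ, e.fderiv_eq, fderiv_const_mul d, smul_apply, smul_eq_mul,
      fderiv_log_det_ratio k.toIsMetricOn kb.toIsMetricOn hy,
      trace_christoffelDiff (J := (loc11 φ J y).toLinearMap) (ψ := ψ) (w := w)
        (k.complex_sq y hy) (k.trace_complex hy) (hψ w)]
    have : (Module.finrank ℝ E + 2 : ℝ) ≠ 0 := by positivity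
    field_simp
  rw [hψ, hψΨ, hψΨ, hψΨ, hψΨ]

/-- The solution of the `h`-projective equation of `g` that is defined by `gbar`. -/
noncomputable def equivalentTensor (g gbar : Tensor02 E M) : Tensor02 E M := fun x =>
  Real.exp (2 * volumePotential g gbar x) • (modelForm g x ∘L raise gbar g x)

/-- The differential of a function at a point, on the model space. -/
noncomputable def modelDifferential (f : M → ℝ) (x : M) : E →L[ℝ] ℝ :=
  mfderiv 𝓘(ℝ, E) 𝓘(ℝ, ℝ) f x

/-- The one-form of the solution that is defined by `gbar`. -/
noncomputable def equivalentForm (g gbar : Tensor02 E M) : Tensor01 E M := fun x =>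
  (-Real.exp (2 * volumePotential g gbar x)) •
    (modelDifferential (volumePotential g gbar) x ∘L raise gbar g x)

theorem frame_inverse {g gbar : Tensor02 E M} (hb : ∀ x u, (∀ v, gbar x u v = 0) → u = 0)
    (hφ : φ ∈ atlas E M) (hy : y ∈ φ.target) (u : E) :
    frameEquiv hφ hy ((loc02 φ gbar y).inverse (loc02 φ g y u))
      = raise gbar g (φ.symm y) (frameEquiv hφ hy u) := by
  have h1 := inverse_comp_bilinearComp (B := modelForm gbar (φ.symm y))
    (A := modelForm g (φ.symm y)) (hb (φ.symm y)) (frameEquiv hφ hy)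
  have h2 := congrArg (fun f => f u) h1
  change (loc02 φ gbar y).inverse (loc02 φ g y u)
    = (frameEquiv hφ hy).symm (raise gbar g (φ.symm y) (frameEquiv hφ hy u)) at h2
  rw [h2, ContinuousLinearEquiv.apply_symm_apply]

theorem loc02_equivalentTensor {g gbar : Tensor02 E M}
    (hb : ∀ x u, (∀ v, gbar x u v = 0) → u = 0) (hφ : φ ∈ atlas E M) (hy : y ∈ φ.target) :
    loc02 φ (equivalentTensor g gbar) y = Real.exp (2 * volumePotential g gbar (φ.symm y)) •
      (loc02 φ g y ∘L ((loc02 φ gbar y).inverse ∘L loc02 φ g y)) := by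
  ext u v
  change Real.exp (2 * volumePotential g gbar (φ.symm y)) *
    modelForm g (φ.symm y) (raise gbar g (φ.symm y) (frameEquiv hφ hy u)) (frameEquiv hφ hy v)
    = Real.exp (2 * volumePotential g gbar (φ.symm y)) *
    modelForm g (φ.symm y) (frameEquiv hφ hy ((loc02 φ gbar y).inverse (loc02 φ g y u)))
      (frameEquiv hφ hy v)
  rw [frame_inverse hb hφ hy]

theorem mfderiv_comp_frame {f : M → ℝ} (hφ : φ ∈ atlas E M) (hy : y ∈ φ.target)
    (hf : DifferentiableAt ℝ (fun z => f (φ.symm z)) y) (u : E) :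
    modelDifferential f (φ.symm y) (frameEquiv hφ hy u)
      = fderiv ℝ (fun z => f (φ.symm z)) y u := by
  have hx : φ.symm y ∈ φ.source := φ.map_target hy
  have hd : MDifferentiableAt 𝓘(ℝ, E) 𝓘(ℝ, ℝ) f (φ.symm y) := by
    have h1 : MDifferentiableAt 𝓘(ℝ, E) 𝓘(ℝ, ℝ) (fun z => f (φ.symm z)) (φ (φ.symm y)) := by
      rw [φ.right_inv hy]; exact hf.mdifferentiableAt
    have h2 := h1.comp (φ.symm y) ((mdifferentiable_chart hφ).mdifferentiableAt hx)
    refine h2.congr_of_eventuallyEq ?_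
    filter_upwards [φ.open_source.mem_nhds hx] with z hz
    simp [φ.left_inv hz]
  have := mfderiv_comp y hd ((mdifferentiable_chart hφ).mdifferentiableAt_symm hy)
  rw [← mfderiv_eq_fderiv]
  exact (congrArg (fun f : E →L[ℝ] ℝ => f u) this).symm

theorem loc01_equivalentForm {g gbar : Tensor02 E M} {J : Tensor11 E M}
    (h : IsKahler g J) (hb : IsKahler gbar J) (hφ : φ ∈ atlas E M) (hy : y ∈ φ.target) :
    loc01 φ (equivalentForm g gbar) y = (-Real.exp (2 * volumePotential g gbar (φ.symm y))) •
      (fderiv ℝ (fun z => volumePotential g gbar (φ.symm z)) y ∘L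
        ((loc02 φ gbar y).inverse ∘L loc02 φ g y)) := by
  have hd := differentiableAt_of_smoothOn (contDiffOn_volumePotential h hb hφ) φ.open_target hy
  ext u
  change (-Real.exp (2 * volumePotential g gbar (φ.symm y))) *
    modelDifferential (volumePotential g gbar) (φ.symm y)
      (raise gbar g (φ.symm y) (frameEquiv hφ hy u))
    = (-Real.exp (2 * volumePotential g gbar (φ.symm y))) *
      fderiv ℝ (fun z => volumePotential g gbar (φ.symm z)) y
        ((loc02 φ gbar y).inverse (loc02 φ g y u))
  rw [← frame_inverse hb.nondegenerate hφ hy, mfderiv_comp_frame hφ hy hd]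

/-- With `df = ψ` known from `christoffelDiff_eq`, the equation is `covDeriv02_equivalent` in each
chart; symmetry and invariance under `J` follow because `gbar⁻¹ g` is self-adjoint and commutes with
`J`. -/
theorem IsKahler.isHprSolution_equivalent {g gbar : Tensor02 E M} {J : Tensor11 E M}
    (h : IsKahler g J) (hb : IsKahler gbar J) (he : HProjectivelyEquivalent g gbar J) :
    IsHprSolution g J (equivalentTensor g gbar) (equivalentForm g gbar) := by
  have hraise : ∀ x u v, modelForm gbar x (raise gbar g x u) v = modelForm g x u v := fun x u v => by
    have := apply_inverse (G := modelForm gbar x) (hb.nondegenerate x) (modelForm g x u)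
    exact congrArg (fun f => f v) this
  have gs : ∀ x u v, modelForm g x u v = modelForm g x v u := h.symm
  have gbs : ∀ x u v, modelForm gbar x u v = modelForm gbar x v u := hb.symm
  have hsm : ∀ φ ∈ atlas E M, ContDiffOn ℝ ∞ (fun z => (loc02 φ gbar z).inverse ∘L loc02 φ g z)
      φ.target := fun φ hφ =>
    ((hb.isKahlerOn hφ).contDiffOn_inverse.clm_comp (h.isKahlerOn hφ).smooth)
  have hexp : ∀ φ ∈ atlas E M, ContDiffOn ℝ ∞
      (fun z => Real.exp (2 * volumePotential g gbar (φ.symm z))) φ.target := fun φ hφ =>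
    (contDiffOn_const.mul (contDiffOn_volumePotential h hb hφ)).exp
  have hsymm : ∀ x u v, (equivalentTensor g gbar x : E →L[ℝ] E →L[ℝ] ℝ) u v
      = (equivalentTensor g gbar x : E →L[ℝ] E →L[ℝ] ℝ) v u := by
    intro x (u : E) (v : E)
    change Real.exp _ * modelForm g x (raise gbar g x u) v
      = Real.exp _ * modelForm g x (raise gbar g x v) u
    rw [gs x _ v, ← hraise, gs x _ u, ← hraise x u, gbs]
  let K : M → E →L[ℝ] E := fun x => J x
  have gK : ∀ x u v, modelForm g x (K x u) (K x v) = modelForm g x u v := h.hermitian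
  have gbK : ∀ x u v, modelForm gbar x (K x u) (K x v) = modelForm gbar x u v := hb.hermitian
  have hK : ∀ x u, K x (K x u) = -u := h.complex_sq
  have hraiseK : ∀ x u, raise gbar g x (K x u) = K x (raise gbar g x u) := by
    intro x u
    rw [← sub_eq_zero]
    refine hb.nondegenerate x _ fun (v : E) => ?_
    change modelForm gbar x (raise gbar g x (K x u) - K x (raise gbar g x u)) v = 0
    rw [map_sub, sub_apply, hraise, ← gK, hK, ← gbK x (K x _), hK, map_neg, map_neg, neg_apply,
      neg_apply, hraise, sub_self]
  refine ⟨fun φ hφ => ?_, fun φ hφ => ?_, hsymm, ?_, fun φ hφ y hy w u v => ?_⟩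
  · exact ((hexp φ hφ).smul ((h.smooth_metric φ hφ).clm_comp (hsm φ hφ))).congr fun z hz =>
      loc02_equivalentTensor hb.nondegenerate hφ hz
  · have hf := (contDiffOn_volumePotential h hb hφ).fderiv_of_isOpen (m := ∞) φ.open_target
      (by simp)
    exact ((hexp φ hφ).neg.smul (hf.clm_comp (hsm φ hφ))).congr fun z hz =>
      loc01_equivalentForm h hb hφ hz
  · intro x (u : E) (v : E)
    change Real.exp _ * modelForm g x (raise gbar g x (K x u)) (K x v)
      = Real.exp _ * modelForm g x (raise gbar g x u) v
    rw [hraiseK, gK]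
  · have k := h.isKahlerOn hφ
    have kb := hb.isKahlerOn hφ
    have e : loc02 φ (equivalentTensor g gbar) =ᶠ[𝓝 y] fun z =>
        Real.exp (2 * volumePotential g gbar (φ.symm z)) •
          (loc02 φ g z ∘L ((loc02 φ gbar z).inverse ∘L loc02 φ g z)) := by
      filter_upwards [φ.open_target.mem_nhds hy] with z hz using
        loc02_equivalentTensor hb.nondegenerate hφ hz
    have key := covDeriv02_equivalent k kb hy
      (f := fun z => volumePotential g gbar (φ.symm z))
      (differentiableAt_of_smoothOn (contDiffOn_volumePotential h hb hφ) φ.open_target hy)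
      (h.christoffelDiff_eq hb he hφ hy rfl) w u v
    rw [covDeriv02, e.fderiv_eq, e.self_of_nhds, loc01_equivalentForm h hb hφ hy]
    rw [covDeriv02] at key
    rw [key]
    simp only [smul_apply, ContinuousLinearMap.comp_apply, smul_eq_mul]
    ring

/-- The form is `df` composed with the invertible `gbar⁻¹ g`, up to a nonzero factor, so `df = 0`
and the difference of the connections vanishes with it. -/
theorem IsKahler.affinelyEquivalent_of_form_eq_zero {g gbar : Tensor02 E M} {J : Tensor11 E M}
    (h : IsKahler g J) (hb : IsKahler gbar J) (he : HProjectivelyEquivalent g gbar J)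
    (h0 : ∀ x, equivalentForm g gbar x = 0) : AffinelyEquivalent g gbar := by
  intro φ hφ y hy u v
  have h1 := (loc01_eq_zero_iff hφ hy _).2 (h0 (φ.symm y))
  rw [loc01_equivalentForm h hb hφ hy] at h1
  have h2 := (smul_eq_zero.1 h1).resolve_left (neg_ne_zero.2 (Real.exp_pos _).ne')
  have h3 : (0 : E →L[ℝ] ℝ) = fderiv ℝ (fun z => volumePotential g gbar (φ.symm z)) y := by
    ext w
    have h4 := congrArg (fun f => f ((loc02 φ g y).inverse (loc02 φ gbar y w))) h2
    simp only [ContinuousLinearMap.comp_apply] at h4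
    rw [apply_inverse ((h.isKahlerOn hφ).nondegenerate y hy),
      inverse_apply ((hb.isKahlerOn hφ).nondegenerate y hy)] at h4
    exact h4.symm
  have h5 := h.christoffelDiff_eq hb he hφ hy h3 u v
  rw [christoffelDiff_apply] at h5
  simp only [zero_apply, zero_smul, add_zero, sub_zero] at h5
  exact (sub_eq_zero.1 h5).symm

end Planar
end HProj

theorem theorem4
    {E : Type*} [NormedAddCommGroup E] [NormedSpace ℝ E] [FiniteDimensional ℝ E]
    {M : Type*} [TopologicalSpace M] [ChartedSpace E M] [IsManifold 𝓘(ℝ, E) ∞ M]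
    [T2Space M] [CompactSpace M] [ConnectedSpace M]
    (hdim : 4 ≤ Module.finrank ℝ E)
    (g : HProj.Tensor02 E M) (J : HProj.Tensor11 E M) (hgJ : HProj.IsKahler g J)
    (hD : 3 ≤ HProj.degreeOfMobility g J)
    (hB : HProj.IsExtendedConstant g J 0) :
    (∀ (a : HProj.Tensor02 E M) (lam : HProj.Tensor01 E M),
      HProj.IsHprSolution g J a lam → ∀ x, lam x = 0) ∧
    (∀ gbar : HProj.Tensor02 E M, HProj.IsKahler gbar J →
      HProj.HProjectivelyEquivalent g gbar J → HProj.AffinelyEquivalent g gbar) := by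
  have key : ∀ (a : HProj.Tensor02 E M) (lam : HProj.Tensor01 E M),
      HProj.IsHprSolution g J a lam → ∀ x, lam x = 0 := fun _ _ hs x =>
    hgJ.form_eq_zero_of_extendedConstant hB hs x
  exact ⟨key, fun _ hb he => hgJ.affinelyEquivalent_of_form_eq_zero hb he
    (key _ _ (hgJ.isHprSolution_equivalent hb he))⟩
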